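/- Let $(M,g)$ be a four-dimensional spacetime (a smooth manifold with a smooth Lorentzian metric of signature $(-,+,+,+)$) with Weyl tensor $W$, let ${*W}$ be the Hodge dual of $W$, and let $$T_{\alpha\mu\beta\nu}=\tfrac14\left(W_{\alpha}{}^{\rho}{}_{\beta}{}^{\sigma}W_{\mu\rho\nu\sigma}+{*W}_{\alpha}{}^{\rho}{}_{\beta}{}^{\sigma}\,{*W}_{\mu\rho\nu\sigma}\right)$$ be the Bel-Robinson tensor. An observer at a point $p$ is a vector $u\in T_pM$ with $g(u,u)=-1$; for a tensor $A$, $A_\perp$ denotes its orthogonal projection by $\gamma=u\otimes u+g$. Relative to $u$, the super-Poynting vector is $q_\perp=-T(u,u,u)_\perp$, the super-stress tensor is $t_\perp=T(u,u)_\perp$ and the stress flux tensor is $Q_\perp=-T(u)_\perp$. The field is super-energy (García-Parrado) radiative at $p$ if $Q_\perp\neq0$ for every observer $u$ at $p$, and non-radiative otherwise. An observer is at rest with respect to the field if $q_\perp=0$; the principal super-stresses are the eigenvalues of $t_\perp$, as a tensor on the space $u^\perp$, for $u$ at rest. The spacetime is of (Petrov-Bel) type I at $p$ if $W$, acting on the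 complex three-dimensional space of self-dual bivectors at $p$, has three distinct eigenvalues. A null Debever direction is a line spanned by a null vector $\ell\neq0$ with $\ell_{[e}W_{a]bc[d}\ell_{f]}\ell^b\ell^c=0$. Proposition. Suppose that the spacetime is of type I at $p$. Then there are exactly four null Debever directions at $p$, and the field is super-energy non-radiative at $p$ if and only if these four directions span a 3-plane, that is, a three-dimensional subspace of $T_pM$. Moreover, if they span a 3-plane, then observers at rest exist at $p$, and for every observer at rest the direction orthogonal to this 3-plane is exactly the eigenspace in $u^\perp$ of the proper super-stress tensor $t_\perp$ associated with the largest principal super-stress. -/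

import Mathlib

open scoped Manifold ContDiff BigOperators

noncomputable section

namespace SuperEnergy

/-! ## Algebra at a point

Tensors at a point are written in components with respect to a basis of the tangent space: `g` is
the matrix `g_{ab}` of a metric of signature `(-,+,+,+)`, vectors have upper indices and the tensors
`Tensor4` below are covariant.  -/

/-- Components `v^a` of a tangent vector. -/
abbrev Vec : Type := Fin 4 → ℝ

/-- Components `A_{abcd}` of a covariant tensor of order four. -/
abbrev Tensor4 : Type := Fin 4 → Fin 4 → Fin 4 → Fin 4 → ℝ

/-- The product `g(v, w) = g_{ab} v^a w^b`. -/
def metricProd (g : Matrix (Fin 4) (Fin 4) ℝ) (v w : Vec) : ℝ :=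
  ∑ a, ∑ b, g a b * v a * w b

/-- Lowering of an index, `v_a = g_{ab} v^b`. -/
def lower (g : Matrix (Fin 4) (Fin 4) ℝ) (v : Vec) (a : Fin 4) : ℝ :=
  ∑ b, g a b * v b

/-- The Levi-Civita symbol `ε_{abcd}`, with `ε_{0123} = 1`. -/
def leviCivita (a b c d : Fin 4) : ℝ :=
  Matrix.det (Matrix.of fun i j : Fin 4 => if ![a, b, c, d] i = j then (1 : ℝ) else 0)

/-- The metric volume element `η_{abcd} = √|det g| ε_{abcd}`. -/
def volumeForm (g : Matrix (Fin 4) (Fin 4) ℝ) : Tensor4 := fun a b c d =>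
  Real.sqrt |g.det| * leviCivita a b c d

/-- The mixed tensor `η_{ab}{}^{cd}`. -/
def volumeMixed (g : Matrix (Fin 4) (Fin 4) ℝ) (a b c d : Fin 4) : ℝ :=
  ∑ e, ∑ f, volumeForm g a b e f * g⁻¹ e c * g⁻¹ f d

/-- The Hodge dual `(*W)_{abcd} = ½ η_{ab}{}^{ef} W_{efcd}`. -/
def hodgeDual (g : Matrix (Fin 4) (Fin 4) ℝ) (W : Tensor4) : Tensor4 := fun a b c d =>
  (1 / 2) * ∑ e, ∑ f, volumeMixed g a b e f * W e f c d

/-- The Bel-Robinson tensor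
`T_{ambn} = ¼ (W_a{}^r{}_b{}^s W_{mrns} + *W_a{}^r{}_b{}^s *W_{mrns})`. -/
def belRobinson (g : Matrix (Fin 4) (Fin 4) ℝ) (W : Tensor4) : Tensor4 := fun a m b n =>
  (1 / 4) * ∑ r, ∑ s, ∑ r', ∑ s', g⁻¹ r r' * g⁻¹ s s' *
    (W a r b s * W m r' n s' + hodgeDual g W a r b s * hodgeDual g W m r' n s')

/-! ### Petrov-Bel type -/

/-- A complex 2-form `X` is self-dual if `½ η_{ab}{}^{cd} X_{cd} = i X_{ab}`. -/
def IsSelfDualBivector (g : Matrix (Fin 4) (Fin 4) ℝ) (X : Fin 4 → Fin 4 → ℂ) : Prop :=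
  (∀ a b, X a b = -X b a) ∧
    ∀ a b, (1 / 2) * ∑ c, ∑ d, (volumeMixed g a b c d : ℂ) * X c d = Complex.I * X a b

/-- The endomorphism `X ↦ W(X)` of the 2-forms, `W(X)_{ab} = ½ W_{ab}{}^{cd} X_{cd}`. -/
def weylMap (g : Matrix (Fin 4) (Fin 4) ℝ) (W : Tensor4) (X : Fin 4 → Fin 4 → ℂ) :
    Fin 4 → Fin 4 → ℂ := fun a b =>
  (1 / 2) * ∑ e, ∑ f, ∑ c, ∑ d, ((W a b e f * g⁻¹ e c * g⁻¹ f d : ℝ) : ℂ) * X c d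

/-- `ρ` is an eigenvalue of the Weyl tensor acting on the complex three-dimensional space of
self-dual bivectors. -/
def IsWeylEigenvalue (g : Matrix (Fin 4) (Fin 4) ℝ) (W : Tensor4) (ρ : ℂ) : Prop :=
  ∃ X : Fin 4 → Fin 4 → ℂ, X ≠ 0 ∧ IsSelfDualBivector g X ∧
    ∀ a b, weylMap g W X a b = ρ * X a b

/-- Petrov-Bel type I: the Weyl tensor has three distinct eigenvalues on the self-dual bivectors. -/
def IsTypeI (g : Matrix (Fin 4) (Fin 4) ℝ) (W : Tensor4) : Prop :=
  ∃ ρ : Fin 3 → ℂ, Function.Injective ρ ∧ ∀ k, IsWeylEigenvalue g W (ρ k)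

/-! ### Null Debever directions -/

/-- A null Debever vector: a non-zero null vector `ℓ` with
`ℓ_{[e} W_{a]bc[d} ℓ_{f]} ℓ^b ℓ^c = 0`. -/
def IsDebeverVector (g : Matrix (Fin 4) (Fin 4) ℝ) (W : Tensor4) (ℓ : Vec) : Prop :=
  ℓ ≠ 0 ∧ metricProd g ℓ ℓ = 0 ∧
    ∀ e a d f, ∑ b, ∑ c,
      (lower g ℓ e * W a b c d * lower g ℓ f - lower g ℓ a * W e b c d * lower g ℓ f
        - lower g ℓ e * W a b c f * lower g ℓ d + lower g ℓ a * W e b c f * lower g ℓ d)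
        * ℓ b * ℓ c = 0

/-- The null Debever directions: the lines spanned by null Debever vectors. -/
def debeverDirections (g : Matrix (Fin 4) (Fin 4) ℝ) (W : Tensor4) : Set (Submodule ℝ Vec) :=
  {L | ∃ ℓ : Vec, IsDebeverVector g W ℓ ∧ L = Submodule.span ℝ {ℓ}}

/-- The subspace spanned by the null Debever directions. -/
def debeverSpan (g : Matrix (Fin 4) (Fin 4) ℝ) (W : Tensor4) : Submodule ℝ Vec :=
  sSup (debeverDirections g W)

/-! ### Relative super-energy quantities -/

/-- An observer is a unit timelike vector. -/
def IsObserver (g : Matrix (Fin 4) (Fin 4) ℝ) (u : Vec) : Prop :=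
  metricProd g u u = -1

/-- The projector `γ_a{}^b = δ_a^b + u_a u^b` orthogonal to `u`. -/
def projector (g : Matrix (Fin 4) (Fin 4) ℝ) (u : Vec) (a b : Fin 4) : ℝ :=
  (if a = b then 1 else 0) + lower g u a * u b

/-- The super-Poynting vector `q_⊥ = -T(u,u,u)_⊥` (as a covector). -/
def superPoynting (g : Matrix (Fin 4) (Fin 4) ℝ) (W : Tensor4) (u : Vec) (a : Fin 4) : ℝ :=
  -∑ a', projector g u a a' * ∑ b, ∑ c, ∑ d, belRobinson g W a' b c d * u b * u c * u d

/-- The super-stress tensor `t_⊥ = T(u,u)_⊥`. -/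
def superStress (g : Matrix (Fin 4) (Fin 4) ℝ) (W : Tensor4) (u : Vec) (a b : Fin 4) : ℝ :=
  ∑ a', ∑ b', projector g u a a' * projector g u b b' *
    ∑ c, ∑ d, belRobinson g W a' b' c d * u c * u d

/-- The stress flux tensor `Q_⊥ = -T(u)_⊥`. -/
def stressFlux (g : Matrix (Fin 4) (Fin 4) ℝ) (W : Tensor4) (u : Vec) (a b c : Fin 4) : ℝ :=
  -∑ a', ∑ b', ∑ c', projector g u a a' * projector g u b b' * projector g u c c' *
    ∑ d, belRobinson g W a' b' c' d * u d

/-- Intrinsic super-energy radiation (García-Parrado): the stress flux tensor does not vanish for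
any observer. -/
def IsSuperEnergyRadiative (g : Matrix (Fin 4) (Fin 4) ℝ) (W : Tensor4) : Prop :=
  ∀ u : Vec, IsObserver g u → ∃ a b c, stressFlux g W u a b c ≠ 0

/-- An observer at rest with respect to the field: the super-Poynting vector vanishes. -/
def IsAtRest (g : Matrix (Fin 4) (Fin 4) ℝ) (W : Tensor4) (u : Vec) : Prop :=
  IsObserver g u ∧ ∀ a, superPoynting g W u a = 0

/-- The eigenspace of the super-stress tensor relative to `u` for `κ`: the vectors `v` orthogonal to
`u` with `(t_⊥)_{ab} v^b = κ v_a`. -/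
def superStressEigenspace (g : Matrix (Fin 4) (Fin 4) ℝ) (W : Tensor4) (u : Vec) (κ : ℝ) :
    Submodule ℝ Vec where
  carrier := {v | metricProd g u v = 0 ∧ ∀ a, ∑ b, superStress g W u a b * v b = κ * lower g v a}
  zero_mem' := by simp [metricProd, lower]
  add_mem' := by
    rintro v w ⟨hv, hv'⟩ ⟨hw, hw'⟩
    refine ⟨?_, fun a => ?_⟩
    · simp only [metricProd, Pi.add_apply, mul_add, Finset.sum_add_distrib] at *
      rw [hv, hw, add_zero]
    · have h1 := hv' a
      have h2 := hw' a
      simp only [lower, Pi.add_apply, mul_add, Finset.sum_add_distrib] at *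
      rw [h1, h2]
  smul_mem' := by
    rintro r v ⟨hv, hv'⟩
    refine ⟨?_, fun a => ?_⟩
    · have h : metricProd g u (r • v) = r * metricProd g u v := by
        simp only [metricProd, Pi.smul_apply, smul_eq_mul, Finset.mul_sum]
        exact Finset.sum_congr rfl fun _ _ => Finset.sum_congr rfl fun _ _ => by ring
      rw [h, hv, mul_zero]
    · have h : lower g (r • v) a = r * lower g v a := by
        simp only [lower, Pi.smul_apply, smul_eq_mul, Finset.mul_sum]
        exact Finset.sum_congr rfl fun _ _ => by ring
      have h' : ∑ b, superStress g W u a b * (r • v) b =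
          r * ∑ b, superStress g W u a b * v b := by
        simp only [Pi.smul_apply, smul_eq_mul, Finset.mul_sum]
        exact Finset.sum_congr rfl fun _ _ => by ring
      rw [h, h', hv' a]
      ring

/-- The eigenvalues of the super-stress tensor relative to `u`, as a tensor on the space orthogonal
to `u`. When `u` is at rest these are the principal super-stresses. -/
def principalSuperStresses (g : Matrix (Fin 4) (Fin 4) ℝ) (W : Tensor4) (u : Vec) : Set ℝ :=
  {κ | superStressEigenspace g W u κ ≠ ⊥}

/-- The subspace orthogonal to `S` with respect to `g`. -/
def orthogonalSpace (g : Matrix (Fin 4) (Fin 4) ℝ) (S : Submodule ℝ Vec) : Submodule ℝ Vec where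
  carrier := {v | ∀ w ∈ S, metricProd g w v = 0}
  zero_mem' := by simp [metricProd]
  add_mem' := by
    intro v v' hv hv' w hw
    have h1 := hv w hw
    have h2 := hv' w hw
    simp only [metricProd, Pi.add_apply, mul_add, Finset.sum_add_distrib] at *
    rw [h1, h2, add_zero]
  smul_mem' := by
    intro r v hv w hw
    have h : metricProd g w (r • v) = r * metricProd g w v := by
      simp only [metricProd, Pi.smul_apply, smul_eq_mul, Finset.mul_sum]
      exact Finset.sum_congr rfl fun _ _ => Finset.sum_congr rfl fun _ _ => by ring
    rw [h, hv w hw, mul_zero]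

/-! ## Spacetimes and their Weyl tensor -/

/-- The model space of a four-dimensional manifold. -/
abbrev E4 : Type := EuclideanSpace ℝ (Fin 4)

/-- The coordinate vector `e_i` of the model space. -/
def coordVec (i : Fin 4) : E4 := EuclideanSpace.single i 1

/-- A smooth Lorentzian metric, of signature `(-,+,+,+)`, on a four-dimensional manifold. -/
structure LorentzMetric (M : Type*) [TopologicalSpace M] [ChartedSpace E4 M]
    [IsManifold (𝓡 4) ∞ M] where
  /-- The scalar product on each tangent space. -/
  val (x : M) : TangentSpace (𝓡 4) x →L[ℝ] TangentSpace (𝓡 4) x →L[ℝ] ℝ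
  symm (x : M) (v w : TangentSpace (𝓡 4) x) : val x v w = val x w v
  /-- There are orthonormal frames with one timelike and three spacelike vectors. -/
  signature (x : M) : ∃ e : Fin 4 → TangentSpace (𝓡 4) x, ∀ i j,
    val x (e i) (e j) = if i = j then (if i = 0 then -1 else 1) else 0
  contMDiff : ContMDiff (𝓡 4) ((𝓡 4).prod 𝓘(ℝ, E4 →L[ℝ] E4 →L[ℝ] ℝ)) ∞
    (fun x ↦ Bundle.TotalSpace.mk' (E4 →L[ℝ] E4 →L[ℝ] ℝ)
      (E := fun x : M ↦ TangentSpace (𝓡 4) x →L[ℝ] TangentSpace (𝓡 4) x →L[ℝ] ℝ) x (val x))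

variable {M : Type*} [TopologicalSpace M] [ChartedSpace E4 M]

/-- The coordinate tangent vector `∂/∂x^i`, of the chart at `p`, at the point with coordinates
`y`. -/
def coordFrame (p : M) (y : E4) (i : Fin 4) : TangentSpace (𝓡 4) ((extChartAt (𝓡 4) p).symm y) :=
  mfderiv 𝓘(ℝ, E4) (𝓡 4) (extChartAt (𝓡 4) p).symm y (coordVec i)

/-- The partial derivative `∂f/∂x^k`. -/
def partialDeriv (k : Fin 4) (f : E4 → ℝ) (y : E4) : ℝ := fderiv ℝ f y (coordVec k)

namespace LorentzMetric

variable [IsManifold (𝓡 4) ∞ M] (g : LorentzMetric M) (p : M)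

/-- The components `g_{ij}` of the metric in the chart at `p`, as functions of the coordinates. -/
def comp (y : E4) : Matrix (Fin 4) (Fin 4) ℝ := Matrix.of fun i j =>
  g.val ((extChartAt (𝓡 4) p).symm y) (coordFrame p y i) (coordFrame p y j)

/-- The Christoffel symbols `Γ^e_{bc} = ½ g^{ed} (∂_b g_{dc} + ∂_c g_{db} - ∂_d g_{bc})`. -/
def christoffel (y : E4) (e b c : Fin 4) : ℝ :=
  (1 / 2) * ∑ d, (g.comp p y)⁻¹ e d *
    (partialDeriv b (fun z => g.comp p z d c) y + partialDeriv c (fun z => g.comp p z d b) y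
      - partialDeriv d (fun z => g.comp p z b c) y)

/-- The second derivatives `∂_a ∂_b g_{cd}`. -/
def secondDeriv (y : E4) (a b c d : Fin 4) : ℝ :=
  partialDeriv a (partialDeriv b (fun z => g.comp p z c d)) y

/-- The covariant Riemann tensor `R_{abcd} = ½ (∂_b ∂_c g_{ad} + ∂_a ∂_d g_{bc} - ∂_a ∂_c g_{bd}
- ∂_b ∂_d g_{ac}) + g_{ef} (Γ^e_{bc} Γ^f_{ad} - Γ^e_{bd} Γ^f_{ac})`. -/
def riemann (y : E4) : Tensor4 := fun a b c d =>
  (1 / 2) * (g.secondDeriv p y b c a d + g.secondDeriv p y a d b c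
      - g.secondDeriv p y a c b d - g.secondDeriv p y b d a c)
    + ∑ e, ∑ f, g.comp p y e f *
      (g.christoffel p y e b c * g.christoffel p y f a d
        - g.christoffel p y e b d * g.christoffel p y f a c)

/-- The Ricci tensor `R_{bd} = g^{ac} R_{abcd}`. -/
def ricci (y : E4) (b d : Fin 4) : ℝ :=
  ∑ a, ∑ c, (g.comp p y)⁻¹ a c * g.riemann p y a b c d

/-- The scalar curvature `R = g^{bd} R_{bd}`. -/
def scalarCurvature (y : E4) : ℝ :=
  ∑ b, ∑ d, (g.comp p y)⁻¹ b d * g.ricci p y b d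

/-- The Weyl tensor
`W_{abcd} = R_{abcd} - ½ (g_{ac} R_{bd} - g_{ad} R_{bc} - g_{bc} R_{ad} + g_{bd} R_{ac})
+ (R/6) (g_{ac} g_{bd} - g_{ad} g_{bc})`. -/
def weyl (y : E4) : Tensor4 := fun a b c d =>
  g.riemann p y a b c d
    - (1 / 2) * (g.comp p y a c * g.ricci p y b d - g.comp p y a d * g.ricci p y b c
      - g.comp p y b c * g.ricci p y a d + g.comp p y b d * g.ricci p y a c)
    + (g.scalarCurvature p y / 6) *
      (g.comp p y a c * g.comp p y b d - g.comp p y a d * g.comp p y b c)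

/-- The components at the point `p` of the metric, in the chart at `p`. -/
def metricAt : Matrix (Fin 4) (Fin 4) ℝ := g.comp p (extChartAt (𝓡 4) p p)

/-- The components at the point `p` of the Weyl tensor, in the chart at `p`. -/
def weylAt : Tensor4 := g.weyl p (extChartAt (𝓡 4) p p)

end LorentzMetric

end SuperEnergy

end

open scoped Manifold ContDiff BigOperators

namespace SuperEnergy

/-! ### Regularity of the metric components and symmetries of the curvature tensor. -/

section Manifold

open Bundle Filter Topology

variable {M : Type*} [TopologicalSpace M] [ChartedSpace E4 M]

/-! In an oriented orthonormal frame a Weyl tensor is a complex symmetric trace-free 3×3 matrix `Q`: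
up to sign, its action on self-dual bivectors described by their electric parts
(`IsWeylTensor.eq_weylOf`, `weylMap_bivector_zero`). Type I makes `Q` diagonal in a complex
orthonormal triad (`exists_triad`). Self-dual bivectors satisfy the relations of the Pauli matrices,
and these turn every complex triad into a real orthonormal frame (`IsTriad.exists_observer`,
`IsTriad.exists_frame`): this is the isomorphism of the proper orthochronous Lorentz group with
SO(3, ℂ). So there is a canonical frame in which `Q` is `diagonal ρ`, with distinct `ρ j` of sum
zero.

In that frame the Bel-Robinson tensor is explicit. The super-Poynting vector vanishes, the
super-stress is diagonal with entries ¼ Σ|ρ_k|² - ½|ρ_i|², and the stress flux vanishes exactly when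
Im(ρ_0 conj ρ_1) = 0, that is, when the eigenvalues lie on a real line through 0.

Null directions correspond to isotropic vectors k of ℂ³ up to scale, and the Debever condition
becomes Σ ρ_j k_j² = 0. Together with Σ k_j² = 0 it forces k_j² to be proportional to ρ_{j+1} -
ρ_{j+2}, so only signs remain: four directions (H, ±x_1, ±x_2, ±x_3), with an even number of sign
changes. At most one x_j vanishes, and they span a 3-plane exactly when one does. As x_1 x_2 x_3 = 6
H Im(ρ_0 conj ρ_1) (`IsRootOf.prod_nullVec`), this is the condition found for the stress flux. If
the jth spatial component vanishes, ρ_j lies between the other two eigenvalues and has the smallest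
modulus (`IsRootOf.normSq_lt`), so the normal to the 3-plane carries the largest super-stress.

Arbitrary observers are reached as follows. Zero stress flux implies zero super-Poynting vector, by
tracelessness. An observer at rest makes `Q * Qᴴ` symmetric, so `Q` is normal with real
eigenvectors, and the resulting real triad gives a canonical frame whose time axis is that observer
(`IsFrame.exists_canonicalFrame_of_isAtRest`). -/

lemma mfderivWithin_target_eq (p : M) {y : E4} (hy : y ∈ (extChartAt (𝓡 4) p).target) :
    mfderivWithin 𝓘(ℝ, E4) (𝓡 4) (extChartAt (𝓡 4) p).symm (extChartAt (𝓡 4) p).target y =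
      mfderiv 𝓘(ℝ, E4) (𝓡 4) (extChartAt (𝓡 4) p).symm y :=
  mfderivWithin_of_isOpen (isOpen_extChartAt_target p) hy

variable [IsManifold (𝓡 4) ∞ M]

/-- The coordinate field is the tangent map of the inverse chart applied to a constant section,
hence as regular as needed; two derivatives suffice for the curvature. -/
lemma contMDiffAt_coordFrame (p : M) (i : Fin 4) {y : E4}
    (hy : y ∈ (extChartAt (𝓡 4) p).target) :
    ContMDiffAt 𝓘(ℝ, E4) ((𝓡 4).prod 𝓘(ℝ, E4)) 2
      (fun z => TotalSpace.mk' E4 (E := fun x : M => TangentSpace (𝓡 4) x)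
        ((extChartAt (𝓡 4) p).symm z) (coordFrame p z i)) y := by
  have hopen := isOpen_extChartAt_target (I := 𝓡 4) p
  have : IsManifold (𝓡 4) 1 M := IsManifold.of_le (n := ∞) (by simp)
  have h1 := (contMDiffOn_extChartAt_symm (I := 𝓡 4) (n := ∞) p).contMDiffOn_tangentMapWithin
    (m := 2) (by norm_cast) hopen.uniqueMDiffOn
  have h2 : ContMDiffAt 𝓘(ℝ, E4) (𝓘(ℝ, E4).prod 𝓘(ℝ, E4)) 2
      (fun z => (TotalSpace.mk' E4 z (coordVec i) : TangentBundle 𝓘(ℝ, E4) E4)) y := by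
    rw [contMDiffAt_totalSpace]
    refine ⟨contMDiffAt_id, ?_⟩
    simp only [TangentBundle.trivializationAt_apply]
    refine (contMDiffAt_const (c := coordVec i)).congr_of_eventuallyEq (Eventually.of_forall ?_)
    intro z
    simp only [chartAt_self_eq]
    exact congrArg (fun L : E4 →L[ℝ] E4 => L (coordVec i))
      ((congrArg (fun s => fderivWithin ℝ (id : E4 → E4) s z) Set.range_id).trans
        (fderivWithin_id uniqueDiffWithinAt_univ))
  have h3 := (h1.contMDiffAt (x := TotalSpace.mk' E4 y (coordVec i)) ?_).comp y h2
  · refine h3.congr_of_eventuallyEq ?_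
    filter_upwards [hopen.mem_nhds hy] with z hz
    simp only [Function.comp, tangentMapWithin, coordFrame]
    rw [mfderivWithin_target_eq p hz]
  · exact (FiberBundle.continuous_proj E4 _).continuousAt.preimage_mem_nhds (hopen.mem_nhds hy)

namespace LorentzMetric

variable (g : LorentzMetric M) (p : M)

lemma contDiffAt_comp (i j : Fin 4) {y : E4} (hy : y ∈ (extChartAt (𝓡 4) p).target) :
    ContDiffAt ℝ 2 (fun z => g.comp p z i j) y := by
  rw [← contMDiffAt_iff_contDiffAt]
  have hb : ContMDiffAt 𝓘(ℝ, E4) (𝓡 4) 2 (extChartAt (𝓡 4) p).symm y :=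
    ((contMDiffOn_extChartAt_symm (I := 𝓡 4) (n := 2) p).contMDiffAt
      ((isOpen_extChartAt_target (I := 𝓡 4) p).mem_nhds hy))
  have : ContMDiffAt 𝓘(ℝ, E4) ((𝓡 4).prod 𝓘(ℝ)) 2
      (fun m ↦ TotalSpace.mk' ℝ (E := Bundle.Trivial M ℝ) ((extChartAt (𝓡 4) p).symm m)
        (g.val ((extChartAt (𝓡 4) p).symm m) (coordFrame p m i) (coordFrame p m j))) y := by
    apply ContMDiffAt.clm_bundle_apply₂ (F₁ := E4) (F₂ := E4)
    · exact ContMDiffAt.comp y ((g.contMDiff.of_le (by norm_cast)).contMDiffAt) hb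
    · exact contMDiffAt_coordFrame p i hy
    · exact contMDiffAt_coordFrame p j hy
  simp only [contMDiffAt_totalSpace] at this
  exact this.2

lemma comp_symm (y : E4) (i j : Fin 4) : g.comp p y i j = g.comp p y j i := g.symm _ _ _

lemma secondDeriv_symm_right (y : E4) (a b c d : Fin 4) :
    g.secondDeriv p y a b c d = g.secondDeriv p y a b d c := by
  unfold secondDeriv
  rw [show (fun z => g.comp p z c d) = fun z => g.comp p z d c from
    funext fun z => g.comp_symm p z c d]

/-- Schwarz's theorem, for which `contDiffAt_comp` gives the regularity. The pair symmetry and the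
cyclic identity of the curvature rest on it. -/
lemma secondDeriv_symm_left {y : E4} (hy : y ∈ (extChartAt (𝓡 4) p).target) (a b c d : Fin 4) :
    g.secondDeriv p y a b c d = g.secondDeriv p y b a c d := by
  have h := g.contDiffAt_comp p c d hy
  have hs := h.isSymmSndFDerivAt (by simp)
  have hd : DifferentiableAt ℝ (fderiv ℝ fun z => g.comp p z c d) y :=
    (h.fderiv_right (m := 1) (by norm_num)).differentiableAt (by simp)
  have key : ∀ i j, g.secondDeriv p y i j c d =
      fderiv ℝ (fderiv ℝ fun z => g.comp p z c d) y (coordVec i) (coordVec j) := by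
    intro i j
    change fderiv ℝ (fun z => fderiv ℝ (fun w => g.comp p w c d) z (coordVec j)) y (coordVec i) = _
    rw [fderiv_clm_apply hd (differentiableAt_const _)]
    simp
  rw [key, key, hs]

lemma christoffel_symm (y : E4) (e b c : Fin 4) :
    g.christoffel p y e b c = g.christoffel p y e c b := by
  unfold christoffel
  congr 1
  refine Finset.sum_congr rfl fun d _ => ?_
  rw [show (fun z => g.comp p z b c) = fun z => g.comp p z c b from
    funext fun z => g.comp_symm p z b c]
  ring

lemma riemann_antisymm_left (y : E4) (a b c d : Fin 4) :
    g.riemann p y a b c d = -g.riemann p y b a c d := by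
  have h : ∑ e, ∑ f, g.comp p y e f *
      (g.christoffel p y e b c * g.christoffel p y f a d
        - g.christoffel p y e b d * g.christoffel p y f a c) =
      -∑ e, ∑ f, g.comp p y e f *
      (g.christoffel p y e a c * g.christoffel p y f b d
        - g.christoffel p y e a d * g.christoffel p y f b c) := by
    rw [Finset.sum_comm, ← Finset.sum_neg_distrib]
    refine Finset.sum_congr rfl fun e _ => ?_
    rw [← Finset.sum_neg_distrib]
    refine Finset.sum_congr rfl fun f _ => ?_
    rw [g.comp_symm p y f e]
    ring
  simp only [riemann, h]
  ring

lemma riemann_antisymm_right (y : E4) (a b c d : Fin 4) :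
    g.riemann p y a b c d = -g.riemann p y a b d c := by
  have h : ∑ e, ∑ f, g.comp p y e f *
      (g.christoffel p y e b c * g.christoffel p y f a d
        - g.christoffel p y e b d * g.christoffel p y f a c) =
      -∑ e, ∑ f, g.comp p y e f *
      (g.christoffel p y e b d * g.christoffel p y f a c
        - g.christoffel p y e b c * g.christoffel p y f a d) := by
    simp only [← Finset.sum_neg_distrib]
    exact Finset.sum_congr rfl fun e _ => Finset.sum_congr rfl fun f _ => by ring
  simp only [riemann, h]
  ring

lemma riemann_pair_symm {y : E4} (hy : y ∈ (extChartAt (𝓡 4) p).target) (a b c d : Fin 4) :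
    g.riemann p y a b c d = g.riemann p y c d a b := by
  have h : ∑ e, ∑ f, g.comp p y e f *
      (g.christoffel p y e b c * g.christoffel p y f a d
        - g.christoffel p y e b d * g.christoffel p y f a c) =
      ∑ e, ∑ f, g.comp p y e f *
      (g.christoffel p y e d a * g.christoffel p y f c b
        - g.christoffel p y e d b * g.christoffel p y f c a) := by
    simp only [mul_sub, Finset.sum_sub_distrib]
    congr 1
    · rw [Finset.sum_comm]
      refine Finset.sum_congr rfl fun e _ => Finset.sum_congr rfl fun f _ => ?_
      rw [g.comp_symm p y f e, g.christoffel_symm p y f b c, g.christoffel_symm p y e a d]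
      ring
    · refine Finset.sum_congr rfl fun e _ => Finset.sum_congr rfl fun f _ => ?_
      rw [g.christoffel_symm p y e b d, g.christoffel_symm p y f a c]
  simp only [riemann, h]
  rw [g.secondDeriv_symm_left p hy d a, g.secondDeriv_symm_left p hy c b,
    g.secondDeriv_symm_left p hy c a, g.secondDeriv_symm_left p hy d b,
    g.secondDeriv_symm_right p y a d c b, g.secondDeriv_symm_right p y b c d a,
    g.secondDeriv_symm_right p y a c d b, g.secondDeriv_symm_right p y b d c a]
  ring

lemma riemann_cyclic {y : E4} (hy : y ∈ (extChartAt (𝓡 4) p).target) (a b c d : Fin 4) :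
    g.riemann p y a b c d + g.riemann p y a c d b + g.riemann p y a d b c = 0 := by
  have h : ∀ e f, g.comp p y e f *
      (g.christoffel p y e b c * g.christoffel p y f a d
        - g.christoffel p y e b d * g.christoffel p y f a c) + g.comp p y e f *
      (g.christoffel p y e c d * g.christoffel p y f a b
        - g.christoffel p y e c b * g.christoffel p y f a d) + g.comp p y e f *
      (g.christoffel p y e d b * g.christoffel p y f a c
        - g.christoffel p y e d c * g.christoffel p y f a b) = 0 := by
    intro e f
    rw [g.christoffel_symm p y e c b, g.christoffel_symm p y e d b, g.christoffel_symm p y e d c]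
    ring
  have h' := Finset.sum_congr (rfl : (Finset.univ : Finset (Fin 4)) = Finset.univ) fun e _ =>
    Finset.sum_congr (rfl : (Finset.univ : Finset (Fin 4)) = Finset.univ) fun f _ => h e f
  simp only [Finset.sum_add_distrib, Finset.sum_const_zero] at h'
  simp only [riemann]
  rw [g.secondDeriv_symm_left p hy c d a b, g.secondDeriv_symm_left p hy d b a c,
    g.secondDeriv_symm_left p hy c b a d, g.secondDeriv_symm_right p y a b c d,
    g.secondDeriv_symm_right p y a d c b, g.secondDeriv_symm_right p y a c d b]
  linear_combination h'

/-- At every point of the chart domain the components of the metric admit an orthonormal frame. -/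
lemma exists_frame_comp {y : E4} (hy : y ∈ (extChartAt (𝓡 4) p).target) :
    ∃ Λ : Matrix (Fin 4) (Fin 4) ℝ, Λ.transpose * g.comp p y * Λ =
      Matrix.diagonal ![-1, 1, 1, 1] := by
  obtain ⟨e, he⟩ := g.signature ((extChartAt (𝓡 4) p).symm y)
  have hinv := isInvertible_mfderivWithin_extChartAt_symm (I := 𝓡 4) hy
  have hr : Set.range (𝓡 4) = Set.univ := (𝓡 4).range_eq_univ
  rw [hr, mfderivWithin_univ] at hinv
  obtain ⟨φ, hφ⟩ := hinv
  -- The derivative `φ` of the inverse chart is invertible, so the orthonormal vectors have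
  -- coordinates in the coordinate frame; these are the columns of `Λ`.
  let coef : Fin 4 → E4 := fun i => φ.symm (e i)
  have hexp : ∀ i, e i = ∑ a, coef i a • coordFrame p y a := by
    intro i
    conv_lhs => rw [← φ.apply_symm_apply (e i)]
    have h1 : coef i = ∑ a, coef i a • coordVec a := by
      ext b
      simp [coordVec, Finset.sum_apply, Pi.single_apply]
    have h2 : ∀ v : E4, φ v = mfderiv 𝓘(ℝ, E4) (𝓡 4) (extChartAt (𝓡 4) p).symm y v := by
      intro v
      rw [← hφ]
      rfl
    refine (congrArg φ h1).trans ?_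
    refine (map_sum φ _ _).trans ?_
    refine Finset.sum_congr rfl fun a _ => ?_
    refine (map_smul φ _ _).trans ?_
    rw [h2]
    rfl
  refine ⟨Matrix.of fun a i => coef i a, ?_⟩
  ext i j
  have h := he i j
  rw [hexp i, hexp j] at h
  simp only [map_sum, map_smul, sum_apply, smul_apply,
    smul_eq_mul] at h
  have : (Matrix.diagonal ![(-1 : ℝ), 1, 1, 1] : Matrix (Fin 4) (Fin 4) ℝ) i j =
      if i = j then (if i = 0 then -1 else 1) else 0 := by
    rw [Matrix.diagonal_apply]
    fin_cases i <;> simp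
  rw [this, ← h]
  simp only [Matrix.mul_apply, Matrix.transpose_apply, Matrix.of_apply, comp]
  refine Finset.sum_congr rfl fun a _ => ?_
  rw [Finset.sum_mul, Finset.mul_sum]
  refine Finset.sum_congr rfl fun b _ => ?_
  ring

end LorentzMetric

end Manifold

end SuperEnergy

/-! ### Algebraic Weyl tensors and orthonormal frames. -/

namespace SuperEnergy

/-- The Minkowski metric. -/
def mink : Matrix (Fin 4) (Fin 4) ℝ := Matrix.diagonal ![-1, 1, 1, 1]

/-- The algebraic symmetries of a Weyl tensor. -/
structure IsWeylTensor (g : Matrix (Fin 4) (Fin 4) ℝ) (W : Tensor4) : Prop where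
  antisymm_left : ∀ a b c d, W a b c d = -W b a c d
  antisymm_right : ∀ a b c d, W a b c d = -W a b d c
  pair_symm : ∀ a b c d, W a b c d = W c d a b
  cyclic : ∀ a b c d, W a b c d + W a c d b + W a d b c = 0
  trace : ∀ b d, ∑ a, ∑ c, g⁻¹ a c * W a b c d = 0

/-- A frame, given by its components as the columns of `Λ`, which is orthonormal for `g`. -/
def IsFrame (g Λ : Matrix (Fin 4) (Fin 4) ℝ) : Prop := Λ.transpose * g * Λ = mink

lemma mink_mul_mink : mink * mink = 1 := by
  rw [mink, Matrix.diagonal_mul_diagonal, ← Matrix.diagonal_one]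
  congr 1
  ext i
  fin_cases i <;> simp

lemma mink_inv : mink⁻¹ = mink := Matrix.inv_eq_left_inv mink_mul_mink

lemma mink_transpose : mink.transpose = mink := Matrix.diagonal_transpose _

lemma det_mink : mink.det = -1 := by
  simp [mink, Matrix.det_diagonal, Fin.prod_univ_four]

namespace IsFrame

variable {g Λ : Matrix (Fin 4) (Fin 4) ℝ}

lemma left_inv (h : IsFrame g Λ) : mink * Λ.transpose * g * Λ = 1 := by
  have h' : Λ.transpose * g * Λ = mink := h
  rw [Matrix.mul_assoc, Matrix.mul_assoc, ← Matrix.mul_assoc Λ.transpose, h', mink_mul_mink]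

lemma right_inv (h : IsFrame g Λ) : Λ * (mink * Λ.transpose * g) = 1 :=
  mul_eq_one_comm.mp h.left_inv

lemma inv_eq (h : IsFrame g Λ) : g⁻¹ = Λ * mink * Λ.transpose := by
  apply Matrix.inv_eq_left_inv
  simpa only [Matrix.mul_assoc] using h.right_inv

lemma det_sq (h : IsFrame g Λ) : Λ.det ^ 2 * g.det = -1 := by
  have h' : Λ.transpose * g * Λ = mink := h
  have := congrArg Matrix.det h'
  rw [Matrix.det_mul, Matrix.det_mul, Matrix.det_transpose, det_mink] at this
  linarith

lemma det_ne_zero (h : IsFrame g Λ) : Λ.det ≠ 0 := by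
  intro h0
  have := h.det_sq
  simp [h0] at this

lemma isUnit (h : IsFrame g Λ) : IsUnit g.det := by
  refine isUnit_iff_ne_zero.mpr fun h0 => ?_
  have := h.det_sq
  simp [h0] at this

lemma mul (h : IsFrame g Λ) {L : Matrix (Fin 4) (Fin 4) ℝ} (hL : IsFrame mink L) :
    IsFrame g (Λ * L) := by
  have h' : Λ.transpose * g * Λ = mink := h
  have hL' : L.transpose * mink * L = mink := hL
  unfold IsFrame
  rw [Matrix.transpose_mul]
  calc L.transpose * Λ.transpose * g * (Λ * L) = L.transpose * (Λ.transpose * g * Λ) * L := by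
        simp only [Matrix.mul_assoc]
    _ = mink := by rw [h', hL']

end IsFrame

section Weyl

variable {M : Type*} [TopologicalSpace M] [ChartedSpace E4 M] [IsManifold (𝓡 4) ∞ M]

namespace LorentzMetric

variable (g : LorentzMetric M) (p : M)

lemma ricci_symm {y : E4} (hy : y ∈ (extChartAt (𝓡 4) p).target) (b d : Fin 4) :
    g.ricci p y b d = g.ricci p y d b := by
  have hs : (g.comp p y).transpose = g.comp p y := by
    ext i j
    exact g.comp_symm p y j i
  have hi : ∀ i j, (g.comp p y)⁻¹ i j = (g.comp p y)⁻¹ j i := by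
    intro i j
    rw [← Matrix.transpose_apply (g.comp p y)⁻¹ j i, Matrix.transpose_nonsing_inv, hs]
  unfold ricci
  rw [Finset.sum_comm]
  refine Finset.sum_congr rfl fun a _ => Finset.sum_congr rfl fun c _ => ?_
  rw [hi, g.riemann_pair_symm p hy]

lemma isWeylTensor_weyl {y : E4} (hy : y ∈ (extChartAt (𝓡 4) p).target) :
    IsWeylTensor (g.comp p y) (g.weyl p y) := by
  have gs := g.comp_symm p y
  have rs := fun b d => g.ricci_symm p hy b d
  refine ⟨fun a b c d => ?_, fun a b c d => ?_, fun a b c d => ?_, fun a b c d => ?_,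
    fun b d => ?_⟩
  · simp only [weyl, g.riemann_antisymm_left p y a b c d]
    ring
  · simp only [weyl, g.riemann_antisymm_right p y a b c d]
    ring
  · simp only [weyl, g.riemann_pair_symm p hy a b c d]
    rw [gs c a, gs c b, gs d a, gs d b, rs d b, rs d a, rs c b, rs c a]
    ring
  · simp only [weyl]
    rw [gs d c, gs c b, gs d b, rs d b, rs d c, rs c b]
    linear_combination g.riemann_cyclic p hy a b c d
  -- The frame only serves to show that the matrix of the metric is invertible.
  · obtain ⟨Λ, hΛ⟩ := g.exists_frame_comp p hy
    have hu : IsUnit (g.comp p y).det := IsFrame.isUnit (Λ := Λ) hΛ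
    have hl := Matrix.nonsing_inv_mul _ hu
    have hr := Matrix.mul_nonsing_inv _ hu
    set G := (g.comp p y)⁻¹ with hG
    have hl' : ∀ i j, ∑ k, G i k * g.comp p y k j = if i = j then 1 else 0 := fun i j => by
      rw [← Matrix.mul_apply, hl, Matrix.one_apply]
    have hr' : ∀ i j, ∑ k, g.comp p y i k * G k j = if i = j then 1 else 0 := fun i j => by
      rw [← Matrix.mul_apply, hr, Matrix.one_apply]
    -- The trace 4 is the dimension, to which the factors 1/2 and 1/6 of the Weyl tensor are tuned.
    have e1 : ∑ a, ∑ c, G a c * g.comp p y a c = 4 := by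
      have : ∀ a, ∑ c, G a c * g.comp p y a c = 1 := fun a => by
        simp_rw [gs a]
        simpa using hl' a a
      simp [this]
    have e2 : ∀ X : Fin 4 → ℝ, ∑ a, ∑ c, G a c * (g.comp p y a d * X c) = X d := fun X => by
      rw [Finset.sum_comm]
      have : ∀ c, ∑ a, G a c * (g.comp p y a d * X c) = (if d = c then 1 else 0) * X c :=
        fun c => by
          rw [← hr', Finset.sum_mul]
          exact Finset.sum_congr rfl fun a _ => by rw [gs d a]; ring
      simp [this]
    have e3 : ∀ X : Fin 4 → ℝ, ∑ a, ∑ c, G a c * (g.comp p y b c * X a) = X b := fun X => by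
      have : ∀ a, ∑ c, G a c * (g.comp p y b c * X a) = (if a = b then 1 else 0) * X a :=
        fun a => by
          rw [← hl', Finset.sum_mul]
          exact Finset.sum_congr rfl fun c _ => by rw [gs b c]; ring
      simp [this]
    have e4 : ∑ a, ∑ c, G a c * g.ricci p y a c = g.scalarCurvature p y := rfl
    have e5 : ∑ a, ∑ c, G a c * g.riemann p y a b c d = g.ricci p y b d := rfl
    have expand : ∀ a c, G a c * g.weyl p y a b c d = G a c * g.riemann p y a b c d
        - 1 / 2 * (G a c * g.comp p y a c * g.ricci p y b d
          - G a c * (g.comp p y a d * g.ricci p y b c)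
          - G a c * (g.comp p y b c * g.ricci p y a d) + g.comp p y b d * (G a c * g.ricci p y a c))
        + g.scalarCurvature p y / 6 * (G a c * g.comp p y a c * g.comp p y b d
          - G a c * (g.comp p y a d * g.comp p y b c)) := fun a c => by
      simp only [weyl]
      ring
    simp only [expand, Finset.sum_add_distrib, Finset.sum_sub_distrib, ← Finset.mul_sum,
      ← Finset.sum_mul, e1, e2, e3 fun a => g.ricci p y a d, e4, e5]
    ring

end LorentzMetric

end Weyl

end SuperEnergy

/-! ### Change of frame as multiplication by Kronecker squares. -/

namespace SuperEnergy

open scoped Kronecker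
open Matrix

/-- The components of a covariant tensor in the frame `Λ`. -/
def pull (Λ : Matrix (Fin 4) (Fin 4) ℝ) (W : Tensor4) : Tensor4 := fun a b c d =>
  ∑ e, ∑ f, ∑ h, ∑ k, Λ e a * Λ f b * Λ h c * Λ k d * W e f h k

/-- A tensor as a matrix, rows indexed by the first pair of indices. -/
def flat (W : Tensor4) : Matrix (Fin 4 × Fin 4) (Fin 4 × Fin 4) ℝ :=
  Matrix.of fun i j => W i.1 i.2 j.1 j.2

/-- Exchange of the two middle indices. -/
def midSwap (W : Tensor4) : Tensor4 := fun a b c d => W a c b d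

lemma flat_injective : Function.Injective flat := fun W W' h => by
  funext a b c d
  exact congrFun (congrFun h (a, b)) (c, d)

/-- The purpose of `flat`: covariance statements with sums over many indices become associativity of
matrix products. -/
lemma flat_pull (Λ : Matrix (Fin 4) (Fin 4) ℝ) (W : Tensor4) :
    flat (pull Λ W) = (Λ ⊗ₖ Λ)ᵀ * flat W * (Λ ⊗ₖ Λ) := by
  ext ⟨a, b⟩ ⟨c, d⟩
  simp only [Matrix.mul_apply, Matrix.transpose_apply, Matrix.kronecker_apply, flat, Matrix.of_apply,
    pull, Fintype.sum_prod_type, Finset.sum_mul]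
  have : ∀ e, ∑ f, ∑ h, ∑ k, Λ e a * Λ f b * Λ h c * Λ k d * W e f h k =
      ∑ h, ∑ k, ∑ f, Λ e a * Λ f b * Λ h c * Λ k d * W e f h k := fun e => by
    rw [Finset.sum_comm]
    exact Finset.sum_congr rfl fun h _ => Finset.sum_comm
  simp only [this]
  rw [Finset.sum_comm]
  refine Finset.sum_congr rfl fun h _ => ?_
  rw [Finset.sum_comm]
  refine Finset.sum_congr rfl fun k _ => Finset.sum_congr rfl fun e _ =>
    Finset.sum_congr rfl fun f _ => ?_
  ring

lemma pull_midSwap (Λ : Matrix (Fin 4) (Fin 4) ℝ) (W : Tensor4) :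
    pull Λ (midSwap W) = midSwap (pull Λ W) := by
  funext a b c d
  simp only [pull, midSwap]
  refine Finset.sum_congr rfl fun e _ => ?_
  rw [Finset.sum_comm]
  refine Finset.sum_congr rfl fun h _ => Finset.sum_congr rfl fun f _ =>
    Finset.sum_congr rfl fun k _ => ?_
  ring

lemma pull_pull (Λ L : Matrix (Fin 4) (Fin 4) ℝ) (W : Tensor4) :
    pull L (pull Λ W) = pull (Λ * L) W := by
  apply flat_injective
  rw [flat_pull, flat_pull, flat_pull, Matrix.mul_kronecker_mul, Matrix.transpose_mul]
  simp only [Matrix.mul_assoc]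

lemma pull_smul (Λ : Matrix (Fin 4) (Fin 4) ℝ) (r : ℝ) (W : Tensor4) :
    pull Λ (r • W) = r • pull Λ W := by
  funext a b c d
  simp only [pull, Pi.smul_apply, smul_eq_mul, Finset.mul_sum]
  refine Finset.sum_congr rfl fun e _ => Finset.sum_congr rfl fun h _ =>
    Finset.sum_congr rfl fun f _ => Finset.sum_congr rfl fun k _ => by ring

/-! ### The volume form and the Hodge dual -/

/-- Multilinearity of the determinant: each row is expanded in the standard basis, one after the
other. -/
lemma sum_mul_leviCivita_aux (x y z w : Fin 4 → ℝ) :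
    Matrix.det (Matrix.of ![x, y, z, w]) =
      ∑ e, ∑ f, ∑ h, ∑ k, x e * y f * z h * w k * leviCivita e f h k := by
  have hL : ∀ a b c d, leviCivita a b c d = Matrix.detRowAlternating
      ![Pi.single a (1 : ℝ), Pi.single b 1, Pi.single c 1, Pi.single d 1] := by
    intro a b c d
    rw [leviCivita]
    change Matrix.det _ = Matrix.det _
    congr 1
    ext i j
    fin_cases i <;> simp [Pi.single_apply, eq_comm]
  have step : ∀ (v : Fin 4 → Fin 4 → ℝ) (i : Fin 4) (t : Fin 4 → ℝ),
      Matrix.detRowAlternating (Function.update v i t) =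
        ∑ e, t e * Matrix.detRowAlternating (Function.update v i (Pi.single e (1 : ℝ))) := by
    intro v i t
    have : t = ∑ e, t e • (Pi.single e (1 : ℝ) : Fin 4 → ℝ) := by
      ext j
      simp [Finset.sum_apply, Pi.single_apply]
    conv_lhs => rw [this]
    rw [AlternatingMap.map_update_sum]
    simp only [AlternatingMap.map_update_smul, smul_eq_mul]
  have s0 : ∀ x y z w : Fin 4 → ℝ, Matrix.detRowAlternating ![x, y, z, w] =
      ∑ e, x e * Matrix.detRowAlternating ![Pi.single e (1 : ℝ), y, z, w] := by
    intro x y z w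
    have hh : ∀ t, Function.update ![x, y, z, w] 0 t = ![t, y, z, w] := fun t => by
      ext i; fin_cases i <;> simp
    simpa [hh] using step ![x, y, z, w] 0 x
  have s1 : ∀ x y z w : Fin 4 → ℝ, Matrix.detRowAlternating ![x, y, z, w] =
      ∑ e, y e * Matrix.detRowAlternating ![x, Pi.single e (1 : ℝ), z, w] := by
    intro x y z w
    have hh : ∀ t, Function.update ![x, y, z, w] 1 t = ![x, t, z, w] := fun t => by
      ext i; fin_cases i <;> simp
    simpa [hh] using step ![x, y, z, w] 1 y
  have s2 : ∀ x y z w : Fin 4 → ℝ, Matrix.detRowAlternating ![x, y, z, w] =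
      ∑ e, z e * Matrix.detRowAlternating ![x, y, Pi.single e (1 : ℝ), w] := by
    intro x y z w
    have hh : ∀ t, Function.update ![x, y, z, w] 2 t = ![x, y, t, w] := fun t => by
      ext i; fin_cases i <;> simp
    simpa [hh] using step ![x, y, z, w] 2 z
  have s3 : ∀ x y z w : Fin 4 → ℝ, Matrix.detRowAlternating ![x, y, z, w] =
      ∑ e, w e * Matrix.detRowAlternating ![x, y, z, Pi.single e (1 : ℝ)] := by
    intro x y z w
    have hh : ∀ t, Function.update ![x, y, z, w] 3 t = ![x, y, z, t] := fun t => by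
      ext i; fin_cases i <;> simp
    simpa [hh] using step ![x, y, z, w] 3 w
  change Matrix.detRowAlternating ![x, y, z, w] = _
  rw [s0]
  refine Finset.sum_congr rfl fun e _ => ?_
  rw [s1, Finset.mul_sum]
  refine Finset.sum_congr rfl fun f _ => ?_
  rw [s2, Finset.mul_sum, Finset.mul_sum]
  refine Finset.sum_congr rfl fun h _ => ?_
  rw [s3, Finset.mul_sum, Finset.mul_sum, Finset.mul_sum]
  refine Finset.sum_congr rfl fun k _ => ?_
  rw [hL]
  ring

lemma pull_leviCivita (Λ : Matrix (Fin 4) (Fin 4) ℝ) :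
    pull Λ leviCivita = Λ.det • leviCivita := by
  funext a b c d
  rw [pull, ← sum_mul_leviCivita_aux (fun e => Λ e a) (fun e => Λ e b) (fun e => Λ e c)
    (fun e => Λ e d)]
  rw [Pi.smul_apply, Pi.smul_apply, Pi.smul_apply, Pi.smul_apply, smul_eq_mul, leviCivita,
    ← Matrix.det_transpose Λ, mul_comm, ← Matrix.det_mul]
  congr 1
  ext i j
  simp only [Matrix.mul_apply, Matrix.of_apply, ite_mul, one_mul, zero_mul, Finset.sum_ite_eq,
    Finset.mem_univ, if_true, Matrix.transpose_apply]
  fin_cases i <;> rfl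

lemma volumeForm_eq (g : Matrix (Fin 4) (Fin 4) ℝ) :
    volumeForm g = Real.sqrt |g.det| • leviCivita := rfl

lemma volumeForm_mink : volumeForm mink = leviCivita := by
  rw [volumeForm_eq, det_mink]
  simp

lemma kronecker_volumeForm (g Λ : Matrix (Fin 4) (Fin 4) ℝ) :
    (Λ ⊗ₖ Λ)ᵀ * flat (volumeForm g) * (Λ ⊗ₖ Λ) =
      (Real.sqrt |g.det| * Λ.det) • flat (volumeForm mink) := by
  rw [← flat_pull, volumeForm_eq, pull_smul, pull_leviCivita, smul_smul, volumeForm_mink]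
  rfl

lemma flat_volumeMixed (g : Matrix (Fin 4) (Fin 4) ℝ) :
    flat (volumeMixed g) = flat (volumeForm g) * (g⁻¹ ⊗ₖ g⁻¹) := by
  ext ⟨a, b⟩ ⟨c, d⟩
  simp only [flat, Matrix.of_apply, volumeMixed, Matrix.mul_apply, Matrix.kronecker_apply,
    Fintype.sum_prod_type, mul_assoc]

lemma flat_hodgeDual (g : Matrix (Fin 4) (Fin 4) ℝ) (W : Tensor4) :
    flat (hodgeDual g W) = (1 / 2 : ℝ) • (flat (volumeMixed g) * flat W) := by
  ext ⟨a, b⟩ ⟨c, d⟩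
  simp only [flat, Matrix.of_apply, hodgeDual, Matrix.mul_apply, Matrix.smul_apply, smul_eq_mul,
    Fintype.sum_prod_type]

/-- The contraction runs over the second and fourth slots of each factor. `midSwap` puts these slots
side by side, so that each half of the tensor has the form A G Aᵀ. -/
lemma flat_midSwap_belRobinson (g : Matrix (Fin 4) (Fin 4) ℝ) (W : Tensor4) :
    flat (midSwap (belRobinson g W)) =
      (1 / 4 : ℝ) • (flat (midSwap W) * (g⁻¹ ⊗ₖ g⁻¹) * (flat (midSwap W))ᵀ +
        flat (midSwap (hodgeDual g W)) * (g⁻¹ ⊗ₖ g⁻¹) * (flat (midSwap (hodgeDual g W)))ᵀ) := by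
  ext ⟨a, b⟩ ⟨c, d⟩
  simp only [flat, Matrix.of_apply, midSwap, belRobinson, Matrix.mul_apply, Matrix.smul_apply,
    Matrix.add_apply, smul_eq_mul, Fintype.sum_prod_type, Matrix.kronecker_apply,
    Matrix.transpose_apply, Finset.sum_mul, ← Finset.sum_add_distrib]
  congr 1
  have : ∀ F : Fin 4 → Fin 4 → Fin 4 → Fin 4 → ℝ,
      ∑ r, ∑ s, ∑ r', ∑ s', F r s r' s' = ∑ r', ∑ s', ∑ r, ∑ s, F r s r' s' := by
    intro F
    calc _ = ∑ r, ∑ r', ∑ s', ∑ s, F r s r' s' := by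
          refine Finset.sum_congr rfl fun r _ => ?_
          rw [Finset.sum_comm]
          exact Finset.sum_congr rfl fun h _ => Finset.sum_comm
      _ = _ := by
          rw [Finset.sum_comm]
          refine Finset.sum_congr rfl fun r _ => ?_
          rw [Finset.sum_comm]
  rw [this]
  refine Finset.sum_congr rfl fun e _ => Finset.sum_congr rfl fun h _ =>
    Finset.sum_congr rfl fun f _ => Finset.sum_congr rfl fun k _ => by ring

namespace IsFrame

variable {g Λ : Matrix (Fin 4) (Fin 4) ℝ}

lemma kronecker_inv (h : IsFrame g Λ) :
    g⁻¹ ⊗ₖ g⁻¹ = (Λ ⊗ₖ Λ) * (mink⁻¹ ⊗ₖ mink⁻¹) * (Λ ⊗ₖ Λ)ᵀ := by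
  rw [h.inv_eq, mink_inv, Matrix.mul_kronecker_mul, Matrix.mul_kronecker_mul]
  rfl

/-- The orientation of a frame, a sign. -/
lemma orientation_sq (h : IsFrame g Λ) : (Real.sqrt |g.det| * Λ.det) ^ 2 = 1 := by
  rw [mul_pow, Real.sq_sqrt (abs_nonneg _)]
  have h1 := h.det_sq
  have h2 : 0 < Λ.det ^ 2 := sq_pos_of_ne_zero h.det_ne_zero
  have h3 : g.det < 0 := by
    by_contra h4
    nlinarith [mul_nonneg h2.le (not_lt.mp h4)]
  rw [abs_of_neg h3]
  linarith

lemma orientation_eq_one (h : IsFrame g Λ) (hd : 0 < Λ.det) : Real.sqrt |g.det| * Λ.det = 1 := by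
  have h1 := h.orientation_sq
  have h2 : 0 ≤ Real.sqrt |g.det| * Λ.det := mul_nonneg (Real.sqrt_nonneg _) hd.le
  nlinarith

lemma pull_hodgeDual (h : IsFrame g Λ) (W : Tensor4) :
    pull Λ (hodgeDual g W) = (Real.sqrt |g.det| * Λ.det) • hodgeDual mink (pull Λ W) := by
  apply flat_injective
  change _ = (Real.sqrt |g.det| * Λ.det) • flat (hodgeDual mink (pull Λ W))
  rw [flat_pull, flat_hodgeDual, flat_hodgeDual, flat_volumeMixed, flat_volumeMixed,
    h.kronecker_inv, flat_pull, smul_comm, ← Matrix.smul_mul (Real.sqrt |g.det| * Λ.det), ← Matrix.smul_mul (Real.sqrt |g.det| * Λ.det),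
    ← kronecker_volumeForm]
  simp only [Matrix.mul_smul, Matrix.smul_mul, Matrix.mul_assoc]

/-- The Hodge dual picks up the orientation sign of the frame, but enters quadratically; hence no
orientation is needed. -/
lemma pull_belRobinson (h : IsFrame g Λ) (W : Tensor4) :
    pull Λ (belRobinson g W) = belRobinson mink (pull Λ W) := by
  have hm : pull Λ (midSwap (belRobinson g W)) = midSwap (belRobinson mink (pull Λ W)) := by
    apply flat_injective
    rw [flat_pull, flat_midSwap_belRobinson, flat_midSwap_belRobinson, h.kronecker_inv]
    have hs := h.orientation_sq
    have e1 := h.pull_hodgeDual W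
    set s := Real.sqrt |g.det| * Λ.det with hsdef
    have e2 : hodgeDual mink (pull Λ W) = s • pull Λ (hodgeDual g W) := by
      rw [e1, smul_smul, ← sq, hs, one_smul]
    have e3 : flat (midSwap (hodgeDual mink (pull Λ W))) =
        s • flat (midSwap (pull Λ (hodgeDual g W))) := by
      rw [e2]
      rfl
    rw [e3, ← pull_midSwap, ← pull_midSwap, flat_pull, flat_pull]
    simp only [Matrix.transpose_mul, Matrix.transpose_smul, Matrix.transpose_transpose,
      Matrix.smul_mul, Matrix.mul_smul, smul_smul, ← sq, hs, one_smul, Matrix.mul_add,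
      Matrix.add_mul, Matrix.mul_assoc]
  rw [pull_midSwap] at hm
  funext a b c d
  exact congrFun (congrFun (congrFun (congrFun hm a) c) b) d

end IsFrame

end SuperEnergy

namespace SuperEnergy

open scoped Kronecker
open Matrix

/-! ### Covariance of the algebraic symmetries -/

/-- Exchange of the first two indices. -/
def leftSwap (W : Tensor4) : Tensor4 := fun a b c d => W b a c d

/-- Exchange of the last two indices. -/
def rightSwap (W : Tensor4) : Tensor4 := fun a b c d => W a b d c

lemma pull_leftSwap (Λ : Matrix (Fin 4) (Fin 4) ℝ) (W : Tensor4) :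
    pull Λ (leftSwap W) = leftSwap (pull Λ W) := by
  funext a b c d
  simp only [pull, leftSwap]
  rw [Finset.sum_comm]
  refine Finset.sum_congr rfl fun e _ => Finset.sum_congr rfl fun h _ =>
    Finset.sum_congr rfl fun f _ => Finset.sum_congr rfl fun k _ => ?_
  ring

lemma pull_rightSwap (Λ : Matrix (Fin 4) (Fin 4) ℝ) (W : Tensor4) :
    pull Λ (rightSwap W) = rightSwap (pull Λ W) := by
  funext a b c d
  simp only [pull, rightSwap]
  refine Finset.sum_congr rfl fun e _ => Finset.sum_congr rfl fun h _ => ?_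
  rw [Finset.sum_comm]
  refine Finset.sum_congr rfl fun f _ => Finset.sum_congr rfl fun k _ => ?_
  ring

lemma pull_add (Λ : Matrix (Fin 4) (Fin 4) ℝ) (W W' : Tensor4) :
    pull Λ (W + W') = pull Λ W + pull Λ W' := by
  funext a b c d
  simp only [pull, Pi.add_apply, mul_add, Finset.sum_add_distrib]

lemma pull_neg (Λ : Matrix (Fin 4) (Fin 4) ℝ) (W : Tensor4) : pull Λ (-W) = -pull Λ W := by
  funext a b c d
  simp only [pull, Pi.neg_apply, mul_neg, Finset.sum_neg_distrib]

lemma pull_zero (Λ : Matrix (Fin 4) (Fin 4) ℝ) : pull Λ 0 = 0 := by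
  funext a b c d
  simp only [pull, Pi.zero_apply, mul_zero, Finset.sum_const_zero]

lemma pull_one (W : Tensor4) : pull 1 W = W := by
  apply flat_injective
  rw [flat_pull, Matrix.one_kronecker_one, Matrix.transpose_one, Matrix.one_mul, Matrix.mul_one]

lemma pull_eq_zero_iff {Λ : Matrix (Fin 4) (Fin 4) ℝ} (h : Λ.det ≠ 0) (W : Tensor4) :
    pull Λ W = 0 ↔ W = 0 := by
  refine ⟨fun h0 => ?_, fun h0 => h0 ▸ pull_zero Λ⟩
  have := congrArg (pull Λ⁻¹) h0
  rwa [pull_pull, Matrix.mul_nonsing_inv _ (isUnit_iff_ne_zero.mpr h), pull_one, pull_zero] at this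

/-- Covariance of contractions, used with the inverse metric for traces and with `v b * v c` for the
Debever condition. -/
lemma sum_vec_mul_pull (Λ G : Matrix (Fin 4) (Fin 4) ℝ) (W : Tensor4) (b d : Fin 4) :
    ∑ a, ∑ c, G a c * pull Λ W a b c d =
      ∑ f, ∑ k, Λ f b * Λ k d * ∑ e, ∑ h, (Λ * G * Λᵀ) e h * W e f h k := by
  let v : Fin 4 × Fin 4 → ℝ := fun i => G i.1 i.2
  have h1 : ∑ a, ∑ c, G a c * pull Λ W a b c d = (v ᵥ* flat (pull Λ (midSwap W))) (b, d) := by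
    rw [pull_midSwap]
    simp only [Matrix.vecMul, dotProduct, Fintype.sum_prod_type, flat, midSwap, Matrix.of_apply, v]
  have h2 : v ᵥ* (Λ ⊗ₖ Λ)ᵀ = fun i => (Λ * G * Λᵀ) i.1 i.2 := by
    ext ⟨e, h⟩
    simp only [Matrix.vecMul, dotProduct, Fintype.sum_prod_type, Matrix.transpose_apply,
      Matrix.kronecker_apply, Matrix.mul_apply, Finset.sum_mul, v]
    rw [Finset.sum_comm]
    exact Finset.sum_congr rfl fun _ _ => Finset.sum_congr rfl fun _ _ => by ring
  rw [h1, flat_pull, ← Matrix.vecMul_vecMul, ← Matrix.vecMul_vecMul, h2]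
  simp only [Matrix.vecMul, dotProduct, Fintype.sum_prod_type, flat, midSwap, Matrix.of_apply,
    Matrix.kronecker_apply]
  exact Finset.sum_congr rfl fun _ _ => Finset.sum_congr rfl fun _ _ => by ring

lemma IsFrame.isWeylTensor {g Λ : Matrix (Fin 4) (Fin 4) ℝ} {W : Tensor4} (h : IsFrame g Λ)
    (hW : IsWeylTensor g W) : IsWeylTensor mink (pull Λ W) := by
  refine ⟨fun a b c d => ?_, fun a b c d => ?_, fun a b c d => ?_, fun a b c d => ?_,
    fun b d => ?_⟩
  · have : W = -leftSwap W := by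
      funext a b c d
      exact hW.antisymm_left a b c d
    conv_lhs => rw [this, pull_neg, pull_leftSwap]
    rfl
  · have : W = -rightSwap W := by
      funext a b c d
      exact hW.antisymm_right a b c d
    conv_lhs => rw [this, pull_neg, pull_rightSwap]
    rfl
  · have h1 : flat W = (flat W)ᵀ := by
      ext ⟨a, b⟩ ⟨c, d⟩
      exact hW.pair_symm a b c d
    have h2 : flat (pull Λ W) = (flat (pull Λ W))ᵀ := by
      rw [flat_pull]
      conv_lhs => rw [h1]
      simp only [Matrix.transpose_mul, Matrix.transpose_transpose, Matrix.mul_assoc]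
    exact congrFun (congrFun h2 (a, b)) (c, d)
  · have h0 : W + midSwap (rightSwap W) + rightSwap (midSwap W) = 0 := by
      funext a b c d
      exact hW.cyclic a b c d
    have h1 := congrArg (pull Λ) h0
    rw [pull_add, pull_add, pull_midSwap, pull_rightSwap, pull_rightSwap, pull_midSwap,
      pull_zero] at h1
    exact congrFun (congrFun (congrFun (congrFun h1 a) b) c) d
  · rw [sum_vec_mul_pull, mink_inv, ← h.inv_eq]
    simp [hW.trace]

/-! ### Covariance of the Petrov type -/

lemma IsFrame.kronecker_transpose_mul_volumeMixed {g Λ : Matrix (Fin 4) (Fin 4) ℝ}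
    (h : IsFrame g Λ) (hd : 0 < Λ.det) :
    (Λ ⊗ₖ Λ)ᵀ * flat (volumeMixed g) = flat (volumeMixed mink) * (Λ ⊗ₖ Λ)ᵀ := by
  have h1 := kronecker_volumeForm g Λ
  rw [h.orientation_eq_one hd, one_smul] at h1
  rw [flat_volumeMixed, flat_volumeMixed, h.kronecker_inv, ← h1]
  simp only [Matrix.mul_assoc]

lemma IsFrame.kronecker_transpose_mul_weyl {g Λ : Matrix (Fin 4) (Fin 4) ℝ} (h : IsFrame g Λ)
    (W : Tensor4) :
    (Λ ⊗ₖ Λ)ᵀ * (flat W * (g⁻¹ ⊗ₖ g⁻¹)) =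
      flat (pull Λ W) * (mink⁻¹ ⊗ₖ mink⁻¹) * (Λ ⊗ₖ Λ)ᵀ := by
  rw [flat_pull, h.kronecker_inv]
  simp only [Matrix.mul_assoc]

/-- The real matrix `A` as a complex matrix. -/
abbrev toComplex {m n : Type*} (A : Matrix m n ℝ) : Matrix m n ℂ := A.map Complex.ofReal

lemma toComplex_mul {l m n : Type*} [Fintype m] (A : Matrix l m ℝ) (B : Matrix m n ℝ) :
    toComplex (A * B) = toComplex A * toComplex B := Matrix.map_mul (f := Complex.ofRealHom)

/-- A 2-form as a vector indexed by pairs. -/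
def flatForm (X : Fin 4 → Fin 4 → ℂ) : Fin 4 × Fin 4 → ℂ := fun i => X i.1 i.2

lemma selfDual_iff (g : Matrix (Fin 4) (Fin 4) ℝ) (X : Fin 4 → Fin 4 → ℂ) :
    (∀ a b, (1 / 2) * ∑ c, ∑ d, (volumeMixed g a b c d : ℂ) * X c d = Complex.I * X a b) ↔
      (1 / 2 : ℂ) • (toComplex (flat (volumeMixed g)) *ᵥ flatForm X) = Complex.I • flatForm X := by
  rw [funext_iff, Prod.forall]
  simp only [flatForm, flat, Matrix.mulVec, dotProduct, Fintype.sum_prod_type, Pi.smul_apply,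
    smul_eq_mul, Matrix.map_apply, Matrix.of_apply]

lemma flatForm_weylMap (g : Matrix (Fin 4) (Fin 4) ℝ) (W : Tensor4) (X : Fin 4 → Fin 4 → ℂ) :
    flatForm (weylMap g W X) =
      (1 / 2 : ℂ) • (toComplex (flat W * (g⁻¹ ⊗ₖ g⁻¹)) *ᵥ flatForm X) := by
  ext ⟨a, b⟩
  simp only [flatForm, flat, weylMap, Matrix.mulVec, dotProduct, Fintype.sum_prod_type,
    Pi.smul_apply, smul_eq_mul, Matrix.map_apply, Matrix.of_apply, Matrix.mul_apply,
    Matrix.kronecker_apply]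
  congr 1
  push_cast
  simp only [Finset.sum_mul]
  have : ∀ F : Fin 4 → Fin 4 → Fin 4 → Fin 4 → ℂ,
      ∑ r, ∑ s, ∑ r', ∑ s', F r s r' s' = ∑ r', ∑ s', ∑ r, ∑ s, F r s r' s' := by
    intro F
    calc _ = ∑ r, ∑ r', ∑ s', ∑ s, F r s r' s' := by
          refine Finset.sum_congr rfl fun r _ => ?_
          rw [Finset.sum_comm]
          exact Finset.sum_congr rfl fun h _ => Finset.sum_comm
      _ = _ := by
          rw [Finset.sum_comm]
          refine Finset.sum_congr rfl fun r _ => ?_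
          rw [Finset.sum_comm]
  rw [this]
  refine Finset.sum_congr rfl fun e _ => Finset.sum_congr rfl fun h _ =>
    Finset.sum_congr rfl fun f _ => Finset.sum_congr rfl fun k _ => by ring

/-- `(Λ ⊗ₖ Λ)ᵀ` intertwines the two Weyl maps and the two Hodge operators. The latter needs a
positive determinant: a frame of the other orientation would exchange self-dual and anti-self-dual
bivectors. -/
lemma IsFrame.isTypeI {g Λ : Matrix (Fin 4) (Fin 4) ℝ} (h : IsFrame g Λ) (hd : 0 < Λ.det)
    {W : Tensor4} (hW : IsTypeI g W) : IsTypeI mink (pull Λ W) := by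
  obtain ⟨ρ, hρ, hev⟩ := hW
  refine ⟨ρ, hρ, fun k => ?_⟩
  obtain ⟨X, hX0, ⟨hXa, hXs⟩, hXe⟩ := hev k
  let K := toComplex (Λ ⊗ₖ Λ)ᵀ
  let X' : Fin 4 → Fin 4 → ℂ := fun a b => (K *ᵥ flatForm X) (a, b)
  have hX' : flatForm X' = K *ᵥ flatForm X := rfl
  have hinv : toComplex ((Λ⁻¹ ⊗ₖ Λ⁻¹)ᵀ) * K = 1 := by
    rw [← toComplex_mul, ← Matrix.transpose_mul, ← Matrix.mul_kronecker_mul,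
      Matrix.mul_nonsing_inv _ (isUnit_iff_ne_zero.mpr hd.ne'), Matrix.one_kronecker_one,
      Matrix.transpose_one]
    exact Matrix.map_one _ Complex.ofReal_zero Complex.ofReal_one
  have hXe' : flatForm (weylMap g W X) = ρ k • flatForm X := by
    ext ⟨a, b⟩
    exact hXe a b
  rw [selfDual_iff] at hXs
  rw [flatForm_weylMap] at hXe'
  refine ⟨X', fun h0 => hX0 ?_, ⟨fun a b => ?_, ?_⟩, ?_⟩
  · have h1 : K *ᵥ flatForm X = 0 := by
      rw [← hX', h0]
      rfl
    have h2 := congrArg (toComplex ((Λ⁻¹ ⊗ₖ Λ⁻¹)ᵀ) *ᵥ ·) h1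
    simp only [Matrix.mulVec_mulVec, hinv, Matrix.one_mulVec, Matrix.mulVec_zero] at h2
    funext a b
    exact congrFun h2 (a, b)
  · simp only [X', K, Matrix.mulVec, dotProduct, Fintype.sum_prod_type, Matrix.map_apply,
      Matrix.transpose_apply, Matrix.kronecker_apply, flatForm]
    rw [Finset.sum_comm, ← Finset.sum_neg_distrib]
    refine Finset.sum_congr rfl fun e _ => ?_
    rw [← Finset.sum_neg_distrib]
    refine Finset.sum_congr rfl fun f _ => ?_
    rw [hXa f e]
    push_cast
    ring
  · rw [selfDual_iff, hX', Matrix.mulVec_mulVec, ← toComplex_mul,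
      ← h.kronecker_transpose_mul_volumeMixed hd, toComplex_mul, ← Matrix.mulVec_mulVec,
      ← Matrix.mulVec_smul, hXs, Matrix.mulVec_smul]
  · have : flatForm (weylMap mink (pull Λ W) X') = ρ k • flatForm X' := by
      rw [flatForm_weylMap, hX', Matrix.mulVec_mulVec, ← toComplex_mul,
        ← h.kronecker_transpose_mul_weyl, toComplex_mul, ← Matrix.mulVec_mulVec,
        ← Matrix.mulVec_smul, hXe', Matrix.mulVec_smul]
    exact fun a b => congrFun this (a, b)

/-! ### Covariance of the null Debever vectors -/

lemma metricProd_eq (g : Matrix (Fin 4) (Fin 4) ℝ) (v w : Vec) :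
    metricProd g v w = v ⬝ᵥ g *ᵥ w := by
  simp only [metricProd, dotProduct, Matrix.mulVec, Finset.mul_sum]
  exact Finset.sum_congr rfl fun _ _ => Finset.sum_congr rfl fun _ _ => by ring

lemma lower_eq (g : Matrix (Fin 4) (Fin 4) ℝ) (v : Vec) : lower g v = g *ᵥ v := rfl

lemma IsFrame.metricProd {g Λ : Matrix (Fin 4) (Fin 4) ℝ} (h : IsFrame g Λ) (v w : Vec) :
    metricProd g (Λ *ᵥ v) (Λ *ᵥ w) = SuperEnergy.metricProd mink v w := by
  have h' : Λᵀ * g * Λ = mink := h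
  rw [metricProd_eq, metricProd_eq, ← h', ← Matrix.mulVec_mulVec, ← Matrix.mulVec_mulVec,
    Matrix.dotProduct_mulVec v Λᵀ, Matrix.vecMul_transpose]

lemma IsFrame.lower {g Λ : Matrix (Fin 4) (Fin 4) ℝ} (h : IsFrame g Λ) (v : Vec) :
    Λᵀ *ᵥ lower g (Λ *ᵥ v) = SuperEnergy.lower mink v := by
  have h' : Λᵀ * g * Λ = mink := h
  rw [lower_eq, lower_eq, ← h', ← Matrix.mulVec_mulVec, ← Matrix.mulVec_mulVec]

/-- The contraction `W_{abcd} ℓ^b ℓ^c`. -/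
def innerContract (W : Tensor4) (ℓ : Vec) : Matrix (Fin 4) (Fin 4) ℝ :=
  Matrix.of fun a d => ∑ b, ∑ c, W a b c d * ℓ b * ℓ c

lemma innerContract_pull (Λ : Matrix (Fin 4) (Fin 4) ℝ) (W : Tensor4) (v : Vec) :
    innerContract (pull Λ W) v = Λᵀ * innerContract W (Λ *ᵥ v) * Λ := by
  let G : Matrix (Fin 4) (Fin 4) ℝ := Matrix.of fun b c => v b * v c
  have h1 : Λ * G * Λᵀ = Matrix.of fun b c => (Λ *ᵥ v) b * (Λ *ᵥ v) c := by
    ext b c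
    simp only [Matrix.mul_apply, G, Matrix.of_apply, Matrix.transpose_apply, Matrix.mulVec,
      dotProduct, Finset.sum_mul, Finset.mul_sum]
    exact Finset.sum_congr rfl fun _ _ => Finset.sum_congr rfl fun _ _ => by ring
  ext a d
  have h2 := sum_vec_mul_pull Λ G (leftSwap W) a d
  rw [pull_leftSwap, h1] at h2
  calc innerContract (pull Λ W) v a d = _ := ?_
    _ = _ := h2
    _ = _ := ?_
  · simp only [innerContract, G, Matrix.of_apply, leftSwap]
    exact Finset.sum_congr rfl fun _ _ => Finset.sum_congr rfl fun _ _ => by ring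
  · simp only [innerContract, Matrix.of_apply, leftSwap, Matrix.mul_apply,
      Matrix.transpose_apply]
    rw [Finset.sum_comm]
    refine Finset.sum_congr rfl fun k _ => ?_
    rw [Finset.sum_mul]
    refine Finset.sum_congr rfl fun f _ => ?_
    have : ∑ x, ∑ x_1, (Λ *ᵥ v) x * (Λ *ᵥ v) x_1 * W f x x_1 k =
        ∑ b, ∑ c, W f b c k * (Λ *ᵥ v) b * (Λ *ᵥ v) c :=
      Finset.sum_congr rfl fun _ _ => Finset.sum_congr rfl fun _ _ => by ring
    rw [this]
    ring

/-- The tensor `ℓ_e N_{ad} ℓ_f`. -/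
def sandwich (l : Vec) (N : Matrix (Fin 4) (Fin 4) ℝ) : Tensor4 := fun e a d f =>
  l e * N a d * l f

lemma pull_sandwich (Λ : Matrix (Fin 4) (Fin 4) ℝ) (l : Vec) (N : Matrix (Fin 4) (Fin 4) ℝ) :
    pull Λ (sandwich l N) = sandwich (Λᵀ *ᵥ l) (Λᵀ * N * Λ) := by
  funext e a d f
  simp only [pull, sandwich, Matrix.mulVec, dotProduct, Matrix.mul_apply, Matrix.transpose_apply,
    Finset.sum_mul, Finset.mul_sum]
  have : ∀ F : Fin 4 → Fin 4 → Fin 4 → Fin 4 → ℝ,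
      ∑ r, ∑ s, ∑ r', ∑ s', F r s r' s' = ∑ s', ∑ r', ∑ s, ∑ r, F r s r' s' := by
    intro F
    calc _ = ∑ r, ∑ s', ∑ r', ∑ s, F r s r' s' := by
          refine Finset.sum_congr rfl fun r _ => ?_
          calc _ = ∑ s, ∑ s', ∑ r', F r s r' s' :=
                Finset.sum_congr rfl fun h _ => Finset.sum_comm
            _ = ∑ s', ∑ s, ∑ r', F r s r' s' := Finset.sum_comm
            _ = _ := Finset.sum_congr rfl fun h _ => Finset.sum_comm
      _ = ∑ s', ∑ r, ∑ r', ∑ s, F r s r' s' := Finset.sum_comm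
      _ = _ := by
          refine Finset.sum_congr rfl fun r _ => ?_
          rw [Finset.sum_comm]
          exact Finset.sum_congr rfl fun h _ => Finset.sum_comm
  rw [this]
  refine Finset.sum_congr rfl fun _ _ => Finset.sum_congr rfl fun _ _ =>
    Finset.sum_congr rfl fun _ _ => Finset.sum_congr rfl fun _ _ => by ring

/-- The tensor `4 ℓ_{[e} N_{a][d} ℓ_{f]}`. -/
def debeverTensor (l : Vec) (N : Matrix (Fin 4) (Fin 4) ℝ) : Tensor4 :=
  sandwich l N + -leftSwap (sandwich l N) + -rightSwap (sandwich l N) +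
    leftSwap (rightSwap (sandwich l N))

lemma isDebeverVector_iff (g : Matrix (Fin 4) (Fin 4) ℝ) (W : Tensor4) (ℓ : Vec) :
    IsDebeverVector g W ℓ ↔ ℓ ≠ 0 ∧ metricProd g ℓ ℓ = 0 ∧
      debeverTensor (lower g ℓ) (innerContract W ℓ) = 0 := by
  refine and_congr_right fun _ => and_congr_right fun _ => ?_
  simp only [funext_iff]
  refine forall_congr' fun e => forall_congr' fun a => forall_congr' fun d => forall_congr' fun f => ?_
  refine Eq.congr ?_ rfl
  simp only [debeverTensor, sandwich, leftSwap, rightSwap, innerContract, Matrix.of_apply,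
    Pi.add_apply, Pi.neg_apply, Finset.mul_sum, Finset.sum_mul, ← Finset.sum_neg_distrib,
    ← Finset.sum_add_distrib]
  exact Finset.sum_congr rfl fun _ _ => Finset.sum_congr rfl fun _ _ => by ring

lemma IsFrame.isDebeverVector_iff {g Λ : Matrix (Fin 4) (Fin 4) ℝ} (h : IsFrame g Λ)
    (W : Tensor4) (v : Vec) :
    IsDebeverVector g W (Λ *ᵥ v) ↔ IsDebeverVector mink (pull Λ W) v := by
  rw [SuperEnergy.isDebeverVector_iff, SuperEnergy.isDebeverVector_iff, h.metricProd]
  have h0 : Λ *ᵥ v ≠ 0 ↔ v ≠ 0 := by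
    refine not_congr ⟨fun h0 => Matrix.eq_zero_of_mulVec_eq_zero h.det_ne_zero h0, fun h0 => ?_⟩
    rw [h0, Matrix.mulVec_zero]
  rw [h0, innerContract_pull, ← h.lower]
  have : debeverTensor (Λᵀ *ᵥ SuperEnergy.lower g (Λ *ᵥ v))
      (Λᵀ * innerContract W (Λ *ᵥ v) * Λ) =
      pull Λ (debeverTensor (SuperEnergy.lower g (Λ *ᵥ v)) (innerContract W (Λ *ᵥ v))) := by
    simp only [debeverTensor, pull_add, pull_neg, pull_leftSwap, pull_rightSwap, pull_sandwich]
  rw [this, pull_eq_zero_iff h.det_ne_zero]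

end SuperEnergy

namespace SuperEnergy

open scoped Kronecker
open Matrix

/-! ### Frames adapted to an observer -/

lemma metricProd_mink (v w : Vec) :
    metricProd mink v w = -(v 0 * w 0) + v 1 * w 1 + v 2 * w 2 + v 3 * w 3 := by
  simp [metricProd, mink, Fin.sum_univ_four, Matrix.diagonal_apply]

lemma exists_isFrame_mink_of_observer {c : Vec} (hc : metricProd mink c c = -1) :
    ∃ L : Matrix (Fin 4) (Fin 4) ℝ, IsFrame mink L ∧ ∀ i, L i 0 = c i := by
  rw [metricProd_mink] at hc
  -- The boost carrying the time axis to `c` has the denominator `1 + c 0`. It vanishes only for `c`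
  -- opposite to the time axis, where `mink` itself is a frame with first column `c`.
  by_cases h : 1 + c 0 = 0
  · have h0 : c 0 = -1 := by linarith
    rw [h0] at hc
    have h1 : c 1 = 0 := by nlinarith [sq_nonneg (c 1), sq_nonneg (c 2), sq_nonneg (c 3)]
    have h2 : c 2 = 0 := by nlinarith [sq_nonneg (c 1), sq_nonneg (c 2), sq_nonneg (c 3)]
    have h3 : c 3 = 0 := by nlinarith [sq_nonneg (c 1), sq_nonneg (c 2), sq_nonneg (c 3)]
    refine ⟨mink, ?_, fun i => ?_⟩
    · unfold IsFrame
      rw [mink_transpose, mink_mul_mink, Matrix.one_mul]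
    · fin_cases i <;> simp [mink, h0, h1, h2, h3]
  · obtain ⟨k, hk⟩ : ∃ k : ℝ, k * (1 + c 0) = 1 := ⟨(1 + c 0)⁻¹, inv_mul_cancel₀ h⟩
    refine ⟨!![c 0, c 1, c 2, c 3; c 1, 1 + k * (c 1 * c 1), k * (c 1 * c 2), k * (c 1 * c 3);
      c 2, k * (c 2 * c 1), 1 + k * (c 2 * c 2), k * (c 2 * c 3);
      c 3, k * (c 3 * c 1), k * (c 3 * c 2), 1 + k * (c 3 * c 3)], ?_, fun i => ?_⟩
    · unfold IsFrame
      have e1 : ∀ x : ℝ, -(c 0 * x) + x + k * x * (c 1 ^ 2 + c 2 ^ 2 + c 3 ^ 2) = 0 := fun x => by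
        linear_combination x * ((c 0 - 1) * hk + k * hc)
      have e2 : ∀ x : ℝ, -x + 2 * k * x + k ^ 2 * x * (c 1 ^ 2 + c 2 ^ 2 + c 3 ^ 2) = 0 :=
        fun x => by
          linear_combination x * ((k * (c 0 - 1) + 1) * hk + k ^ 2 * hc)
      ext i j
      fin_cases i <;> fin_cases j <;>
        simp [mink, Matrix.mul_apply, Fin.sum_univ_four, Matrix.diagonal_apply]
      · linear_combination hc
      · linear_combination e1 (c 1)
      · linear_combination e1 (c 2)
      · linear_combination e1 (c 3)
      · linear_combination e1 (c 1)
      · linear_combination e2 (c 1 * c 1)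
      · linear_combination e2 (c 1 * c 2)
      · linear_combination e2 (c 1 * c 3)
      · linear_combination e1 (c 2)
      · linear_combination e2 (c 2 * c 1)
      · linear_combination e2 (c 2 * c 2)
      · linear_combination e2 (c 2 * c 3)
      · linear_combination e1 (c 3)
      · linear_combination e2 (c 3 * c 1)
      · linear_combination e2 (c 3 * c 2)
      · linear_combination e2 (c 3 * c 3)
    · fin_cases i <;> simp

lemma IsFrame.exists_oriented {g Λ : Matrix (Fin 4) (Fin 4) ℝ} (h : IsFrame g Λ) :
    ∃ Λ' : Matrix (Fin 4) (Fin 4) ℝ, IsFrame g Λ' ∧ 0 < Λ'.det ∧ ∀ i, Λ' i 0 = Λ i 0 := by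
  rcases lt_or_gt_of_ne h.det_ne_zero with hd | hd
  · let D : Matrix (Fin 4) (Fin 4) ℝ := Matrix.diagonal ![1, 1, 1, -1]
    have hD : IsFrame mink D := by
      unfold IsFrame
      rw [Matrix.diagonal_transpose, mink, Matrix.diagonal_mul_diagonal,
        Matrix.diagonal_mul_diagonal]
      congr 1
      ext i
      fin_cases i <;> simp
    refine ⟨Λ * D, h.mul hD, ?_, fun i => ?_⟩
    · have : D.det = -1 := by simp [D, Matrix.det_diagonal, Fin.prod_univ_four]
      rw [Matrix.det_mul, this]
      linarith
    · simp [D, Matrix.mul_apply, Matrix.diagonal_apply]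
  · exact ⟨Λ, h, hd, fun _ => rfl⟩

lemma IsFrame.exists_of_observer {g Λ : Matrix (Fin 4) (Fin 4) ℝ} (h : IsFrame g Λ) {u : Vec}
    (hu : IsObserver g u) :
    ∃ Λ' : Matrix (Fin 4) (Fin 4) ℝ, IsFrame g Λ' ∧ 0 < Λ'.det ∧ ∀ i, Λ' i 0 = u i := by
  have e : Λ *ᵥ (Λ⁻¹ *ᵥ u) = u := by
    rw [Matrix.mulVec_mulVec, Matrix.mul_nonsing_inv _ (isUnit_iff_ne_zero.mpr h.det_ne_zero),
      Matrix.one_mulVec]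
  have hc : SuperEnergy.metricProd mink (Λ⁻¹ *ᵥ u) (Λ⁻¹ *ᵥ u) = -1 := by
    rw [← h.metricProd, e]
    exact hu
  obtain ⟨L, hL, hL0⟩ := exists_isFrame_mink_of_observer hc
  obtain ⟨Λ', h1, h2, h3⟩ := (h.mul hL).exists_oriented
  refine ⟨Λ', h1, h2, fun i => ?_⟩
  rw [h3, ← congrFun e i]
  simp only [Matrix.mul_apply, hL0]
  rfl

lemma IsFrame.isObserver {g Λ : Matrix (Fin 4) (Fin 4) ℝ} (h : IsFrame g Λ) {u : Vec}
    (hu : ∀ i, Λ i 0 = u i) : IsObserver g u := by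
  have e : u = Λ *ᵥ Pi.single 0 1 := by
    ext i
    simp [hu]
  rw [IsObserver, e, h.metricProd, metricProd_mink]
  simp

/-- The projector onto the spatial vectors of a frame. -/
def spatial : Matrix (Fin 4) (Fin 4) ℝ := Matrix.diagonal ![0, 1, 1, 1]

lemma spatial_apply (i j : Fin 4) : spatial i j = if i = j ∧ i ≠ 0 then 1 else 0 := by
  rw [spatial, Matrix.diagonal_apply]
  fin_cases i <;> fin_cases j <;> simp

section Observer

variable {g Λ : Matrix (Fin 4) (Fin 4) ℝ} {u : Vec}

/-- With `u` as first frame vector the projector is diag(0,1,1,1), so every relative quantity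
reduces to components of the Bel-Robinson tensor with spatial indices in the projected slots. -/
lemma IsFrame.transpose_mul_projector (h : IsFrame g Λ) (hu : ∀ i, Λ i 0 = u i) :
    Λᵀ * Matrix.of (projector g u) = spatial * Λᵀ := by
  have e : u = Λ *ᵥ Pi.single 0 1 := by
    ext i
    simp [hu]
  have hl : Λᵀ *ᵥ SuperEnergy.lower g u = SuperEnergy.lower mink (Pi.single 0 1) := by
    rw [e, h.lower]
  ext i b
  have h1 := congrFun hl i
  simp only [Matrix.mulVec, dotProduct, Matrix.transpose_apply] at h1
  simp only [Matrix.mul_apply, Matrix.transpose_apply, Matrix.of_apply, projector, mul_add,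
    Finset.sum_add_distrib, ← mul_assoc, ← Finset.sum_mul, h1, ← hu]
  simp only [mul_ite, mul_one, mul_zero, Finset.sum_ite_eq', Finset.mem_univ, if_true]
  fin_cases i <;> simp [SuperEnergy.lower, mink, spatial, Matrix.diagonal_apply]

lemma mulVec_transpose_eq_zero_iff (h : IsFrame g Λ) (q : Vec) : Λᵀ *ᵥ q = 0 ↔ q = 0 := by
  refine ⟨fun h0 => Matrix.eq_zero_of_mulVec_eq_zero (M := Λᵀ) ?_ h0, fun h0 => ?_⟩
  · rw [Matrix.det_transpose]
    exact h.det_ne_zero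
  · rw [h0, Matrix.mulVec_zero]

lemma IsFrame.superPoynting_eq_zero_iff (h : IsFrame g Λ) (hu : ∀ i, Λ i 0 = u i) (W : Tensor4) :
    (∀ a, superPoynting g W u a = 0) ↔
      ∀ i, i ≠ 0 → belRobinson mink (pull Λ W) i 0 0 0 = 0 := by
  let s : Vec := fun a => ∑ b, ∑ c, ∑ d, belRobinson g W a b c d * u b * u c * u d
  have h1 : superPoynting g W u = -(Matrix.of (projector g u) *ᵥ s) := rfl
  have h2 : ∀ i, (Λᵀ *ᵥ s) i = belRobinson mink (pull Λ W) i 0 0 0 := fun i => by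
    rw [← h.pull_belRobinson]
    simp only [Matrix.mulVec, dotProduct, s, pull, Matrix.transpose_apply, Finset.mul_sum, hu]
    exact Finset.sum_congr rfl fun _ _ => Finset.sum_congr rfl fun _ _ =>
      Finset.sum_congr rfl fun _ _ => Finset.sum_congr rfl fun _ _ => by ring
  have h3 : (∀ a, superPoynting g W u a = 0) ↔ superPoynting g W u = 0 := by
    rw [funext_iff]
    rfl
  rw [h3, ← mulVec_transpose_eq_zero_iff h, h1, Matrix.mulVec_neg, neg_eq_zero,
    Matrix.mulVec_mulVec, h.transpose_mul_projector hu, ← Matrix.mulVec_mulVec, funext_iff]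
  refine forall_congr' fun i => ?_
  rw [spatial, Matrix.mulVec_diagonal, h2]
  fin_cases i <;> simp

lemma IsFrame.superStress (h : IsFrame g Λ) (hu : ∀ i, Λ i 0 = u i) (W : Tensor4) (i j : Fin 4) :
    (Λᵀ * Matrix.of (superStress g W u) * Λ) i j =
      if i ≠ 0 ∧ j ≠ 0 then belRobinson mink (pull Λ W) i j 0 0 else 0 := by
  let S : Matrix (Fin 4) (Fin 4) ℝ :=
    Matrix.of fun a b => ∑ c, ∑ d, belRobinson g W a b c d * u c * u d
  have h1 : Matrix.of (SuperEnergy.superStress g W u) =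
      Matrix.of (projector g u) * S * (Matrix.of (projector g u))ᵀ := by
    ext a b
    simp only [SuperEnergy.superStress, Matrix.mul_apply, Matrix.transpose_apply, Matrix.of_apply, S,
      Finset.sum_mul]
    rw [Finset.sum_comm]
    refine Finset.sum_congr rfl fun b' _ => Finset.sum_congr rfl fun a' _ => ?_
    simp only [Finset.mul_sum, Finset.sum_mul]
    exact Finset.sum_congr rfl fun _ _ => Finset.sum_congr rfl fun _ _ => by ring
  have h2 : (Λᵀ * S * Λ) i j = belRobinson mink (pull Λ W) i j 0 0 := by
    rw [← h.pull_belRobinson]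
    simp only [Matrix.mul_apply, S, pull, Matrix.transpose_apply, Matrix.of_apply, Finset.mul_sum,
      Finset.sum_mul, hu]
    rw [Finset.sum_comm]
    exact Finset.sum_congr rfl fun _ _ => Finset.sum_congr rfl fun _ _ =>
      Finset.sum_congr rfl fun _ _ => Finset.sum_congr rfl fun _ _ => by ring
  have h3 : Λᵀ * Matrix.of (SuperEnergy.superStress g W u) * Λ =
      spatial * (Λᵀ * S * Λ) * spatial := by
    have e : (Matrix.of (projector g u))ᵀ * Λ = Λ * spatial := by
      have := congrArg Matrix.transpose (h.transpose_mul_projector hu)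
      simpa only [Matrix.transpose_mul, Matrix.transpose_transpose, spatial,
        Matrix.diagonal_transpose] using this
    calc _ = (Λᵀ * Matrix.of (projector g u)) * S * ((Matrix.of (projector g u))ᵀ * Λ) := by
          rw [h1]
          simp only [Matrix.mul_assoc]
      _ = _ := by
          rw [e, h.transpose_mul_projector hu]
          simp only [Matrix.mul_assoc]
  rw [h3, spatial, Matrix.mul_diagonal, Matrix.diagonal_mul, h2]
  fin_cases i <;> fin_cases j <;> simp

/-- The components of a covariant tensor of order three with respect to the columns of `A`. -/
def pull3 (A : Matrix (Fin 4) (Fin 4) ℝ) (F : Fin 4 → Fin 4 → Fin 4 → ℝ) :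
    Fin 4 → Fin 4 → Fin 4 → ℝ := fun a b c =>
  ∑ e, ∑ f, ∑ h, A e a * A f b * A h c * F e f h

lemma pull3_eq (A : Matrix (Fin 4) (Fin 4) ℝ) (F : Fin 4 → Fin 4 → Fin 4 → ℝ) (a b c : Fin 4) :
    pull3 A F a b c = ((A ⊗ₖ A)ᵀ * (Matrix.of fun (i : Fin 4 × Fin 4) j => F i.1 i.2 j) * A)
      (a, b) c := by
  simp only [pull3, Matrix.mul_apply, Matrix.transpose_apply, Matrix.kronecker_apply,
    Matrix.of_apply, Fintype.sum_prod_type, Finset.sum_mul]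
  symm
  rw [Finset.sum_comm]
  refine Finset.sum_congr rfl fun e _ => ?_
  rw [Finset.sum_comm]
  exact Finset.sum_congr rfl fun _ _ => Finset.sum_congr rfl fun _ _ => by ring

lemma pull3_pull3 (A B : Matrix (Fin 4) (Fin 4) ℝ) (F : Fin 4 → Fin 4 → Fin 4 → ℝ) :
    pull3 B (pull3 A F) = pull3 (A * B) F := by
  funext a b c
  rw [pull3_eq, pull3_eq, Matrix.mul_kronecker_mul, Matrix.transpose_mul]
  have : (Matrix.of fun (i : Fin 4 × Fin 4) j => pull3 A F i.1 i.2 j) =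
      (A ⊗ₖ A)ᵀ * (Matrix.of fun (i : Fin 4 × Fin 4) j => F i.1 i.2 j) * A := by
    ext ⟨a, b⟩ c
    exact pull3_eq A F a b c
  rw [this]
  simp only [Matrix.mul_assoc]

lemma IsFrame.stressFlux_eq_zero_iff (h : IsFrame g Λ) (hu : ∀ i, Λ i 0 = u i) (W : Tensor4) :
    (∀ a b c, stressFlux g W u a b c = 0) ↔
      ∀ i j k, i ≠ 0 → j ≠ 0 → k ≠ 0 → belRobinson mink (pull Λ W) i j k 0 = 0 := by
  let F : Fin 4 → Fin 4 → Fin 4 → ℝ := fun a b c => ∑ d, belRobinson g W a b c d * u d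
  let P := (Matrix.of (projector g u))ᵀ
  have e : P * Λ = Λ * spatial := by
    have := congrArg Matrix.transpose (h.transpose_mul_projector hu)
    simpa only [Matrix.transpose_mul, Matrix.transpose_transpose, spatial,
      Matrix.diagonal_transpose] using this
  have h0 : (∀ a b c, stressFlux g W u a b c = 0) ↔ pull3 P F = 0 := by
    simp only [funext_iff]
    refine forall_congr' fun a => forall_congr' fun b => forall_congr' fun c => ?_
    exact neg_eq_zero
  have h1 : ∀ i j k, pull3 Λ F i j k = belRobinson mink (pull Λ W) i j k 0 := fun i j k => by
    rw [← h.pull_belRobinson]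
    simp only [pull3, pull, F, Finset.mul_sum, hu]
    exact Finset.sum_congr rfl fun _ _ => Finset.sum_congr rfl fun _ _ =>
      Finset.sum_congr rfl fun _ _ => Finset.sum_congr rfl fun _ _ => by ring
  have z : ∀ A, pull3 A 0 = 0 := fun A => by
    funext a b c
    simp [pull3]
  have h2 : pull3 P F = 0 ↔ pull3 spatial (pull3 Λ F) = 0 := by
    rw [pull3_pull3, ← e, ← pull3_pull3]
    refine ⟨fun h' => by rw [h', z], fun h' => ?_⟩
    have := congrArg (pull3 Λ⁻¹) h'
    have one : ∀ G, pull3 1 G = G := fun G => by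
      funext a b c
      rw [pull3_eq, Matrix.one_kronecker_one, Matrix.transpose_one, Matrix.one_mul, Matrix.mul_one]
      rfl
    rwa [pull3_pull3, Matrix.mul_nonsing_inv _ (isUnit_iff_ne_zero.mpr h.det_ne_zero), one, z]
      at this
  have h3 : ∀ i j k, pull3 spatial (pull3 Λ F) i j k =
      if i ≠ 0 ∧ j ≠ 0 ∧ k ≠ 0 then belRobinson mink (pull Λ W) i j k 0 else 0 := fun i j k => by
    rw [← h1]
    change ∑ e, ∑ f, ∑ h, spatial e i * spatial f j * spatial h k * pull3 Λ F e f h = _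
    rw [Finset.sum_eq_single i, Finset.sum_eq_single j, Finset.sum_eq_single k]
    · simp only [spatial_apply]
      by_cases hi : i = 0 <;> by_cases hj : j = 0 <;> by_cases hk : k = 0 <;> simp [hi, hj, hk]
    all_goals simp +contextual [spatial_apply]
  rw [h0, h2]
  simp only [funext_iff, h3]
  refine forall_congr' fun i => forall_congr' fun j => forall_congr' fun k => ?_
  by_cases hi : i = 0 <;> by_cases hj : j = 0 <;> by_cases hk : k = 0 <;> simp [hi, hj, hk]

/-- The super-stress eigenspaces in a frame adapted to the observer. -/
lemma IsFrame.mem_superStressEigenspace_iff (h : IsFrame g Λ) (hu : ∀ i, Λ i 0 = u i) (W : Tensor4)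
    (κ : ℝ) (v : Vec) :
    Λ *ᵥ v ∈ superStressEigenspace g W u κ ↔
      v 0 = 0 ∧ ∀ i, i ≠ 0 → ∑ j ∈ {1, 2, 3}, belRobinson mink (pull Λ W) i j 0 0 * v j =
        κ * v i := by
  have e : u = Λ *ᵥ Pi.single 0 1 := by
    ext i
    simp [hu]
  have h1 : SuperEnergy.metricProd g u (Λ *ᵥ v) = 0 ↔ v 0 = 0 := by
    rw [e, h.metricProd, metricProd_mink]
    simp
  change (_ ∧ _) ↔ _
  rw [h1]
  refine and_congr_right fun h0 => ?_
  let t : Matrix (Fin 4) (Fin 4) ℝ := Matrix.of (SuperEnergy.superStress g W u)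
  have h2 : (∀ a, ∑ b, SuperEnergy.superStress g W u a b * (Λ *ᵥ v) b =
      κ * SuperEnergy.lower g (Λ *ᵥ v) a) ↔
      t *ᵥ (Λ *ᵥ v) - κ • SuperEnergy.lower g (Λ *ᵥ v) = 0 := by
    rw [funext_iff]
    refine forall_congr' fun a => ?_
    exact sub_eq_zero.symm
  rw [h2, ← mulVec_transpose_eq_zero_iff h, Matrix.mulVec_sub, Matrix.mulVec_smul, h.lower,
    Matrix.mulVec_mulVec, Matrix.mulVec_mulVec, funext_iff]
  refine forall_congr' fun i => ?_
  rw [Pi.sub_apply, Pi.zero_apply, sub_eq_zero]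
  have h3 : ∀ i, ((Λᵀ * t * Λ) *ᵥ v) i =
      if i = 0 then 0 else ∑ j ∈ {1, 2, 3}, belRobinson mink (pull Λ W) i j 0 0 * v j := by
    intro i
    simp only [Matrix.mulVec, dotProduct, t, h.superStress hu]
    rw [Fin.sum_univ_four]
    by_cases hi : i = 0
    · simp [hi]
    · simp [hi, add_assoc]
  rw [h3]
  fin_cases i <;> simp [SuperEnergy.lower, mink, Matrix.diagonal_apply, h0]

end Observer

end SuperEnergy

namespace SuperEnergy

open Matrix Complex

/-! ### Self-dual bivectors in Minkowski space -/

/-- The self-dual bivector with electric part `x`. -/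
def bivector (x : Fin 3 → ℂ) : Matrix (Fin 4) (Fin 4) ℂ :=
  !![0, x 0, x 1, x 2; -x 0, 0, I * x 2, -(I * x 1); -x 1, -(I * x 2), 0, I * x 0;
    -x 2, I * x 1, -(I * x 0), 0]

/-- The standard basis of the self-dual bivectors. -/
def sd (m : Fin 3) : Matrix (Fin 4) (Fin 4) ℂ := bivector (Pi.single m 1)

/-- The complex self-dual Weyl tensor with components `Q`. -/
def cweyl (Q : Matrix (Fin 3) (Fin 3) ℂ) (a b c d : Fin 4) : ℂ :=
  ∑ m, ∑ n, Q m n * sd m a b * sd n c d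

/-- The Weyl tensor of Minkowski space with components `Q`. -/
def weylOf (Q : Matrix (Fin 3) (Fin 3) ℂ) : Tensor4 := fun a b c d => (cweyl Q a b c d).re

lemma bivector_eq_sum (x : Fin 3 → ℂ) (a b : Fin 4) : bivector x a b = ∑ m, x m * sd m a b := by
  rw [Fin.sum_univ_three]
  fin_cases a <;> fin_cases b <;> simp [sd, bivector, mul_comm]

/-- The 0-1 matrix defining the symbol maps the Vandermonde matrix of 0, 1, 2, 3, of determinant 12,
to that of a, b, c, d. The polynomial formula makes explicit evaluation possible. -/
lemma leviCivita_eq (a b c d : Fin 4) :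
    leviCivita a b c d = ((b : ℝ) - a) * (c - a) * (d - a) * (c - b) * (d - b) * (d - c) / 12 := by
  have h1 : ∀ v : Fin 4 → Fin 4,
      (Matrix.of fun i j : Fin 4 => if v i = j then (1 : ℝ) else 0) *
        Matrix.vandermonde (fun i : Fin 4 => (i : ℝ)) =
          Matrix.vandermonde fun i => ((v i : ℕ) : ℝ) := by
    intro v
    ext i j
    simp [Matrix.mul_apply, Matrix.vandermonde_apply]
  have h2 := congrArg Matrix.det (h1 ![a, b, c, d])
  rw [Matrix.det_mul, Matrix.det_vandermonde, Matrix.det_vandermonde] at h2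
  have h3 : ∀ f : Fin 4 → ℝ, ∏ i : Fin 4, ∏ j ∈ Finset.Ioi i, (f j - f i) =
      (f 1 - f 0) * (f 2 - f 0) * (f 3 - f 0) * (f 2 - f 1) * (f 3 - f 1) * (f 3 - f 2) := by
    intro f
    have e0 : Finset.Ioi (0 : Fin 4) = {1, 2, 3} := by decide
    have e1 : Finset.Ioi (1 : Fin 4) = {2, 3} := by decide
    have e2 : Finset.Ioi (2 : Fin 4) = {3} := by decide
    have e3 : Finset.Ioi (3 : Fin 4) = ∅ := by decide
    rw [Fin.prod_univ_four, e0, e1, e2, e3, Finset.prod_insert (by decide),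
      Finset.prod_pair (by decide), Finset.prod_pair (by decide), Finset.prod_singleton,
      Finset.prod_empty]
    ring
  rw [h3 fun i => ((i : ℕ) : ℝ), h3 fun i => ((![a, b, c, d] i : ℕ) : ℝ)] at h2
  simp at h2
  rw [leviCivita]
  linarith

lemma volumeMixed_mink (a b c d : Fin 4) :
    volumeMixed mink a b c d = leviCivita a b c d * mink c c * mink d d := by
  rw [volumeMixed, mink_inv, volumeForm_mink]
  rw [Finset.sum_eq_single c, Finset.sum_eq_single d]
  all_goals simp +contextual [mink, Matrix.diagonal_apply]

lemma hodge_sd (m : Fin 3) (a b : Fin 4) :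
    (1 / 2 : ℂ) * ∑ c, ∑ d, (volumeMixed mink a b c d : ℂ) * sd m c d = I * sd m a b := by
  simp only [volumeMixed_mink, leviCivita_eq, Fin.sum_univ_four]
  fin_cases m <;> fin_cases a <;> fin_cases b <;>
    simp [sd, bivector, mink] <;> norm_num <;> ring_nf

end SuperEnergy

/-! ### The Bel-Robinson tensor in terms of the complex matrix. -/

namespace SuperEnergy

open Matrix Complex

/-- Each `sd m` is an eigenvector of the dual with eigenvalue `I` (`hodge_sd`), and taking real
parts commutes with the real Hodge operator. -/
lemma hodgeDual_weylOf (Q : Matrix (Fin 3) (Fin 3) ℂ) :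
    hodgeDual mink (weylOf Q) = fun a b c d => (I * cweyl Q a b c d).re := by
  funext a b c d
  have h : I * cweyl Q a b c d =
      (1 / 2 : ℂ) * ∑ e, ∑ f, (volumeMixed mink a b e f : ℂ) * cweyl Q e f c d := by
    simp only [cweyl, Finset.mul_sum]
    have e : ∀ F : Fin 4 → Fin 4 → Fin 3 → Fin 3 → ℂ,
        ∑ r, ∑ s, ∑ r', ∑ s', F r s r' s' = ∑ r', ∑ s', ∑ r, ∑ s, F r s r' s' := by
      intro F
      calc _ = ∑ r, ∑ r', ∑ s', ∑ s, F r s r' s' := by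
            refine Finset.sum_congr rfl fun r _ => ?_
            rw [Finset.sum_comm]
            exact Finset.sum_congr rfl fun h _ => Finset.sum_comm
        _ = _ := by
            rw [Finset.sum_comm]
            refine Finset.sum_congr rfl fun r _ => ?_
            rw [Finset.sum_comm]
    rw [e]
    refine Finset.sum_congr rfl fun m _ => Finset.sum_congr rfl fun n _ => ?_
    calc I * (Q m n * sd m a b * sd n c d) = Q m n * (I * sd m a b) * sd n c d := by ring
      _ = _ := by
        rw [← hodge_sd]
        simp only [Finset.mul_sum, Finset.sum_mul]
        exact Finset.sum_congr rfl fun _ _ => Finset.sum_congr rfl fun _ _ => by ring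
  rw [h, hodgeDual]
  have h2 : (1 / 2 : ℂ) = ((1 / 2 : ℝ) : ℂ) := by norm_num
  rw [h2, Complex.re_ofReal_mul, Complex.re_sum]
  congr 1
  refine Finset.sum_congr rfl fun e _ => ?_
  rw [Complex.re_sum]
  refine Finset.sum_congr rfl fun f _ => ?_
  rw [Complex.re_ofReal_mul]
  rfl

/-- The energy tensor of the pair of self-dual bivectors `sd j`, `sd k`. -/
def sdEnergy (j k : Fin 3) (a m : Fin 4) : ℂ :=
  ∑ r, (mink r r : ℂ) * sd j a r * (starRingEnd ℂ) (sd k m r)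

lemma sum_mink_mul (F : Fin 4 → Fin 4 → ℝ) :
    ∑ r, ∑ r', mink⁻¹ r r' * F r r' = ∑ r, mink r r * F r r := by
  rw [mink_inv]
  refine Finset.sum_congr rfl fun r _ => ?_
  rw [Finset.sum_eq_single r]
  all_goals simp +contextual [mink, eq_comm]

/-- If C is the complex tensor `cweyl Q`, then W = Re C and *W = Re(iC) = -Im C, so W W + *W *W is
the real part of C times its conjugate. The contraction then splits into two factors, one for each
index pair. -/
lemma belRobinson_weylOf (Q : Matrix (Fin 3) (Fin 3) ℂ) (a m b n : Fin 4) :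
    belRobinson mink (weylOf Q) a m b n =
      1 / 4 * (∑ j, ∑ l, ∑ k, ∑ p, Q j l * (starRingEnd ℂ) (Q k p) *
        (sdEnergy j k a m * sdEnergy l p b n)).re := by
  have h1 : belRobinson mink (weylOf Q) a m b n = 1 / 4 * (∑ r, ∑ s, (mink r r : ℂ) * mink s s *
      (cweyl Q a r b s * (starRingEnd ℂ) (cweyl Q m r n s))).re := by
    rw [belRobinson]
    congr 1
    have : ∀ F : Fin 4 → Fin 4 → Fin 4 → Fin 4 → ℝ,
        ∑ r, ∑ s, ∑ r', ∑ s', mink⁻¹ r r' * mink⁻¹ s s' * F r s r' s' =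
          ∑ r, ∑ s, mink r r * mink s s * F r s r s := by
      intro F
      calc _ = ∑ r, ∑ r', mink⁻¹ r r' * ∑ s, ∑ s', mink⁻¹ s s' * F r s r' s' := by
            refine Finset.sum_congr rfl fun r _ => ?_
            rw [Finset.sum_comm]
            refine Finset.sum_congr rfl fun r' _ => ?_
            simp only [Finset.mul_sum, mul_assoc]
        _ = _ := by
            rw [sum_mink_mul]
            refine Finset.sum_congr rfl fun r _ => ?_
            rw [sum_mink_mul, Finset.mul_sum]
            simp only [mul_assoc]
    rw [this, hodgeDual_weylOf, Complex.re_sum]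
    refine Finset.sum_congr rfl fun r _ => ?_
    rw [Complex.re_sum]
    refine Finset.sum_congr rfl fun s _ => ?_
    rw [← Complex.ofReal_mul, Complex.re_ofReal_mul]
    congr 1
    simp [weylOf, Complex.mul_re, Complex.conj_re, Complex.conj_im]
  rw [h1]
  congr 2
  have e : ∀ (F : Fin 3 → Fin 3 → Fin 3 → Fin 3 → Fin 4 → Fin 4 → ℂ),
      ∑ r, ∑ s, ∑ j, ∑ l, ∑ k, ∑ p, F j l k p r s =
        ∑ j, ∑ l, ∑ k, ∑ p, ∑ r, ∑ s, F j l k p r s := by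
    intro F
    have e1 : ∀ (G : Fin 3 → Fin 3 → Fin 3 → Fin 3 → Fin 4 → ℂ),
        ∑ s, ∑ j, ∑ l, ∑ k, ∑ p, G j l k p s = ∑ j, ∑ l, ∑ k, ∑ p, ∑ s, G j l k p s := by
      intro G
      rw [Finset.sum_comm]
      refine Finset.sum_congr rfl fun j _ => ?_
      rw [Finset.sum_comm]
      refine Finset.sum_congr rfl fun l _ => ?_
      rw [Finset.sum_comm]
      refine Finset.sum_congr rfl fun k _ => ?_
      rw [Finset.sum_comm]
    simp only [e1]
  have lhs : ∀ r s, (mink r r : ℂ) * mink s s *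
      (cweyl Q a r b s * (starRingEnd ℂ) (cweyl Q m r n s)) =
      ∑ j, ∑ l, ∑ k, ∑ p, (mink r r : ℂ) * mink s s * (Q j l * sd j a r * sd l b s *
        (starRingEnd ℂ) (Q k p * sd k m r * sd p n s)) := by
    intro r s
    have prod : ∀ A B : Fin 3 → Fin 3 → ℂ, (∑ j, ∑ l, A j l) * (∑ k, ∑ p, B k p) =
        ∑ j, ∑ l, ∑ k, ∑ p, A j l * B k p := by
      intro A B
      simp_rw [Finset.sum_mul, Finset.mul_sum]
    simp only [cweyl, map_sum]
    rw [prod]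
    simp only [Finset.mul_sum]
  simp only [lhs]
  rw [e]
  refine Finset.sum_congr rfl fun j _ => Finset.sum_congr rfl fun l _ =>
    Finset.sum_congr rfl fun k _ => Finset.sum_congr rfl fun p _ => ?_
  rw [sdEnergy, sdEnergy, Finset.sum_mul_sum]
  simp only [Finset.mul_sum, map_mul]
  exact Finset.sum_congr rfl fun _ _ => Finset.sum_congr rfl fun _ _ => by ring

lemma sdEnergy_zero_zero (j k : Fin 3) : sdEnergy j k 0 0 = if j = k then 1 else 0 := by
  fin_cases j <;> fin_cases k <;>
    simp [sdEnergy, sd, bivector, mink, Fin.sum_univ_four]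

end SuperEnergy

/-! ### Relative super-energy quantities of a complex matrix. -/

namespace SuperEnergy

open Matrix Complex

lemma sdEnergy_trace (j k : Fin 3) :
    sdEnergy j k 1 1 + sdEnergy j k 2 2 + sdEnergy j k 3 3 = if j = k then 1 else 0 := by
  fin_cases j <;> fin_cases k <;>
    simp [sdEnergy, sd, bivector, mink, Fin.sum_univ_four]

lemma belRobinson_weylOf_zero (Q : Matrix (Fin 3) (Fin 3) ℂ) (i : Fin 4) :
    belRobinson mink (weylOf Q) i 0 0 0 =
      1 / 4 * (∑ j, ∑ k, (Q * Qᴴ) j k * sdEnergy j k i 0).re := by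
  rw [belRobinson_weylOf]
  congr 2
  refine Finset.sum_congr rfl fun j _ => ?_
  rw [Finset.sum_comm]
  refine Finset.sum_congr rfl fun k _ => ?_
  rw [Matrix.mul_apply, Finset.sum_mul]
  refine Finset.sum_congr rfl fun l _ => ?_
  simp [sdEnergy_zero_zero, Matrix.conjTranspose_apply]

/-- Each `sdEnergy` is trace-free, so its spatial trace equals its 00 component. Symmetry of `Q`
then moves the remaining pair `i 0` to the other factor. -/
lemma belRobinson_weylOf_spatial_trace (Q : Matrix (Fin 3) (Fin 3) ℂ) (hQ : Qᵀ = Q) (i : Fin 4) :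
    ∑ a ∈ {1, 2, 3}, belRobinson mink (weylOf Q) a a i 0 =
      belRobinson mink (weylOf Q) i 0 0 0 := by
  rw [belRobinson_weylOf_zero]
  simp only [belRobinson_weylOf]
  rw [← Finset.mul_sum, ← Complex.re_sum]
  congr 2
  have h : ∀ j k, ∑ a ∈ ({1, 2, 3} : Finset (Fin 4)), sdEnergy j k a a = if j = k then 1 else 0 := by
    intro j k
    rw [← sdEnergy_trace, Finset.sum_insert (by decide), Finset.sum_pair (by decide), add_assoc]
  calc _ = ∑ j, ∑ l, ∑ k, ∑ p, Q j l * (starRingEnd ℂ) (Q k p) *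
        ((∑ a ∈ ({1, 2, 3} : Finset (Fin 4)), sdEnergy j k a a) * sdEnergy l p i 0) := by
        rw [Finset.sum_comm]
        refine Finset.sum_congr rfl fun j _ => ?_
        rw [Finset.sum_comm]
        refine Finset.sum_congr rfl fun l _ => ?_
        rw [Finset.sum_comm]
        refine Finset.sum_congr rfl fun k _ => ?_
        rw [Finset.sum_comm]
        refine Finset.sum_congr rfl fun p _ => ?_
        rw [Finset.sum_mul, Finset.mul_sum]
    _ = ∑ j, ∑ l, ∑ p, Q j l * (starRingEnd ℂ) (Q j p) * sdEnergy l p i 0 := by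
        simp only [h]
        refine Finset.sum_congr rfl fun j _ => Finset.sum_congr rfl fun l _ => ?_
        rw [Finset.sum_comm]
        refine Finset.sum_congr rfl fun p _ => ?_
        simp
    _ = _ := by
        rw [Finset.sum_comm]
        refine Finset.sum_congr rfl fun l _ => ?_
        rw [Finset.sum_comm]
        refine Finset.sum_congr rfl fun p _ => ?_
        rw [Matrix.mul_apply, Finset.sum_mul]
        refine Finset.sum_congr rfl fun j _ => ?_
        rw [Matrix.conjTranspose_apply, ← Matrix.transpose_apply Q j l, hQ,
          ← Matrix.transpose_apply Q j p, hQ]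
        rfl

/-- `Q * Qᴴ` is Hermitian, and the imaginary parts of its off-diagonal entries are, up to a factor,
the components of the super-Poynting vector. Their vanishing makes it real, hence symmetric. -/
lemma mul_conjTranspose_symm_of_belRobinson_eq_zero (Q : Matrix (Fin 3) (Fin 3) ℂ)
    (h : ∀ i, i ≠ 0 → belRobinson mink (weylOf Q) i 0 0 0 = 0) : (Q * Qᴴ)ᵀ = Q * Qᴴ := by
  set N := Q * Qᴴ with hN
  have hH : Nᴴ = N := by
    rw [hN, Matrix.conjTranspose_mul, Matrix.conjTranspose_conjTranspose]
  have hH' : ∀ j k, N j k = (starRingEnd ℂ) (N k j) := fun j k => by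
    conv_lhs => rw [← hH]
    rfl
  have key : (∀ j k, (N j k).im = 0) := by
    have h1 := h 1 (by decide)
    have h2 := h 2 (by decide)
    have h3 := h 3 (by decide)
    rw [belRobinson_weylOf_zero, ← hN] at h1 h2 h3
    have d0 := congrArg Complex.im (hH' 0 0)
    have d1 := congrArg Complex.im (hH' 1 1)
    have d2 := congrArg Complex.im (hH' 2 2)
    have o0 := congrArg Complex.im (hH' 0 1)
    have o1 := congrArg Complex.im (hH' 0 2)
    have o2 := congrArg Complex.im (hH' 1 2)
    simp only [Complex.conj_im] at d0 d1 d2 o0 o1 o2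
    simp [Fin.sum_univ_three, sdEnergy, sd, bivector, mink, Fin.sum_univ_four] at h1 h2 h3
    intro j k
    fin_cases j <;> fin_cases k <;> simp <;> linarith
  ext j k
  rw [Matrix.transpose_apply, hH' k j]
  apply Complex.ext
  · simp
  · simp [key]

lemma belRobinson_weylOf_diagonal (ρ : Fin 3 → ℂ) (a m b n : Fin 4) :
    belRobinson mink (weylOf (Matrix.diagonal ρ)) a m b n =
      1 / 4 * (∑ j, ∑ k, ρ j * (starRingEnd ℂ) (ρ k) *
        (sdEnergy j k a m * sdEnergy j k b n)).re := by
  rw [belRobinson_weylOf]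
  congr 2
  refine Finset.sum_congr rfl fun j _ => ?_
  rw [Finset.sum_eq_single j]
  · refine Finset.sum_congr rfl fun k _ => ?_
    rw [Finset.sum_eq_single k]
    · simp
    · intro p _ hp
      simp [Matrix.diagonal_apply_ne _ hp.symm]
    · simp
  · intro p _ hp
    simp [Matrix.diagonal_apply_ne _ hp.symm]
  · simp

/-- The 00 factor keeps only the terms with equal indices, and the spatial block of `sdEnergy k k`
is diagonal, with -1 in direction `k` and 1 in the other two. -/
lemma superStress_weylOf_diagonal (ρ : Fin 3 → ℂ) (i j : Fin 3) :
    belRobinson mink (weylOf (Matrix.diagonal ρ)) i.succ j.succ 0 0 =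
      if i = j then 1 / 4 * (∑ k, normSq (ρ k)) - 1 / 2 * normSq (ρ i) else 0 := by
  rw [belRobinson_weylOf_diagonal]
  have h : ∀ k, sdEnergy k k i.succ j.succ =
      if i = j then (if i = k then -1 else 1) else 0 := by
    intro k
    fin_cases i <;> fin_cases j <;> fin_cases k <;>
      simp [sdEnergy, sd, bivector, mink, Fin.sum_univ_four]
  have h2 : ∑ l, ∑ k, ρ l * (starRingEnd ℂ) (ρ k) *
        (sdEnergy l k i.succ j.succ * sdEnergy l k 0 0) =
      ∑ l, (normSq (ρ l) : ℂ) * (if i = j then (if i = l then -1 else 1) else 0) := by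
    refine Finset.sum_congr rfl fun l _ => ?_
    rw [Finset.sum_eq_single l]
    · rw [h, sdEnergy_zero_zero, Complex.mul_conj]
      simp
    · intro k _ hk
      simp [sdEnergy_zero_zero, hk.symm]
    · simp
  rw [h2, Fin.sum_univ_three, Fin.sum_univ_three]
  fin_cases i <;> fin_cases j <;> simp <;> ring

/-- Only components with three distinct spatial indices can be non-zero, and they are multiples of
Im(ρ_i conj ρ_j). Since the eigenvalues sum to zero, these numbers all agree up to sign. -/
lemma stressFlux_weylOf_diagonal (ρ : Fin 3 → ℂ) (hρ : ∑ k, ρ k = 0) :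
    (∀ i j k : Fin 4, i ≠ 0 → j ≠ 0 → k ≠ 0 →
      belRobinson mink (weylOf (Matrix.diagonal ρ)) i j k 0 = 0) ↔
      (ρ 0 * (starRingEnd ℂ) (ρ 1)).im = 0 := by
  rw [Fin.sum_univ_three] at hρ
  have h2 : ρ 2 = -(ρ 0 + ρ 1) := by linear_combination hρ
  constructor
  · intro h
    have := h 1 2 3 (by decide) (by decide) (by decide)
    rw [belRobinson_weylOf_diagonal] at this
    simp [Fin.sum_univ_three, sdEnergy, sd, bivector, mink, Fin.sum_univ_four] at this
    simp only [Complex.mul_im, Complex.conj_re, Complex.conj_im]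
    linarith
  · intro h i j k hi hj hk
    simp only [Complex.mul_im, Complex.conj_re, Complex.conj_im] at h
    rw [belRobinson_weylOf_diagonal]
    fin_cases i <;> first | exact absurd rfl hi | skip
    all_goals fin_cases j <;> first | exact absurd rfl hj | skip
    all_goals fin_cases k <;> first | exact absurd rfl hk | skip
    all_goals simp [Fin.sum_univ_three, sdEnergy, sd, bivector, mink, Fin.sum_univ_four, h2]
    all_goals linarith

/-- At rest in the canonical frame. -/
lemma superPoynting_weylOf_diagonal (ρ : Fin 3 → ℂ) (i : Fin 4) (hi : i ≠ 0) :
    belRobinson mink (weylOf (Matrix.diagonal ρ)) i 0 0 0 = 0 := by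
  rw [belRobinson_weylOf_diagonal]
  fin_cases i <;> first | exact absurd rfl hi | skip
  all_goals simp [Fin.sum_univ_three, sdEnergy, sd, bivector, mink, Fin.sum_univ_four]

end SuperEnergy

/-! ### Weyl tensors of Minkowski space as complex symmetric trace-free matrices. -/

namespace SuperEnergy

open Matrix Complex

/-- The component matrix of a Weyl tensor of Minkowski space. -/
def weylMatrix (W : Tensor4) : Matrix (Fin 3) (Fin 3) ℂ :=
  Matrix.of fun m n => ⟨W 0 m.succ 0 n.succ, -W 0 m.succ (n + 1).succ (n + 2).succ⟩

lemma tensor4_ext_of_antisymm {W W' : Tensor4} (h1 : ∀ a b c d, W a b c d = -W b a c d)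
    (h2 : ∀ a b c d, W a b c d = -W a b d c) (h1' : ∀ a b c d, W' a b c d = -W' b a c d)
    (h2' : ∀ a b c d, W' a b c d = -W' a b d c)
    (h : ∀ a b c d, a < b → c < d → W a b c d = W' a b c d) : W = W' := by
  have hr : ∀ a b c d, a < b → W a b c d = W' a b c d := by
    intro a b c d hab
    rcases lt_trichotomy c d with hcd | hcd | hcd
    · exact h a b c d hab hcd
    · subst hcd
      linarith [h2 a b c c, h2' a b c c]
    · rw [h2, h2', h a b d c hab hcd]
  funext a b c d
  rcases lt_trichotomy a b with hab | hab | hab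
  · exact hr a b c d hab
  · subst hab
    linarith [h1 a a c d, h1' a a c d]
  · rw [h1, h1', hr b a c d hab]

lemma sd_antisymm (m : Fin 3) (a b : Fin 4) : sd m a b = -sd m b a := by
  fin_cases a <;> fin_cases b <;> simp [sd, bivector]

lemma weylOf_antisymm_left (Q : Matrix (Fin 3) (Fin 3) ℂ) (a b c d : Fin 4) :
    weylOf Q a b c d = -weylOf Q b a c d := by
  rw [weylOf, weylOf, ← Complex.neg_re]
  congr 1
  simp only [cweyl, ← Finset.sum_neg_distrib, sd_antisymm _ a b]
  exact Finset.sum_congr rfl fun _ _ => Finset.sum_congr rfl fun _ _ => by ring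

lemma weylOf_antisymm_right (Q : Matrix (Fin 3) (Fin 3) ℂ) (a b c d : Fin 4) :
    weylOf Q a b c d = -weylOf Q a b d c := by
  rw [weylOf, weylOf, ← Complex.neg_re]
  congr 1
  simp only [cweyl, ← Finset.sum_neg_distrib, sd_antisymm _ c d]
  exact Finset.sum_congr rfl fun _ _ => Finset.sum_congr rfl fun _ _ => by ring

lemma IsWeylTensor.trace_mink {W : Tensor4} (h : IsWeylTensor mink W) (b d : Fin 4) :
    -W 0 b 0 d + W 1 b 1 d + W 2 b 2 d + W 3 b 3 d = 0 := by
  have := h.trace b d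
  rw [mink_inv] at this
  simpa [Fin.sum_univ_four, mink, Matrix.diagonal_apply] using this

/-- The trace equations express the remaining components through the electric part `W 0 m 0 n` and
the magnetic part, the real and (up to sign) imaginary parts of the matrix, whose indices `n + 1`,
`n + 2` run cyclically. Tracelessness is the 00 trace equation for the real part and the cyclic
identity for the imaginary part. -/
lemma IsWeylTensor.eq_weylOf {W : Tensor4} (h : IsWeylTensor mink W) :
    W = weylOf (weylMatrix W) ∧ (weylMatrix W)ᵀ = weylMatrix W ∧ (weylMatrix W).trace = 0 := by
  have tr := h.trace_mink
  have al := h.antisymm_left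
  have ar := h.antisymm_right
  have ps := h.pair_symm
  have z : ∀ a c d, W a a c d = 0 := fun a c d => by linarith [al a a c d]
  have z' : ∀ a c d, W c d a a = 0 := fun a c d => by linarith [ar c d a a]
  have t00 := tr 0 0
  have t01 := tr 0 1
  have t02 := tr 0 2
  have t03 := tr 0 3
  have t11 := tr 1 1
  have t12 := tr 1 2
  have t13 := tr 1 3
  have t22 := tr 2 2
  have t23 := tr 2 3
  have t33 := tr 3 3
  have cy := h.cyclic 0 1 2 3
  simp only [z, z'] at t00 t01 t02 t03 t11 t12 t13 t22 t23 t33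
  simp only [al 1 0, al 2 0, al 3 0, al 2 1, al 3 1, al 3 2, ar _ _ 1 0, ar _ _ 2 0, ar _ _ 3 0,
    ar _ _ 2 1, ar _ _ 3 1, ar _ _ 3 2] at t00 t01 t02 t03 t11 t12 t13 t22 t23 t33 cy
  refine ⟨?_, ?_, ?_⟩
  · refine tensor4_ext_of_antisymm al ar (weylOf_antisymm_left _) (weylOf_antisymm_right _) ?_
    intro a b c d hab hcd
    fin_cases a <;> fin_cases b <;> (try exact absurd hab (by decide)) <;> fin_cases c <;>
      fin_cases d <;> (try exact absurd hcd (by decide)) <;>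
      simp [weylOf, cweyl, Fin.sum_univ_three, sd, bivector, weylMatrix, ar _ _ 3 1,
        ps 0 2 0 1, ps 0 3 0 1, ps 0 3 0 2, ps 1 2 0 1, ps 1 3 0 1, ps 2 3 0 1, ps 1 2 0 2,
        ps 1 3 0 2, ps 2 3 0 2, ps 1 2 0 3, ps 1 3 0 3, ps 2 3 0 3, ps 1 3 1 2, ps 2 3 1 2,
        ps 2 3 1 3] <;> linarith
  · ext m n
    rw [Matrix.transpose_apply]
    apply Complex.ext
    · exact ps _ _ _ _
    · fin_cases m <;> fin_cases n <;>
        simp [weylMatrix, ar _ _ 3 1] <;> linarith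
  · rw [Matrix.trace, Fin.sum_univ_three]
    apply Complex.ext
    · simp [weylMatrix]
      linarith
    · simp [weylMatrix, ar _ _ 3 1]
      linarith

/-- The rows 01, 02, 03 of the self-duality equation give the spatial components from the electric
ones. -/
lemma eq_bivector_of_isSelfDual {X : Fin 4 → Fin 4 → ℂ} (h : IsSelfDualBivector mink X) :
    ∀ a b, X a b = bivector (fun m => X 0 m.succ) a b := by
  obtain ⟨ha, hs⟩ := h
  have z : ∀ a, X a a = 0 := fun a => by linear_combination (1 / 2 : ℂ) * ha a a
  have h1 := hs 0 1
  have h2 := hs 0 2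
  have h3 := hs 0 3
  simp only [volumeMixed_mink, leviCivita_eq, Fin.sum_univ_four] at h1 h2 h3
  simp [mink, z, ha 3 2, ha 2 1, ha 3 1] at h1 h2 h3
  norm_num at h1 h2 h3
  intro a b
  fin_cases a <;> fin_cases b <;> simp [bivector, z, ha 1 0, ha 2 0, ha 3 0, ha 3 2, ha 2 1, ha 3 1]
  all_goals first | linear_combination h1 | linear_combination h2 | linear_combination h3 |
    linear_combination -h1 | linear_combination -h2

lemma weylMap_bivector_zero (Q : Matrix (Fin 3) (Fin 3) ℂ) (x : Fin 3 → ℂ) (m : Fin 3) :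
    weylMap mink (weylOf Q) (bivector x) 0 m.succ = -(Q *ᵥ x) m := by
  have h : ∀ F : Fin 4 → Fin 4 → Fin 4 → Fin 4 → ℂ,
      ∑ e, ∑ f, ∑ c, ∑ d, (mink⁻¹ e c : ℂ) * (mink⁻¹ f d : ℂ) * F e f c d =
        ∑ e, ∑ f, (mink e e : ℂ) * (mink f f : ℂ) * F e f e f := by
    intro F
    rw [mink_inv]
    refine Finset.sum_congr rfl fun e _ => Finset.sum_congr rfl fun f _ => ?_
    rw [Finset.sum_eq_single e, Finset.sum_eq_single f]
    all_goals simp +contextual [mink, Matrix.diagonal_apply, eq_comm]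
  have h' : weylMap mink (weylOf Q) (bivector x) 0 m.succ = 1 / 2 * ∑ e, ∑ f, (mink e e : ℂ) *
      (mink f f : ℂ) * ((weylOf Q 0 m.succ e f : ℂ) * bivector x e f) := by
    rw [← h fun e f c d => (weylOf Q 0 m.succ e f : ℂ) * bivector x c d]
    unfold weylMap
    congr 1
    refine Finset.sum_congr rfl fun _ _ => Finset.sum_congr rfl fun _ _ =>
      Finset.sum_congr rfl fun _ _ => Finset.sum_congr rfl fun _ _ => ?_
    push_cast
    ring
  have hc : ∀ m n, Q m n = ((Q m n).re : ℂ) + (Q m n).im * I :=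
    fun m n => (Complex.re_add_im _).symm
  rw [h', Matrix.mulVec, dotProduct, Fin.sum_univ_three]
  simp only [Fin.sum_univ_four]
  fin_cases m <;> simp [weylOf, cweyl, Fin.sum_univ_three, sd, bivector, mink]
  · linear_combination x 0 * hc 0 0 + x 1 * hc 0 1 + x 2 * hc 0 2
  · linear_combination x 0 * hc 1 0 + x 1 * hc 1 1 + x 2 * hc 1 2
  · linear_combination x 0 * hc 2 0 + x 1 * hc 2 1 + x 2 * hc 2 2

lemma IsTypeI.exists_eigenvectors {Q : Matrix (Fin 3) (Fin 3) ℂ} (h : IsTypeI mink (weylOf Q)) :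
    ∃ (ρ : Fin 3 → ℂ) (y : Fin 3 → Fin 3 → ℂ), Function.Injective ρ ∧ (∀ k, y k ≠ 0) ∧
      ∀ k, Q *ᵥ y k = ρ k • y k := by
  obtain ⟨ρ, hρ, hev⟩ := h
  choose X hX0 hXs hXe using hev
  -- By `weylMap_bivector_zero` the Weyl map is `-Q` on electric parts, hence the sign.
  refine ⟨fun k => -ρ k, fun k m => X k 0 m.succ, fun i j hij => hρ (neg_injective hij),
    fun k h0 => hX0 k ?_, fun k => ?_⟩
  · funext a b
    rw [eq_bivector_of_isSelfDual (hXs k), show (fun m : Fin 3 => X k 0 m.succ) = 0 from h0]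
    fin_cases a <;> fin_cases b <;> simp [bivector]
  · ext m
    have h1 : X k = bivector fun m => X k 0 m.succ := by
      funext a b
      exact eq_bivector_of_isSelfDual (hXs k) a b
    have h2 := hXe k 0 m.succ
    have h3 := weylMap_bivector_zero Q (fun m => X k 0 m.succ) m
    rw [← h1, h2] at h3
    rw [Pi.smul_apply, smul_eq_mul]
    linear_combination h3

end SuperEnergy

namespace SuperEnergy

open Matrix Complex

/-! ### The Clifford relations of self-dual bivectors -/

/-- The endomorphism of the tangent space defined by the self-dual bivector with electric part
`x`. -/
def mixed (x : Fin 3 → ℂ) : Matrix (Fin 4) (Fin 4) ℂ :=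
  !![0, x 0, x 1, x 2; x 0, 0, -(I * x 2), I * x 1; x 1, I * x 2, 0, -(I * x 0);
    x 2, -(I * x 1), I * x 0, 0]

/-- The complex conjugate of a matrix. -/
abbrev conjMat (A : Matrix (Fin 4) (Fin 4) ℂ) : Matrix (Fin 4) (Fin 4) ℂ := A.map (starRingEnd ℂ)

lemma conjMat_mul (A B : Matrix (Fin 4) (Fin 4) ℂ) : conjMat (A * B) = conjMat A * conjMat B :=
  Matrix.map_mul

lemma conjMat_conjMat (A : Matrix (Fin 4) (Fin 4) ℂ) : conjMat (conjMat A) = A := by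
  ext i j
  simp

lemma bivector_eq (x : Fin 3 → ℂ) : bivector x = -(toComplex mink * mixed x) := by
  ext i j
  fin_cases i <;> fin_cases j <;>
    simp [bivector, mixed, mink, Matrix.mul_apply, Matrix.diagonal_apply]

lemma bivector_transpose (x : Fin 3 → ℂ) : (bivector x)ᵀ = -bivector x := by
  ext i j
  fin_cases i <;> fin_cases j <;> simp [bivector]

lemma toComplex_mink_transpose : (toComplex mink)ᵀ = toComplex mink := by
  rw [← Matrix.transpose_map, mink_transpose]

lemma mixed_transpose_mul (x : Fin 3 → ℂ) :
    (mixed x)ᵀ * toComplex mink = -(toComplex mink * mixed x) := by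
  have h := bivector_transpose x
  rw [bivector_eq, Matrix.transpose_neg, Matrix.transpose_mul, toComplex_mink_transpose] at h
  rw [neg_neg] at h
  rw [← h, neg_neg]

/-- The multiplication rule of Pauli matrices, here for endomorphisms of complexified Minkowski
space. -/
lemma mixed_mul_mixed (x y : Fin 3 → ℂ) :
    mixed x * mixed y = (x ⬝ᵥ y) • (1 : Matrix (Fin 4) (Fin 4) ℂ) + I • mixed (crossProduct x y) := by
  ext i j
  fin_cases i <;> fin_cases j <;>
    simp [mixed, Matrix.mul_apply, Fin.sum_univ_four, cross_apply, dotProduct,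
      Fin.sum_univ_three, -mul_eq_mul_left_iff]
  all_goals first | ring1 | (ring_nf; simp only [Complex.I_sq]; ring)

/-- The self-dual and anti-self-dual parts of the complexified Lorentz algebra commute. -/
lemma mixed_mul_conj (x y : Fin 3 → ℂ) :
    mixed x * conjMat (mixed y) = conjMat (mixed y) * mixed x := by
  ext i j
  fin_cases i <;> fin_cases j <;>
    simp [mixed, Matrix.mul_apply, Fin.sum_univ_four]
  all_goals first | ring1 | (ring_nf; simp only [Complex.I_sq]; ring)

/-- A complex orthonormal, positively oriented triad. -/
structure IsTriad (x : Fin 3 → Fin 3 → ℂ) : Prop where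
  dot : ∀ k l, x k ⬝ᵥ x l = if k = l then 1 else 0
  cross : ∀ k, crossProduct (x k) (x (k + 1)) = x (k + 2)

namespace IsTriad

variable {x : Fin 3 → Fin 3 → ℂ}

lemma mixed_sq (h : IsTriad x) (k : Fin 3) : mixed (x k) * mixed (x k) = 1 := by
  have hz : mixed 0 = 0 := by
    ext i j
    fin_cases i <;> fin_cases j <;> simp [mixed]
  rw [mixed_mul_mixed, h.dot, cross_self, hz]
  simp

lemma mixed_mul_next (h : IsTriad x) (k : Fin 3) :
    mixed (x k) * mixed (x (k + 1)) = I • mixed (x (k + 2)) := by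
  rw [mixed_mul_mixed, h.dot, h.cross, if_neg, zero_smul, zero_add]
  fin_cases k <;> decide

lemma mixed_neg (y : Fin 3 → ℂ) : mixed (-y) = -mixed y := by
  ext i j
  fin_cases i <;> fin_cases j <;> simp [mixed]

lemma mixed_mul_prev (h : IsTriad x) (k : Fin 3) :
    mixed (x k) * mixed (x (k + 2)) = -(I • mixed (x (k + 1))) := by
  have h1 := h.cross (k + 2)
  rw [show k + 2 + 1 = k by fin_cases k <;> rfl, show k + 2 + 2 = k + 1 by fin_cases k <;> rfl] at h1
  rw [mixed_mul_mixed, h.dot, ← cross_anticomm, h1, if_neg, zero_smul, zero_add, mixed_neg,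
    smul_neg]
  fin_cases k <;> decide

/-- Up to normalization, the projector onto the timelike axis of the triad. -/
def axis (x : Fin 3 → Fin 3 → ℂ) : Matrix (Fin 4) (Fin 4) ℂ :=
  1 + ∑ k, mixed (x k) * conjMat (mixed (x k))

lemma axis_eq (k : Fin 3) : axis x = 1 + mixed (x k) * conjMat (mixed (x k)) +
    mixed (x (k + 1)) * conjMat (mixed (x (k + 1))) +
    mixed (x (k + 2)) * conjMat (mixed (x (k + 2))) := by
  rw [axis, Fin.sum_univ_three]
  fin_cases k <;> simp <;> abel

lemma conj_axis : conjMat (axis x) = axis x := by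
  rw [axis_eq 0]
  simp only [conjMat, Matrix.map_add _ (map_add (starRingEnd ℂ)), Matrix.map_mul,
    Matrix.map_one _ (map_zero (starRingEnd ℂ)) (map_one (starRingEnd ℂ))]
  change _ + _ * conjMat (conjMat _) + _ * conjMat (conjMat _) + _ * conjMat (conjMat _) = _
  simp only [conjMat_conjMat, mixed_mul_conj]

/-- A form in which invariance under conjugation is visible: as `mixed` matrices commute with
conjugates of `mixed` matrices, conjugation exchanges the first two terms and also the last two. -/
lemma mixed_mul_axis (h : IsTriad x) (k : Fin 3) :
    mixed (x k) * axis x = mixed (x k) + conjMat (mixed (x k)) +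
      I • (mixed (x (k + 2)) * conjMat (mixed (x (k + 1)))) -
      I • (mixed (x (k + 1)) * conjMat (mixed (x (k + 2)))) := by
  rw [axis_eq k]
  simp only [Matrix.mul_add, ← Matrix.mul_assoc, h.mixed_sq, h.mixed_mul_next, h.mixed_mul_prev,
    Matrix.mul_one, Matrix.one_mul, Matrix.neg_mul, Matrix.smul_mul, sub_eq_add_neg]

lemma conj_mixed_mul_axis (h : IsTriad x) (k : Fin 3) :
    conjMat (mixed (x k) * axis x) = mixed (x k) * axis x := by
  rw [h.mixed_mul_axis]
  have e : ∀ A B : Matrix (Fin 4) (Fin 4) ℂ, conjMat (I • (A * B)) = -(I • (conjMat A * conjMat B)) := by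
    intro A B
    rw [← conjMat_mul]
    ext i j
    simp only [Matrix.map_apply, Matrix.smul_apply, Matrix.neg_apply, smul_eq_mul, map_mul,
      Complex.conj_I, neg_mul]
  have e' : ∀ A B : Matrix (Fin 4) (Fin 4) ℂ, conjMat (A + B) = conjMat A + conjMat B := by
    intro A B
    ext i j
    simp
  have e'' : ∀ A B : Matrix (Fin 4) (Fin 4) ℂ, conjMat (A - B) = conjMat A - conjMat B := by
    intro A B
    ext i j
    simp
  rw [e'', e', e', e, e, conjMat_conjMat, conjMat_conjMat, conjMat_conjMat, ← mixed_mul_conj,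
    ← mixed_mul_conj]
  abel

/-- Write m for `mixed (x k)`. By reality of m `axis x` and of `axis x`, the conjugate of m acts on
`axis x` as m does; since m² = 1, each of the four summands of `axis x` multiplies it to itself. -/
lemma axis_sq (h : IsTriad x) : axis x * axis x = (4 : ℂ) • axis x := by
  have e : ∀ k, mixed (x k) * conjMat (mixed (x k)) * axis x = axis x := by
    intro k
    rw [mixed_mul_conj, Matrix.mul_assoc, ← h.conj_mixed_mul_axis, ← conjMat_mul,
      ← Matrix.mul_assoc, h.mixed_sq, Matrix.one_mul, conj_axis]
  conv_lhs => enter [1]; rw [axis_eq 0]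
  rw [Matrix.add_mul, Matrix.add_mul, Matrix.add_mul, e, e, e, Matrix.one_mul]
  module

/-- Each factor is skew for the metric and the two commute, so their product is self-adjoint. -/
lemma axis_transpose_mul : (axis x)ᵀ * toComplex mink = toComplex mink * axis x := by
  have hc : ∀ y, (conjMat (mixed y))ᵀ * toComplex mink = -(toComplex mink * conjMat (mixed y)) := by
    intro y
    have h1 := congrArg conjMat (mixed_transpose_mul y)
    have h2 : conjMat (toComplex mink) = toComplex mink := by
      ext i j
      simp
    have h3 : ∀ A : Matrix (Fin 4) (Fin 4) ℂ, conjMat (-A) = -conjMat A := by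
      intro A
      ext i j
      simp
    rw [h3, conjMat_mul, conjMat_mul, h2] at h1
    exact h1
  have e : ∀ y, (mixed y * conjMat (mixed y))ᵀ * toComplex mink =
      toComplex mink * (mixed y * conjMat (mixed y)) := by
    intro y
    rw [Matrix.transpose_mul, Matrix.mul_assoc, mixed_transpose_mul, Matrix.mul_neg,
      ← Matrix.mul_assoc, hc, Matrix.neg_mul, neg_neg, Matrix.mul_assoc, mixed_mul_conj]
  rw [axis_eq 0]
  simp only [Matrix.transpose_add, Matrix.add_mul, Matrix.mul_add, e, Matrix.transpose_one,
    Matrix.one_mul, Matrix.mul_one]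

lemma axis_zero_zero : ∃ t : ℝ, 1 ≤ t ∧ axis x 0 0 = t := by
  refine ⟨1 + ∑ k, ∑ i, normSq (x k i), ?_, ?_⟩
  · have : 0 ≤ ∑ k, ∑ i, normSq (x k i) :=
      Finset.sum_nonneg fun _ _ => Finset.sum_nonneg fun _ _ => normSq_nonneg _
    linarith
  · have e : ∀ y, (mixed y * conjMat (mixed y)) 0 0 = ((∑ i, normSq (y i) : ℝ) : ℂ) := by
      intro y
      simp [mixed, Matrix.mul_apply, Fin.sum_univ_four, Fin.sum_univ_three, Complex.mul_conj]
    rw [axis, Matrix.add_apply, Matrix.sum_apply]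
    simp only [e]
    push_cast
    simp

/-- The observer of a complex triad: a unit timelike vector for which all the electric parts of the
bivectors are real. -/
lemma exists_observer (h : IsTriad x) : ∃ (u : Vec) (w : Fin 3 → Vec),
    metricProd mink u u = -1 ∧
      ∀ k, (fun a => (w k a : ℂ)) = mixed (x k) *ᵥ fun a => (u a : ℂ) := by
  obtain ⟨t, ht, hat⟩ := axis_zero_zero (x := x)
  have hreal : ∀ A : Matrix (Fin 4) (Fin 4) ℂ, conjMat A = A → ∀ i j, ((A i j).re : ℂ) = A i j := by
    intro A hA i j
    exact Complex.conj_eq_iff_re.mp (congrFun (congrFun hA i) j)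
  -- For A = `axis x`, self-adjointness and A² = 4A give g(A e_0, A e_0) = -4t, so `s` is the factor
  -- that makes A e_0 a unit vector.
  obtain ⟨s, hs⟩ : ∃ s : ℝ, s ^ 2 * (4 * t) = 1 := by
    refine ⟨(Real.sqrt (4 * t))⁻¹, ?_⟩
    rw [inv_pow, Real.sq_sqrt (by linarith)]
    exact inv_mul_cancel₀ (by linarith)
  have hu : (fun a => ((s * (axis x a 0).re : ℝ) : ℂ)) = (s : ℂ) • (axis x *ᵥ Pi.single 0 1) := by
    ext a
    rw [Matrix.mulVec_single_one]
    simp [hreal _ conj_axis]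
  refine ⟨fun a => s * (axis x a 0).re, fun k a => s * ((mixed (x k) * axis x) a 0).re, ?_,
    fun k => ?_⟩
  · apply Complex.ofReal_injective
    have e1 : ∀ v : Vec, ((metricProd mink v v : ℝ) : ℂ) =
        (fun a => (v a : ℂ)) ⬝ᵥ (toComplex mink *ᵥ fun a => (v a : ℂ)) := by
      intro v
      rw [metricProd_mink]
      simp [dotProduct, Matrix.mulVec, mink, Fin.sum_univ_four]
    rw [e1, hu, Matrix.mulVec_smul, smul_dotProduct, dotProduct_smul, Matrix.mulVec_mulVec,
      ← Matrix.vecMul_transpose, ← Matrix.dotProduct_mulVec, Matrix.mulVec_mulVec,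
      ← Matrix.mul_assoc, axis_transpose_mul, Matrix.mul_assoc, h.axis_sq]
    simp only [Matrix.mul_smul, single_one_dotProduct,
      Matrix.mulVec_single_one, Matrix.col_apply]
    have : (toComplex mink * axis x) 0 0 = -t := by
      simp [Matrix.mul_apply, mink, Fin.sum_univ_four, hat]
    rw [Matrix.smul_apply, this]
    have hs' : (s : ℂ) ^ 2 * (4 * t) = 1 := by exact_mod_cast hs
    simp only [smul_eq_mul]
    push_cast
    linear_combination -hs'
  · rw [hu, Matrix.mulVec_smul, Matrix.mulVec_mulVec]
    ext a
    rw [Matrix.mulVec_single_one]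
    simp [hreal _ (h.conj_mixed_mul_axis k)]

end IsTriad

end SuperEnergy

namespace SuperEnergy

open Matrix Complex

/-! ### The canonical frame -/

lemma cweyl_diagonal (ρ : Fin 3 → ℂ) (a b c d : Fin 4) :
    cweyl (Matrix.diagonal ρ) a b c d = ∑ k, ρ k * sd k a b * sd k c d := by
  rw [cweyl]
  refine Finset.sum_congr rfl fun k _ => ?_
  rw [Finset.sum_eq_single k]
  · simp
  · intro l _ hl
    simp [Matrix.diagonal_apply_ne _ hl.symm]
  · simp

/-- `hQ` says that the complex Weyl tensor is the sum of the ρ_k B_k ⊗ B_k with B_k = `bivector (x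
k)`, and `hΛ` that the frame turns B_k into the standard `sd k`. -/
lemma pull_weylOf_eq_diagonal {Λ : Matrix (Fin 4) (Fin 4) ℝ}
    {Q : Matrix (Fin 3) (Fin 3) ℂ} {ρ : Fin 3 → ℂ} {x : Fin 3 → Fin 3 → ℂ}
    (hQ : ∀ m n, Q m n = ∑ k, ρ k * x k m * x k n)
    (hΛ : ∀ k, (toComplex Λ)ᵀ * bivector (x k) * toComplex Λ = sd k) :
    pull Λ (weylOf Q) = weylOf (Matrix.diagonal ρ) := by
  have h1 : ∀ a b c d, cweyl Q a b c d = ∑ k, ρ k * bivector (x k) a b * bivector (x k) c d := by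
    intro a b c d
    simp only [cweyl, hQ, bivector_eq_sum, Finset.sum_mul, Finset.mul_sum]
    rw [Finset.sum_comm]
    calc _ = ∑ n, ∑ k, ∑ m, ρ k * x k m * x k n * sd m a b * sd n c d :=
          Finset.sum_congr rfl fun _ _ => Finset.sum_comm
      _ = ∑ k, ∑ n, ∑ m, ρ k * x k m * x k n * sd m a b * sd n c d := Finset.sum_comm
      _ = _ := Finset.sum_congr rfl fun _ _ => Finset.sum_congr rfl fun _ _ =>
          Finset.sum_congr rfl fun _ _ => by ring
  have h3 : ∀ k a b, ∑ e, ∑ f, (Λ e a : ℂ) * Λ f b * bivector (x k) e f = sd k a b := by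
    intro k a b
    rw [← hΛ k, Matrix.mul_apply, Finset.sum_comm]
    refine Finset.sum_congr rfl fun f _ => ?_
    rw [Matrix.mul_apply, Finset.sum_mul]
    exact Finset.sum_congr rfl fun e _ => by
      simp only [Matrix.transpose_apply, Matrix.map_apply]
      ring
  funext a b c d
  have h4 : cweyl (Matrix.diagonal ρ) a b c d =
      ∑ e, ∑ f, ∑ h, ∑ k, ((Λ e a * Λ f b * Λ h c * Λ k d : ℝ) : ℂ) * cweyl Q e f h k := by
    rw [cweyl_diagonal]
    have prod : ∀ A B : Fin 4 → Fin 4 → ℂ, (∑ j, ∑ l, A j l) * (∑ k, ∑ p, B k p) =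
        ∑ j, ∑ l, ∑ k, ∑ p, A j l * B k p := by
      intro A B
      simp_rw [Finset.sum_mul, Finset.mul_sum]
    have e1 : ∀ (G : Fin 4 → Fin 4 → Fin 4 → Fin 4 → Fin 3 → ℂ),
        ∑ s, ∑ j, ∑ l, ∑ k, ∑ p, G j l k p s = ∑ j, ∑ l, ∑ k, ∑ p, ∑ s, G j l k p s := by
      intro G
      rw [Finset.sum_comm]
      refine Finset.sum_congr rfl fun j _ => ?_
      rw [Finset.sum_comm]
      refine Finset.sum_congr rfl fun l _ => ?_
      rw [Finset.sum_comm]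
      refine Finset.sum_congr rfl fun k _ => ?_
      rw [Finset.sum_comm]
    simp only [← h3, mul_assoc, prod]
    simp only [Finset.mul_sum]
    rw [e1]
    refine Finset.sum_congr rfl fun e _ => Finset.sum_congr rfl fun f _ =>
      Finset.sum_congr rfl fun h _ => Finset.sum_congr rfl fun k _ => ?_
    rw [h1, Finset.mul_sum]
    refine Finset.sum_congr rfl fun s _ => ?_
    push_cast
    ring
  rw [weylOf, h4]
  simp only [Complex.re_sum, Complex.re_ofReal_mul]
  rfl

namespace IsTriad

variable {x : Fin 3 → Fin 3 → ℂ}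

/-- The complex bilinear Minkowski product. -/
def cprod (v w : Fin 4 → ℂ) : ℂ := v ⬝ᵥ toComplex mink *ᵥ w

lemma cprod_comm (v w : Fin 4 → ℂ) : cprod v w = cprod w v := by
  rw [cprod, cprod, Matrix.dotProduct_mulVec, ← Matrix.mulVec_transpose, toComplex_mink_transpose,
    dotProduct_comm]

lemma cprod_mixed (y : Fin 3 → ℂ) (v w : Fin 4 → ℂ) :
    cprod (mixed y *ᵥ v) w = -cprod v (mixed y *ᵥ w) := by
  rw [cprod, cprod, ← Matrix.vecMul_transpose, ← Matrix.dotProduct_mulVec, Matrix.mulVec_mulVec,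
    mixed_transpose_mul, Matrix.neg_mulVec, dotProduct_neg, Matrix.mulVec_mulVec]

lemma cprod_mixed_self (y : Fin 3 → ℂ) (v : Fin 4 → ℂ) : cprod v (mixed y *ᵥ v) = 0 := by
  have h := cprod_mixed y v v
  rw [cprod_comm] at h
  linear_combination (1 / 2 : ℂ) * h

/-- Moving one skew factor across leaves a Clifford product, whose cross-product part is skew and
drops out. The electric parts of an orthonormal triad are therefore orthonormal. -/
lemma cprod_mixed_mixed (y z : Fin 3 → ℂ) (v : Fin 4 → ℂ) (hv : cprod v v = -1) :
    cprod (mixed y *ᵥ v) (mixed z *ᵥ v) = y ⬝ᵥ z := by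
  rw [cprod_mixed, Matrix.mulVec_mulVec, mixed_mul_mixed, Matrix.add_mulVec, Matrix.smul_mulVec,
    Matrix.smul_mulVec, Matrix.one_mulVec]
  have : cprod v ((y ⬝ᵥ z) • v + I • mixed (crossProduct y z) *ᵥ v) =
      (y ⬝ᵥ z) * cprod v v + I * cprod v (mixed (crossProduct y z) *ᵥ v) := by
    simp only [cprod, Matrix.mulVec_add, Matrix.mulVec_smul, dotProduct_add, dotProduct_smul,
      smul_eq_mul]
  rw [this, hv, cprod_mixed_self]
  ring

lemma cprod_mixed_mixed_mixed (y c z : Fin 3 → ℂ) (v : Fin 4 → ℂ) (hv : cprod v v = -1) :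
    cprod (mixed y *ᵥ v) (mixed c *ᵥ mixed z *ᵥ v) = I * (y ⬝ᵥ crossProduct c z) := by
  rw [Matrix.mulVec_mulVec, mixed_mul_mixed, Matrix.add_mulVec, Matrix.smul_mulVec,
    Matrix.smul_mulVec, Matrix.one_mulVec]
  have : cprod (mixed y *ᵥ v) ((c ⬝ᵥ z) • v + I • mixed (crossProduct c z) *ᵥ v) =
      (c ⬝ᵥ z) * cprod (mixed y *ᵥ v) v +
        I * cprod (mixed y *ᵥ v) (mixed (crossProduct c z) *ᵥ v) := by
    simp only [cprod, Matrix.mulVec_add, Matrix.mulVec_smul, dotProduct_add, dotProduct_smul,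
      smul_eq_mul]
  rw [this, cprod_comm, cprod_mixed_self, cprod_mixed_mixed _ _ _ hv]
  ring

lemma triple (h : IsTriad x) (l k m : Fin 3) :
    x l ⬝ᵥ crossProduct (x k) (x m) = Pi.single l 1 ⬝ᵥ
      (crossProduct (Pi.single k (1 : ℂ)) (Pi.single m 1) : Fin 3 → ℂ) := by
  have c0 : crossProduct (x 0) (x 1) = x 2 := h.cross 0
  have c1 : crossProduct (x 1) (x 2) = x 0 := h.cross 1
  have c2 : crossProduct (x 2) (x 0) = x 1 := h.cross 2
  have c0' : crossProduct (x 1) (x 0) = -x 2 := by rw [← cross_anticomm, c0]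
  have c1' : crossProduct (x 2) (x 1) = -x 0 := by rw [← cross_anticomm, c1]
  have c2' : crossProduct (x 0) (x 2) = -x 1 := by rw [← cross_anticomm, c2]
  fin_cases l <;> fin_cases k <;> fin_cases m <;>
    simp [c0, c1, c2, c0', c1', c2', cross_self, h.dot, cross_apply, dotProduct_neg]

/-- The frame formed by a unit timelike vector and the electric parts of the triad. -/
lemma exists_frame (h : IsTriad x) {u : Vec} {w : Fin 3 → Vec} (hu : metricProd mink u u = -1)
    (hw : ∀ k, (fun a => (w k a : ℂ)) = mixed (x k) *ᵥ fun a => (u a : ℂ)) :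
    ∃ Λ : Matrix (Fin 4) (Fin 4) ℝ, IsFrame mink Λ ∧ (∀ a, Λ a 0 = u a) ∧
      ∀ k, (toComplex Λ)ᵀ * bivector (x k) * toComplex Λ = sd k := by
  let v : Fin 4 → ℂ := fun a => (u a : ℂ)
  have hv : cprod v v = -1 := by
    rw [metricProd_mink] at hu
    have hu' : (((-(u 0 * u 0) + u 1 * u 1 + u 2 * u 2 + u 3 * u 3 : ℝ)) : ℂ) = ((-1 : ℝ) : ℂ) := by
      rw [hu]
    push_cast at hu'
    rw [← hu']
    simp [cprod, dotProduct, Matrix.mulVec, mink, Fin.sum_univ_four, v]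
  let col : Fin 4 → Fin 4 → ℂ := Fin.cons v fun k => mixed (x k) *ᵥ v
  let Λ : Matrix (Fin 4) (Fin 4) ℝ := (Matrix.of (Fin.cons u w : Fin 4 → Vec))ᵀ
  have hcol : ∀ i a, ((Λ a i : ℝ) : ℂ) = col i a := by
    intro i a
    refine Fin.cases ?_ (fun k => ?_) i
    · rfl
    · exact congrFun (hw k) a
  -- With `A = 1` this is the Gram matrix of the frame; with `A = mixed (x k)` it gives, up to sign,
  -- the frame components of the bivector.
  have entry : ∀ (A : Matrix (Fin 4) (Fin 4) ℂ) i j,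
      ((toComplex Λ)ᵀ * (toComplex mink * A) * toComplex Λ) i j = cprod (col i) (A *ᵥ col j) := by
    intro A i j
    have hc : toComplex Λ = (Matrix.of col)ᵀ := by
      ext a i
      exact hcol i a
    rw [hc, Matrix.transpose_transpose, cprod, Matrix.mulVec_mulVec, Matrix.mul_apply,
      Matrix.dotProduct_mulVec]
    rfl
  refine ⟨Λ, ?_, fun a => rfl, fun k => ?_⟩
  · have h1 : toComplex (Λᵀ * mink * Λ) = toComplex mink := by
      rw [toComplex_mul, toComplex_mul]
      ext i j
      have := entry 1 i j
      rw [Matrix.mul_one, Matrix.one_mulVec] at this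
      refine Eq.trans this ?_
      have e0 : ∀ k : Fin 3, cprod (mixed (x k) *ᵥ v) v = 0 := fun k => by
        rw [cprod_comm, cprod_mixed_self]
      refine Fin.cases (Fin.cases ?_ (fun l => ?_) j) (fun m => Fin.cases ?_ (fun l => ?_) j) i
      · refine hv.trans ?_
        simp [mink]
      · refine (cprod_mixed_self (x l) v).trans ?_
        simp [mink, Fin.succ_ne_zero, eq_comm]
      · refine (e0 m).trans ?_
        simp [mink, Fin.succ_ne_zero]
      · refine (cprod_mixed_mixed (x m) (x l) v hv).trans ?_
        rw [h.dot]
        fin_cases m <;> fin_cases l <;> simp [mink]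
    ext i j
    exact Complex.ofReal_injective (congrFun (congrFun h1 i) j)
  · ext i j
    rw [bivector_eq, Matrix.mul_neg, Matrix.neg_mul, Matrix.neg_apply, entry]
    refine Fin.cases (Fin.cases ?_ (fun l => ?_) j) (fun m => Fin.cases ?_ (fun l => ?_) j) i
    · have : cprod (col 0) (mixed (x k) *ᵥ col 0) = 0 := cprod_mixed_self (x k) v
      rw [this]
      simp [sd, bivector]
    · have : cprod (col 0) (mixed (x k) *ᵥ col l.succ) = -(x k ⬝ᵥ x l) := by
        rw [← cprod_mixed_mixed (x k) (x l) v hv, cprod_mixed, neg_neg]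
        rfl
      rw [this, h.dot]
      fin_cases k <;> fin_cases l <;> simp [sd, bivector]
    · have : cprod (col m.succ) (mixed (x k) *ᵥ col 0) = x m ⬝ᵥ x k :=
        cprod_mixed_mixed (x m) (x k) v hv
      rw [this, h.dot]
      fin_cases k <;> fin_cases m <;> simp [sd, bivector]
    · have : cprod (col m.succ) (mixed (x k) *ᵥ col l.succ) =
          I * (x m ⬝ᵥ crossProduct (x k) (x l)) :=
        cprod_mixed_mixed_mixed (x m) (x k) (x l) v hv
      rw [this, h.triple]
      fin_cases k <;> fin_cases m <;> fin_cases l <;> simp [sd, bivector, cross_apply]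

end IsTriad

/-- A symmetric complex matrix with distinct eigenvalues is diagonalized by a complex triad. -/
lemma exists_triad {Q : Matrix (Fin 3) (Fin 3) ℂ} (hQ : Qᵀ = Q) {ρ : Fin 3 → ℂ}
    (hρ : Function.Injective ρ) {y : Fin 3 → Fin 3 → ℂ} (hy : ∀ k, y k ≠ 0)
    (hev : ∀ k, Q *ᵥ y k = ρ k • y k) :
    ∃ x, IsTriad x ∧ (∀ k, ∃ s : ℂ, x k = s • y k) ∧
      ∀ m n, Q m n = ∑ k, ρ k * x k m * x k n := by
  -- Orthogonality holds for the bilinear product, not the Hermitian one, since `Q` is symmetric and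
  -- complex.
  have horth : ∀ k l, k ≠ l → y k ⬝ᵥ y l = 0 := by
    intro k l hkl
    have h1 : y k ⬝ᵥ (Q *ᵥ y l) = (Q *ᵥ y k) ⬝ᵥ y l := by
      rw [Matrix.dotProduct_mulVec, ← Matrix.mulVec_transpose, hQ]
    rw [hev, hev, dotProduct_smul, smul_dotProduct, smul_eq_mul, smul_eq_mul] at h1
    have h2 : (ρ l - ρ k) * (y k ⬝ᵥ y l) = 0 := by linear_combination h1
    exact (mul_eq_zero.mp h2).resolve_left (sub_ne_zero.mpr fun h => hkl (hρ h.symm))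
  have hli : LinearIndependent ℂ y := by
    refine Module.End.eigenvectors_linearIndependent' (Matrix.toLin' Q) ρ hρ y fun k => ?_
    refine ⟨Module.End.mem_eigenspace_iff.mpr ?_, hy k⟩
    rw [Matrix.toLin'_apply, hev]
  -- A complex eigenvector might be isotropic. This is excluded because the eigenvectors form a
  -- basis, whose Gram matrix is invertible, and by `horth` that matrix is diagonal.
  have hself : ∀ k, y k ⬝ᵥ y k ≠ 0 := by
    have hu : IsUnit (Matrix.of y) := Matrix.linearIndependent_rows_iff_isUnit.mp hli
    have hd : Matrix.of y * (Matrix.of y)ᵀ = Matrix.diagonal fun k => y k ⬝ᵥ y k := by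
      ext k l
      rw [Matrix.mul_apply, Matrix.diagonal_apply]
      split_ifs with hkl
      · rw [hkl]
        rfl
      · exact horth k l hkl
    have h2 := congrArg Matrix.det hd
    rw [Matrix.det_mul, Matrix.det_transpose, Matrix.det_diagonal] at h2
    have h3 : (Matrix.of y).det ≠ 0 := ((Matrix.isUnit_iff_isUnit_det _).mp hu).ne_zero
    intro k hk
    rw [Finset.prod_eq_zero (Finset.mem_univ k) hk] at h2
    exact h3 (mul_self_eq_zero.mp h2)
  have hs : ∀ k, ∃ s : ℂ, s ^ 2 * (y k ⬝ᵥ y k) = 1 := by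
    intro k
    obtain ⟨s, hs⟩ := IsAlgClosed.exists_pow_nat_eq (y k ⬝ᵥ y k)⁻¹ (n := 2) (by norm_num)
    exact ⟨s, by rw [hs, inv_mul_cancel₀ (hself k)]⟩
  choose s hs using hs
  have gram : ∀ t : Fin 3 → ℂ, (∀ k, t k ^ 2 = s k ^ 2) →
      ∀ k l, (t k • y k) ⬝ᵥ (t l • y l) = if k = l then 1 else 0 := by
    intro t ht k l
    rw [smul_dotProduct, dotProduct_smul, smul_eq_mul, smul_eq_mul]
    split_ifs with hkl
    · rw [← hkl, ← hs k, ← ht k]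
      ring
    · rw [horth k l hkl]
      ring
  have mulT : ∀ t : Fin 3 → ℂ, (∀ k, t k ^ 2 = s k ^ 2) →
      Matrix.of (fun k => t k • y k) * (Matrix.of fun k => t k • y k)ᵀ = 1 := by
    intro t ht
    ext k l
    rw [Matrix.mul_apply, Matrix.one_apply]
    exact gram t ht k l
  obtain ⟨t, ht, hdet⟩ : ∃ t : Fin 3 → ℂ, (∀ k, t k ^ 2 = s k ^ 2) ∧
      (Matrix.of fun k => t k • y k).det = 1 := by
    set τ := (Matrix.of fun k => s k • y k).det with hτ
    have hτ2 : τ ^ 2 = 1 := by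
      have := congrArg Matrix.det (mulT s fun _ => rfl)
      rw [Matrix.det_mul, Matrix.det_transpose, Matrix.det_one, ← hτ] at this
      rw [sq, this]
    -- The determinant `τ` satisfies `τ ^ 2 = 1`, so rescaling the first vector by `τ` fixes the
    -- orientation and preserves the norms.
    refine ⟨Function.update s 0 (τ * s 0), fun k => ?_, ?_⟩
    · by_cases hk : k = 0
      · rw [hk, Function.update_self, mul_pow, hτ2, one_mul]
      · rw [Function.update_of_ne hk]
    · have : (Matrix.of fun k => Function.update s 0 (τ * s 0) k • y k) =
          (Matrix.of fun k => s k • y k).updateRow 0 (τ • (s 0 • y 0)) := by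
        ext k i
        fin_cases k <;> simp [mul_assoc]
      rw [this, Matrix.det_updateRow_smul]
      have e : (Matrix.of fun k => s k • y k).updateRow 0 (s 0 • y 0) =
          Matrix.of fun k => s k • y k := by
        ext k i
        fin_cases k <;> simp
      rw [e, ← hτ, ← sq, hτ2]
  set X : Matrix (Fin 3) (Fin 3) ℂ := Matrix.of fun k => t k • y k with hX
  have hXX : X * Xᵀ = 1 := mulT t ht
  have hXX' : Xᵀ * X = 1 := mul_eq_one_comm.mp hXX
  refine ⟨fun k => t k • y k, ⟨gram t ht, fun k => ?_⟩, fun k => ⟨t k, rfl⟩, ?_⟩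
  -- A vector is determined by its products with the triad, so the cross products follow from triple
  -- products, equal to 0 or to the determinant 1.
  · have hinj : ∀ c d : Fin 3 → ℂ, X *ᵥ c = X *ᵥ d → c = d := by
      intro c d hcd
      have := congrArg (Xᵀ *ᵥ ·) hcd
      simpa only [Matrix.mulVec_mulVec, hXX', Matrix.one_mulVec] using this
    refine hinj _ _ ?_
    have h0 : (t 0 • y 0) ⬝ᵥ crossProduct (t 1 • y 1) (t 2 • y 2) = 1 := by
      rw [triple_product_eq_det, ← hdet]
      congr 1
      ext k i
      fin_cases k <;> rfl
    have h1 := triple_product_permutation (t 0 • y 0) (t 1 • y 1) (t 2 • y 2)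
    have h2 := triple_product_permutation (t 1 • y 1) (t 2 • y 2) (t 0 • y 0)
    ext l
    change (t l • y l) ⬝ᵥ _ = (t l • y l) ⬝ᵥ _
    rw [gram t ht]
    have d1 := fun v w : Fin 3 → ℂ => dot_self_cross v w
    have d2 := fun v w : Fin 3 → ℂ => dot_cross_self v w
    fin_cases k <;> fin_cases l
    · exact d1 _ _
    · exact d2 _ _
    · exact h2.symm.trans (h1.symm.trans h0)
    · exact h0
    · exact d1 _ _
    · exact d2 _ _
    · exact d2 _ _
    · exact h1.symm.trans h0
    · exact d1 _ _
  · have h1 : Q * Xᵀ = Xᵀ * Matrix.diagonal ρ := by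
      ext m k
      rw [Matrix.mul_diagonal]
      have h2 := congrFun (hev k) m
      have h3 : (Q * Xᵀ) m k = t k * (Q *ᵥ y k) m := by
        simp only [Matrix.mul_apply, Matrix.transpose_apply, hX, Matrix.of_apply, Pi.smul_apply,
          smul_eq_mul, Matrix.mulVec, dotProduct, Finset.mul_sum]
        exact Finset.sum_congr rfl fun _ _ => by ring
      rw [h3, h2]
      simp only [Matrix.transpose_apply, hX, Matrix.of_apply, Pi.smul_apply, smul_eq_mul]
      ring
    have h2 : Q = Xᵀ * Matrix.diagonal ρ * X := by
      rw [← h1, Matrix.mul_assoc, hXX', Matrix.mul_one]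
    intro m n
    conv_lhs => rw [h2]
    rw [Matrix.mul_apply]
    refine Finset.sum_congr rfl fun k _ => ?_
    rw [Matrix.mul_diagonal, Matrix.transpose_apply]
    change _ = ρ k * X k m * X k n
    ring

open scoped ComplexOrder in
/-- A normal symmetric matrix has real eigenvectors. -/
lemma exists_real_eigenvector {Q : Matrix (Fin 3) (Fin 3) ℂ} (hQ : Qᵀ = Q)
    (hN : (Q * Qᴴ)ᵀ = Q * Qᴴ) {ρ : ℂ} {y : Fin 3 → ℂ} (hy : y ≠ 0) (hev : Q *ᵥ y = ρ • y) :
    ∃ r : Fin 3 → ℂ, r ≠ 0 ∧ star r = r ∧ Q *ᵥ r = ρ • r := by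
  have hcomm : Qᴴ * Q = Q * Qᴴ := by
    have h1 : (Qᴴ)ᵀ = Qᴴ := by
      ext i j
      rw [Matrix.transpose_apply, Matrix.conjTranspose_apply, Matrix.conjTranspose_apply,
        ← Matrix.transpose_apply Q j i, hQ]
    rw [Matrix.transpose_mul, h1, hQ] at hN
    exact hN
  set A := Q - ρ • (1 : Matrix (Fin 3) (Fin 3) ℂ) with hA
  have hAA : Aᴴ * A = A * Aᴴ := by
    rw [hA, Matrix.conjTranspose_sub, Matrix.conjTranspose_smul, Matrix.conjTranspose_one]
    simp only [Matrix.sub_mul, Matrix.mul_sub, hcomm, Matrix.smul_mul, Matrix.mul_smul,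
      Matrix.one_mul, Matrix.mul_one]
    module
  have hAy : A *ᵥ y = 0 := by
    rw [hA, Matrix.sub_mulVec, hev, Matrix.smul_mulVec, Matrix.one_mulVec, sub_self]
  -- A normal matrix and its adjoint have the same kernel.
  have hAy' : Aᴴ *ᵥ y = 0 := by
    rw [← dotProduct_star_self_eq_zero, Matrix.star_mulVec,
      Matrix.conjTranspose_conjTranspose, ← Matrix.dotProduct_mulVec, Matrix.mulVec_mulVec, ← hAA,
      ← Matrix.mulVec_mulVec, hAy, Matrix.mulVec_zero, dotProduct_zero]
  have hstar : Q *ᵥ star y = ρ • star y := by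
    have h1 := congrArg star hAy'
    rw [Matrix.star_mulVec, Matrix.conjTranspose_conjTranspose, ← Matrix.mulVec_transpose, hA,
      Matrix.transpose_sub, hQ, Matrix.transpose_smul, Matrix.transpose_one, Matrix.sub_mulVec,
      Matrix.smul_mulVec, Matrix.one_mulVec, star_zero] at h1
    exact sub_eq_zero.mp h1
  -- Twice the real part of `y` is a real eigenvector unless it vanishes; then `y` is purely
  -- imaginary and `I • y` is real.
  by_cases h : y + star y = 0
  · refine ⟨I • y, smul_ne_zero Complex.I_ne_zero hy, ?_, ?_⟩
    · rw [star_smul, ← neg_eq_iff_add_eq_zero.mpr h]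
      ext i
      simp
    · rw [Matrix.mulVec_smul, hev, smul_comm]
  · refine ⟨y + star y, h, ?_, ?_⟩
    · rw [star_add, star_star, add_comm]
    · rw [Matrix.mulVec_add, hev, hstar, smul_add]

/-- For real `y` the condition reads s² Σ|y_i|² = 1, so s² is a positive real number and `s` is
real. Thus normalization keeps real eigenvectors real. -/
lemma star_eq_of_real_smul {y x : Fin 3 → ℂ} (hy : star y = y) {s : ℂ} (hx : x = s • y)
    (hxx : x ⬝ᵥ x = 1) : star x = x := by
  have hr : y ⬝ᵥ y = ((∑ i, normSq (y i) : ℝ) : ℂ) := by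
    rw [dotProduct]
    push_cast
    refine Finset.sum_congr rfl fun i _ => ?_
    rw [← Complex.mul_conj]
    congr 1
    exact (congrFun hy i).symm
  have hd : 0 ≤ ∑ i, normSq (y i) := Finset.sum_nonneg fun _ _ => normSq_nonneg _
  set d := ∑ i, normSq (y i)
  rw [hx, smul_dotProduct, dotProduct_smul, hr, smul_eq_mul, smul_eq_mul, ← mul_assoc] at hxx
  have h1 := congrArg Complex.re hxx
  have h2 := congrArg Complex.im hxx
  simp only [Complex.mul_re, Complex.mul_im, Complex.ofReal_re, Complex.ofReal_im, mul_zero,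
    sub_zero, zero_add, Complex.one_re, Complex.one_im] at h1 h2
  have him : s.im = 0 := by
    by_contra hne
    have hd0 : d ≠ 0 := fun h0 => by simp [h0] at h1
    have h3 : s.re = 0 := by
      rcases mul_eq_zero.mp h2 with h4 | h4
      · have : s.re * s.im = 0 := by linarith
        exact (mul_eq_zero.mp this).resolve_right hne
      · exact absurd h4 hd0
    rw [h3] at h1
    nlinarith [mul_nonneg (mul_self_nonneg s.im) hd]
  have hs : star s = s := Complex.conj_eq_iff_im.mpr him
  rw [hx, star_smul, hy, hs]

/-- A frame in which the Weyl tensor is diagonal, with distinct eigenvalues `ρ`. -/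
structure IsCanonicalFrame (g : Matrix (Fin 4) (Fin 4) ℝ) (W : Tensor4)
    (Λ : Matrix (Fin 4) (Fin 4) ℝ) (ρ : Fin 3 → ℂ) : Prop where
  isFrame : IsFrame g Λ
  pull_eq : pull Λ W = weylOf (Matrix.diagonal ρ)
  injective : Function.Injective ρ
  sum_eq_zero : ∑ k, ρ k = 0

lemma IsTriad.sum_eq_zero {x : Fin 3 → Fin 3 → ℂ} (hx : IsTriad x) {Q : Matrix (Fin 3) (Fin 3) ℂ}
    (ht : Q.trace = 0) {ρ : Fin 3 → ℂ} (hQ : ∀ m n, Q m n = ∑ k, ρ k * x k m * x k n) :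
    ∑ k, ρ k = 0 := by
  rw [← ht, Matrix.trace]
  simp only [Matrix.diag_apply, hQ]
  rw [Finset.sum_comm]
  refine Finset.sum_congr rfl fun k _ => ?_
  have := hx.dot k k
  rw [if_pos rfl, dotProduct] at this
  simp only [mul_assoc, ← Finset.mul_sum, this, mul_one]

lemma IsFrame.exists_canonicalFrame {g Λ : Matrix (Fin 4) (Fin 4) ℝ} {W : Tensor4}
    (h : IsFrame g Λ) (hW : IsWeylTensor g W) (hI : IsTypeI g W) :
    ∃ Λ' ρ, IsCanonicalFrame g W Λ' ρ := by
  obtain ⟨Λ₀, h0, hd, -⟩ := h.exists_oriented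
  obtain ⟨e, hs, ht⟩ := (h0.isWeylTensor hW).eq_weylOf
  have hI' := h0.isTypeI hd hI
  rw [e] at hI'
  obtain ⟨ρ, y, hρ, hy, hev⟩ := hI'.exists_eigenvectors
  obtain ⟨x, hx, -, hQ⟩ := exists_triad hs hρ hy hev
  obtain ⟨u, w, hu, hw⟩ := hx.exists_observer
  obtain ⟨L, hL, -, hL'⟩ := hx.exists_frame hu hw
  refine ⟨Λ₀ * L, ρ, h0.mul hL, ?_, hρ, hx.sum_eq_zero ht hQ⟩
  rw [← pull_pull, e]
  exact pull_weylOf_eq_diagonal hQ hL'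

lemma IsFrame.exists_canonicalFrame_of_isAtRest {g Λ : Matrix (Fin 4) (Fin 4) ℝ} {W : Tensor4}
    (h : IsFrame g Λ) (hW : IsWeylTensor g W) (hI : IsTypeI g W) {u : Vec} (hu : IsAtRest g W u) :
    ∃ Λ' ρ, IsCanonicalFrame g W Λ' ρ ∧ ∀ a, Λ' a 0 = u a := by
  obtain ⟨Λ₀, h0, hd, hu0⟩ := h.exists_of_observer hu.1
  obtain ⟨e, hs, ht⟩ := (h0.isWeylTensor hW).eq_weylOf
  have hI' := h0.isTypeI hd hI
  have hq := (h0.superPoynting_eq_zero_iff hu0 W).mp hu.2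
  rw [e] at hI' hq
  have hN := mul_conjTranspose_symm_of_belRobinson_eq_zero _ hq
  obtain ⟨ρ, y, hρ, hy, hev⟩ := hI'.exists_eigenvectors
  choose r hr0 hrr hrev using fun k => exists_real_eigenvector hs hN (hy k) (hev k)
  obtain ⟨x, hx, hxs, hQ⟩ := exists_triad hs hρ hr0 hrev
  have hxr : ∀ k, star (x k) = x k := by
    intro k
    obtain ⟨s, hsk⟩ := hxs k
    exact star_eq_of_real_smul (hrr k) hsk (by simpa using hx.dot k k)
  have hre : ∀ k i, (((x k i).re : ℝ) : ℂ) = x k i := fun k i =>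
    Complex.conj_eq_iff_re.mp (congrFun (hxr k) i)
  -- For a real triad `mixed (x k)` sends the time axis to the real vector (0, x k), so the time
  -- axis is kept and only the spatial vectors are rotated.
  obtain ⟨L, hL, hL0, hL'⟩ := hx.exists_frame (u := Pi.single 0 1)
    (w := fun k => ![0, (x k 0).re, (x k 1).re, (x k 2).re])
    (by rw [metricProd_mink]; simp) (fun k => by
      ext a
      fin_cases a <;> simp [mixed, Matrix.mulVec, dotProduct, Fin.sum_univ_four, hre])
  refine ⟨Λ₀ * L, ρ, ⟨h0.mul hL, ?_, hρ, hx.sum_eq_zero ht hQ⟩, fun a => ?_⟩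
  · rw [← pull_pull, e]
    exact pull_weylOf_eq_diagonal hQ hL'
  · rw [Matrix.mul_apply, ← hu0]
    simp [hL0, Pi.single_apply]

end SuperEnergy

namespace SuperEnergy

open Matrix Complex

/-! ### Null Debever vectors of a diagonal Weyl tensor -/

/-- The electric parts of the anti-self-dual bivectors `ℓ ∧ (sd k) ℓ`. -/
def nullForm (c : Vec) : Matrix (Fin 3) (Fin 3) ℂ :=
  !![(c 0 ^ 2 - c 1 ^ 2 : ℂ), -(c 1 * c 2) - I * (c 0 * c 3), -(c 1 * c 3) + I * (c 0 * c 2);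
    -(c 1 * c 2) + I * (c 0 * c 3), c 0 ^ 2 - c 2 ^ 2, -(c 2 * c 3) - I * (c 0 * c 1);
    -(c 1 * c 3) - I * (c 0 * c 2), -(c 2 * c 3) + I * (c 0 * c 1), c 0 ^ 2 - c 3 ^ 2]

/-- The contraction of `sd k` with a real vector. -/
def sdVec (c : Vec) (k : Fin 3) (a : Fin 4) : ℂ := ∑ b, sd k a b * c b

/-- For null `c` the bivector c ∧ (sd k)c is anti-self-dual, hence the conjugate of a self-dual one.
-/
lemma sdVec_wedge {c : Vec} (hc : metricProd mink c c = 0) (k : Fin 3) (e a : Fin 4) :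
    (lower mink c e : ℂ) * sdVec c k a - lower mink c a * sdVec c k e =
      (starRingEnd ℂ) (bivector (fun i => (starRingEnd ℂ) (nullForm c k i)) e a) := by
  rw [metricProd_mink] at hc
  have hc' : -((c 0 : ℂ) * c 0) + c 1 * c 1 + c 2 * c 2 + c 3 * c 3 = 0 := by exact_mod_cast hc
  have h : ∀ x y : ℂ, x = y ↔ x - y = 0 := fun x y => sub_eq_zero.symm
  have hI : I ^ 2 = -1 := Complex.I_sq
  rw [h]
  fin_cases k <;> fin_cases e <;> fin_cases a <;>
    simp [lower, mink, sdVec, sd, bivector, nullForm, Fin.sum_univ_four]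
  all_goals ring_nf
  all_goals (try simp only [hI])
  all_goals first
    | ring1
    | linear_combination I * hc'
    | linear_combination -I * hc'

lemma innerContract_weylOf_diagonal (ρ : Fin 3 → ℂ) (v : Vec) (a d : Fin 4) :
    innerContract (weylOf (Matrix.diagonal ρ)) v a d =
      -(∑ k, ρ k * sdVec v k a * sdVec v k d).re := by
  have h : -(∑ k, ρ k * sdVec v k a * sdVec v k d) =
      ∑ b, ∑ c, cweyl (Matrix.diagonal ρ) a b c d * v b * v c := by
    have h1 : ∀ k, ∑ c, sd k c d * (v c : ℂ) = -sdVec v k d := fun k => by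
      simp only [sdVec, ← Finset.sum_neg_distrib, sd_antisymm k _ d, neg_mul]
    calc _ = ∑ k, ∑ b, ∑ c, ρ k * sd k a b * sd k c d * v b * v c := by
          rw [← Finset.sum_neg_distrib]
          refine Finset.sum_congr rfl fun k _ => ?_
          rw [← mul_neg, ← h1, sdVec]
          simp only [Finset.mul_sum, Finset.sum_mul]
          rw [Finset.sum_comm]
          exact Finset.sum_congr rfl fun b _ => Finset.sum_congr rfl fun c _ => by ring
      _ = ∑ b, ∑ k, ∑ c, ρ k * sd k a b * sd k c d * v b * v c := Finset.sum_comm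
      _ = ∑ b, ∑ c, ∑ k, ρ k * sd k a b * sd k c d * v b * v c :=
          Finset.sum_congr rfl fun _ _ => Finset.sum_comm
      _ = _ := by simp only [cweyl_diagonal, Finset.sum_mul]
  rw [← Complex.neg_re, h, Complex.re_sum]
  simp only [innerContract, Matrix.of_apply, weylOf, Complex.re_sum, Complex.re_mul_ofReal]

lemma weylMatrix_weylOf (Q : Matrix (Fin 3) (Fin 3) ℂ) : weylMatrix (weylOf Q) = Q := by
  ext m n
  apply Complex.ext <;> fin_cases m <;> fin_cases n <;>
    simp [weylMatrix, weylOf, cweyl, Fin.sum_univ_three, sd, bivector]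

lemma weylOf_eq_zero_iff (Q : Matrix (Fin 3) (Fin 3) ℂ) : weylOf Q = 0 ↔ Q = 0 := by
  refine ⟨fun h => ?_, fun h => ?_⟩
  · rw [← weylMatrix_weylOf Q, h]
    ext m n
    simp [weylMatrix, Complex.ext_iff]
  · funext a b c d
    simp [h, weylOf, cweyl]

lemma transpose_mul_diagonal_mul (ρ : Fin 3 → ℂ) (A : Matrix (Fin 3) (Fin 3) ℂ) (i j : Fin 3) :
    (Aᵀ * Matrix.diagonal ρ * A) i j = ∑ k, ρ k * A k i * A k j := by
  rw [Matrix.mul_apply]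
  refine Finset.sum_congr rfl fun k _ => ?_
  rw [Matrix.mul_diagonal, Matrix.transpose_apply]
  ring

/-- The antisymmetrized tensor is the real part of Σ ρ_k B_k ⊗ B_k with B_k anti-self-dual;
conjugation brings it to the form `weylOf`. Since `weylOf` vanishes only for the zero matrix, the
Debever condition becomes a 3×3 matrix equation. -/
lemma debeverTensor_weylOf_diagonal (ρ : Fin 3 → ℂ) {c : Vec} (hc : metricProd mink c c = 0) :
    debeverTensor (lower mink c) (innerContract (weylOf (Matrix.diagonal ρ)) c) =
      weylOf (((nullForm c)ᵀ * Matrix.diagonal ρ * nullForm c).map (starRingEnd ℂ)) := by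
  funext e a d f
  set B : Fin 3 → Fin 4 → Fin 4 → ℂ := fun k e a =>
    (lower mink c e : ℂ) * sdVec c k a - lower mink c a * sdVec c k e with hB
  have h1 : debeverTensor (lower mink c) (innerContract (weylOf (Matrix.diagonal ρ)) c) e a d f =
      (∑ k, ρ k * B k e a * B k d f).re := by
    simp only [debeverTensor, sandwich, leftSwap, rightSwap, innerContract_weylOf_diagonal,
      Pi.add_apply, Pi.neg_apply, Complex.re_sum, Finset.mul_sum, Finset.sum_mul,
      ← Finset.sum_neg_distrib, ← Finset.sum_add_distrib]
    refine Finset.sum_congr rfl fun k _ => ?_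
    simp only [hB, Complex.mul_re, Complex.mul_im, Complex.sub_re, Complex.sub_im,
      Complex.ofReal_re, Complex.ofReal_im]
    ring
  have h2 : ∀ k e a, B k e a = ∑ m, nullForm c k m * (starRingEnd ℂ) (sd m e a) := by
    intro k e a
    rw [hB]
    simp only [sdVec_wedge hc, bivector_eq_sum, map_sum, map_mul, Complex.conj_conj]
  rw [h1, weylOf, ← Complex.conj_re]
  congr 1
  simp only [cweyl, h2, Matrix.map_apply, transpose_mul_diagonal_mul, map_mul,
    Complex.conj_conj, Fin.sum_univ_three, map_add]
  ring

lemma isDebeverVector_weylOf_diagonal_iff (ρ : Fin 3 → ℂ) (c : Vec) :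
    IsDebeverVector mink (weylOf (Matrix.diagonal ρ)) c ↔ c ≠ 0 ∧ metricProd mink c c = 0 ∧
      ∀ i j, ∑ k, ρ k * nullForm c k i * nullForm c k j = 0 := by
  rw [isDebeverVector_iff]
  refine and_congr_right fun _ => and_congr_right fun hc => ?_
  rw [debeverTensor_weylOf_diagonal ρ hc, weylOf_eq_zero_iff]
  simp only [← Matrix.ext_iff, Matrix.map_apply, Matrix.zero_apply, map_eq_zero,
    transpose_mul_diagonal_mul]

end SuperEnergy

namespace SuperEnergy

open Matrix Complex

/-! ### Null vectors from isotropic complex vectors -/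

/-- The Minkowski null vector of an isotropic complex vector. -/
def nullVec (k : Fin 3 → ℂ) : Vec :=
  ![∑ j, normSq (k j), -2 * (k 1 * (starRingEnd ℂ) (k 2)).im,
    -2 * (k 2 * (starRingEnd ℂ) (k 0)).im, -2 * (k 0 * (starRingEnd ℂ) (k 1)).im]

lemma nullVec_zero (k : Fin 3 → ℂ) : nullVec k 0 = ∑ j, normSq (k j) := rfl

lemma nullVec_smul (μ : ℂ) (k : Fin 3 → ℂ) : nullVec (μ • k) = normSq μ • nullVec k := by
  ext a
  fin_cases a <;> simp [nullVec, normSq_apply, Fin.sum_univ_three] <;> ring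

/-- If k = a + ib, isotropy means |a| = |b| and a ⊥ b. Then `nullVec k` is (|a|² + |b|², 2 a × b),
which is null. -/
lemma re_im_of_isotropic {k : Fin 3 → ℂ} (hk : ∑ j, k j ^ 2 = 0) :
    ((k 0).re ^ 2 + (k 1).re ^ 2 + (k 2).re ^ 2 =
      (k 0).im ^ 2 + (k 1).im ^ 2 + (k 2).im ^ 2) ∧
    (k 0).re * (k 0).im + (k 1).re * (k 1).im + (k 2).re * (k 2).im = 0 := by
  have h := Complex.ext_iff.mp hk
  simp [Fin.sum_univ_three, pow_two] at h
  constructor <;> linarith [h.1, h.2]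

/-- The form has rank one, namely 2H k k* with H the time component. The matrix equation for Debever
vectors thereby reduces to the scalar equation Σ ρ_j k_j² = 0. -/
lemma nullForm_nullVec {k : Fin 3 → ℂ} (hk : ∑ j, k j ^ 2 = 0) (i j : Fin 3) :
    nullForm (nullVec k) i j = 2 * nullVec k 0 * (k i * (starRingEnd ℂ) (k j)) := by
  obtain ⟨h1, h2⟩ := re_im_of_isotropic hk
  apply Complex.ext
  · have key : (nullForm (nullVec k) i j).re - (2 * nullVec k 0 * (k i * (starRingEnd ℂ) (k j))).re =
        ((if i = j then (k 0).re ^ 2 + (k 1).re ^ 2 + (k 2).re ^ 2 -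
            ((k 0).im ^ 2 + (k 1).im ^ 2 + (k 2).im ^ 2) else 0)
          - 2 * (k i).re * (k j).re + 2 * (k i).im * (k j).im) *
          ((k 0).re ^ 2 + (k 1).re ^ 2 + (k 2).re ^ 2 -
            ((k 0).im ^ 2 + (k 1).im ^ 2 + (k 2).im ^ 2)) +
        ((if i = j then
            4 * ((k 0).re * (k 0).im + (k 1).re * (k 1).im + (k 2).re * (k 2).im) else 0)
          - 4 * ((k i).re * (k j).im + (k i).im * (k j).re)) *
          ((k 0).re * (k 0).im + (k 1).re * (k 1).im + (k 2).re * (k 2).im) := by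
      fin_cases i <;> fin_cases j <;>
        simp [nullForm, nullVec, normSq_apply, Fin.sum_univ_three, pow_two] <;> ring
    rw [h2, sub_eq_zero.mpr h1, mul_zero, mul_zero, add_zero] at key
    exact sub_eq_zero.mp key
  · fin_cases i <;> fin_cases j <;>
      simp [nullForm, nullVec, normSq_apply, Fin.sum_univ_three, pow_two] <;>
      first
      | ring1
      | (right; ring1)

lemma metricProd_nullVec {k : Fin 3 → ℂ} (hk : ∑ j, k j ^ 2 = 0) :
    metricProd mink (nullVec k) (nullVec k) = 0 := by
  obtain ⟨h1, h2⟩ := re_im_of_isotropic hk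
  rw [metricProd_mink]
  simp [nullVec, normSq_apply, Fin.sum_univ_three]
  linear_combination -((k 0).re ^ 2 + (k 1).re ^ 2 + (k 2).re ^ 2 -
      ((k 0).im ^ 2 + (k 1).im ^ 2 + (k 2).im ^ 2)) * h1 -
    4 * ((k 0).re * (k 0).im + (k 1).re * (k 1).im + (k 2).re * (k 2).im) * h2

/-- The square of a spatial component of `nullVec k`. -/
lemma nullVec_succ_sq {k : Fin 3 → ℂ} (hk : ∑ j, k j ^ 2 = 0) (j : Fin 3) :
    nullVec k j.succ ^ 2 = nullVec k 0 * (nullVec k 0 - 2 * normSq (k j)) := by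
  have h := congrArg re (nullForm_nullVec hk j j)
  rw [Complex.mul_conj, ← Complex.ofReal_ofNat, ← Complex.ofReal_mul, ← Complex.ofReal_mul,
    Complex.ofReal_re] at h
  have h' : (nullForm (nullVec k) j j).re = nullVec k 0 ^ 2 - nullVec k j.succ ^ 2 := by
    fin_cases j <;> simp [nullForm, pow_two]
  linarith

/-- The columns of `nullForm c` are isotropic. -/
lemma sum_nullForm_sq {c : Vec} (hc : metricProd mink c c = 0) (i : Fin 3) :
    ∑ k, nullForm c k i ^ 2 = 0 := by
  rw [metricProd_mink] at hc
  have hc' : -((c 0 : ℂ) * c 0) + c 1 * c 1 + c 2 * c 2 + c 3 * c 3 = 0 := by exact_mod_cast hc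
  have hI : I ^ 2 = -1 := Complex.I_sq
  rw [Fin.sum_univ_three]
  fin_cases i <;> simp [nullForm]
  · linear_combination ((c 1 : ℂ) ^ 2 - c 0 ^ 2) * hc' + ((c 0 * c 3) ^ 2 +
      (c 0 * c 2) ^ 2 : ℂ) * hI
  · linear_combination ((c 2 : ℂ) ^ 2 - c 0 ^ 2) * hc' + ((c 0 * c 3) ^ 2 +
      (c 0 * c 1) ^ 2 : ℂ) * hI
  · linear_combination ((c 3 : ℂ) ^ 2 - c 0 ^ 2) * hc' + ((c 0 * c 1) ^ 2 +
      (c 0 * c 2) ^ 2 : ℂ) * hI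

/-- Recovers the null vector, up to a factor, from any column of its form for which that factor is
non-zero. -/
lemma nullVec_nullForm {c : Vec} (hc : metricProd mink c c = 0) (i : Fin 3) :
    nullVec (fun k => nullForm c k i) = (2 * c 0 * (c 0 ^ 2 - c i.succ ^ 2)) • c := by
  rw [metricProd_mink] at hc
  have h0 : c 0 ^ 2 = c 1 * c 1 + c 2 * c 2 + c 3 * c 3 := by linarith
  ext a
  fin_cases i <;> fin_cases a <;>
    simp [nullVec, nullForm, normSq_apply, Fin.sum_univ_three, pow_two]
  all_goals first
    | ring1
    | linear_combination (-(c 1 ^ 2 + c 0 ^ 2)) * h0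
    | linear_combination (-(c 2 ^ 2 + c 0 ^ 2)) * h0
    | linear_combination (-(c 3 ^ 2 + c 0 ^ 2)) * h0
    | linear_combination (-2 * c 0 * c 1) * h0
    | linear_combination (-2 * c 0 * c 2) * h0
    | linear_combination (-2 * c 0 * c 3) * h0

/-! ### The null Debever vectors -/

/-- A square root `k` of the differences of the eigenvalues `ρ`. -/
structure IsRootOf (ρ k : Fin 3 → ℂ) : Prop where
  sq (j : Fin 3) : k j ^ 2 = ρ (j + 1) - ρ (j + 2)

/-- Change of the sign of at most one component. -/
def flip (t : Fin 4) (k : Fin 3 → ℂ) : Fin 3 → ℂ := fun j => if t = j.succ then -k j else k j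

namespace IsRootOf

variable {ρ k : Fin 3 → ℂ}

lemma exists_root (ρ : Fin 3 → ℂ) : ∃ k, IsRootOf ρ k := by
  choose k hk using fun j : Fin 3 =>
    IsAlgClosed.exists_pow_nat_eq (ρ (j + 1) - ρ (j + 2)) zero_lt_two
  exact ⟨k, ⟨hk⟩⟩

lemma isotropic (h : IsRootOf ρ k) : ∑ j, k j ^ 2 = 0 := by
  simp only [h.sq, Fin.sum_univ_three]
  simp

lemma weighted (h : IsRootOf ρ k) : ∑ j, ρ j * k j ^ 2 = 0 := by
  simp only [h.sq, Fin.sum_univ_three]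
  simp
  ring

lemma ne_zero (h : IsRootOf ρ k) (hρ : Function.Injective ρ) (j : Fin 3) : k j ≠ 0 := by
  intro h0
  have := h.sq j
  rw [h0, zero_pow two_ne_zero, eq_comm, sub_eq_zero] at this
  have := hρ this
  revert this
  fin_cases j <;> decide

lemma flip (h : IsRootOf ρ k) (t : Fin 4) : IsRootOf ρ (flip t k) := by
  refine ⟨fun j => ?_⟩
  rw [← h.sq, SuperEnergy.flip]
  split_ifs <;> ring

lemma nullVec_zero_pos (h : IsRootOf ρ k) (hρ : Function.Injective ρ) : 0 < nullVec k 0 :=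
  Finset.sum_pos (fun j _ => normSq_pos.mpr (h.ne_zero hρ j)) Finset.univ_nonempty

lemma isDebeverVector (h : IsRootOf ρ k) (hρ : Function.Injective ρ) :
    IsDebeverVector mink (weylOf (Matrix.diagonal ρ)) (nullVec k) := by
  rw [isDebeverVector_weylOf_diagonal_iff]
  refine ⟨fun h0 => (h.nullVec_zero_pos hρ).ne' (congrFun h0 0), metricProd_nullVec h.isotropic,
    fun i j => ?_⟩
  simp only [nullForm_nullVec h.isotropic]
  calc _ = (2 * nullVec k 0 : ℂ) ^ 2 * (starRingEnd ℂ) (k i) * (starRingEnd ℂ) (k j) *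
        ∑ l, ρ l * k l ^ 2 := by
        rw [Finset.mul_sum]
        exact Finset.sum_congr rfl fun _ _ => by ring
    _ = 0 := by rw [h.weighted, mul_zero]

/-- Solutions of the Debever equations are proportional to roots. -/
lemma exists_smul (hρ : Function.Injective ρ) {κ : Fin 3 → ℂ} (hκ : κ ≠ 0)
    (h0 : ∑ j, κ j ^ 2 = 0) (h1 : ∑ j, ρ j * κ j ^ 2 = 0) :
    ∃ μ : ℂ, ∃ k, μ ≠ 0 ∧ IsRootOf ρ k ∧ κ = μ • k := by
  obtain ⟨k, hk⟩ := exists_root ρ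
  have hd := hk.ne_zero hρ
  obtain ⟨μ, hμ⟩ : ∃ μ : ℂ, μ ^ 2 = κ 0 ^ 2 / k 0 ^ 2 := ⟨κ 0 / k 0, by rw [div_pow]⟩
  -- The equations `h0` and `h1` are linear in the squares. As the `ρ j` are distinct, the solutions
  -- form a line, spanned by the cross product of (1, 1, 1) and ρ, whose entries are up to sign the
  -- `k j ^ 2`.
  have hl : ∀ j, κ j ^ 2 = μ ^ 2 * k j ^ 2 := by
    rw [hμ]
    have s0 := hk.sq 0
    have s1 := hk.sq 1
    have s2 := hk.sq 2
    simp [Fin.sum_univ_three] at h0 h1 s0 s1 s2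
    have d0 := pow_ne_zero 2 (hd 0)
    intro j
    rw [div_mul_eq_mul_div, eq_div_iff d0]
    fin_cases j <;> simp
    · rw [s0, s1]
      linear_combination h1 - ρ 2 * h0
    · rw [s0, s2]
      linear_combination ρ 1 * h0 - h1
  have hμ0 : μ ≠ 0 := by
    rintro rfl
    refine hκ (funext fun j => ?_)
    have := hl j
    simpa using this
  refine ⟨μ, μ⁻¹ • κ, hμ0, ⟨fun j => ?_⟩, by rw [smul_smul, mul_inv_cancel₀ hμ0, one_smul]⟩
  rw [← hk.sq, Pi.smul_apply, smul_eq_mul, mul_pow, hl, inv_pow,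
    inv_mul_cancel_left₀ (pow_ne_zero 2 hμ0)]

/-- Two roots differ by signs of the components, and an overall sign does not change the null
vector; the eight choices leave four vectors. -/
lemma exists_nullVec_eq (h : IsRootOf ρ k) {k' : Fin 3 → ℂ} (h' : IsRootOf ρ k') :
    ∃ t, nullVec k' = nullVec (SuperEnergy.flip t k) := by
  have hs : ∀ j, k' j = k j ∨ k' j = -k j :=
    fun j => sq_eq_sq_iff_eq_or_eq_neg.mp (by rw [h.sq, h'.sq])
  have e : ∀ l : Fin 3 → ℂ, l = ![l 0, l 1, l 2] := fun l => by
    ext j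
    fin_cases j <;> rfl
  have key : ∃ t, k' = SuperEnergy.flip t k ∨ k' = -SuperEnergy.flip t k := by
    rw [e k']
    rcases hs 0 with h0 | h0 <;> rcases hs 1 with h1 | h1 <;> rcases hs 2 with h2 | h2 <;>
      rw [h0, h1, h2]
    exacts [⟨0, .inl (by ext j; fin_cases j <;> simp [SuperEnergy.flip])⟩,
      ⟨3, .inl (by ext j; fin_cases j <;> simp [SuperEnergy.flip])⟩,
      ⟨2, .inl (by ext j; fin_cases j <;> simp [SuperEnergy.flip])⟩,
      ⟨1, .inr (by ext j; fin_cases j <;> simp [SuperEnergy.flip])⟩,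
      ⟨1, .inl (by ext j; fin_cases j <;> simp [SuperEnergy.flip])⟩,
      ⟨2, .inr (by ext j; fin_cases j <;> simp [SuperEnergy.flip])⟩,
      ⟨3, .inr (by ext j; fin_cases j <;> simp [SuperEnergy.flip])⟩,
      ⟨0, .inr (by ext j; fin_cases j <;> simp [SuperEnergy.flip])⟩]
  obtain ⟨t, ht | ht⟩ := key
  · exact ⟨t, by rw [ht]⟩
  · refine ⟨t, ?_⟩
    rw [ht, ← neg_one_smul ℂ, nullVec_smul]
    simp

lemma exists_of_isDebeverVector (h : IsRootOf ρ k) (hρ : Function.Injective ρ) {c : Vec}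
    (hc : IsDebeverVector mink (weylOf (Matrix.diagonal ρ)) c) :
    ∃ t, ∃ r : ℝ, r ≠ 0 ∧ r • c = nullVec (SuperEnergy.flip t k) := by
  obtain ⟨hc0, hn, hd⟩ := (isDebeverVector_weylOf_diagonal_iff ρ c).mp hc
  have hn' := hn
  rw [metricProd_mink] at hn'
  have hne : c 0 ≠ 0 := by
    intro h0
    refine hc0 (funext fun a => ?_)
    have : c 1 * c 1 + c 2 * c 2 + c 3 * c 3 = 0 := by
      rw [h0] at hn'
      linarith
    fin_cases a <;> simp <;>
      nlinarith [mul_self_nonneg (c 1), mul_self_nonneg (c 2), mul_self_nonneg (c 3)]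
  -- The three differences add up to 2 c_0², which is non-zero.
  obtain ⟨i, hi⟩ : ∃ i : Fin 3, c 0 ^ 2 - c i.succ ^ 2 ≠ 0 := by
    by_contra! hall
    have a1 := hall 0
    have a2 := hall 1
    have a3 := hall 2
    simp at a1 a2 a3
    exact hne (pow_eq_zero_iff two_ne_zero |>.mp (by linarith))
  have hκ : (fun k => nullForm c k i) ≠ 0 := by
    intro h0
    have : nullForm c i i = 0 := congrFun h0 i
    apply hi
    have e : nullForm c i i = ((c 0 ^ 2 - c i.succ ^ 2 : ℝ) : ℂ) := by
      fin_cases i <;> simp [nullForm]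
    rw [e] at this
    exact_mod_cast this
  obtain ⟨μ, k', hμ, hk', e⟩ := exists_smul hρ hκ (sum_nullForm_sq hn i) (by
    simpa [pow_two, mul_assoc] using hd i i)
  obtain ⟨t, ht⟩ := h.exists_nullVec_eq hk'
  have h1 := nullVec_nullForm hn i
  rw [e, nullVec_smul, ht] at h1
  have hm : normSq μ ≠ 0 := (normSq_pos.mpr hμ).ne'
  refine ⟨t, (normSq μ)⁻¹ * (2 * c 0 * (c 0 ^ 2 - c i.succ ^ 2)), by positivity, ?_⟩
  rw [mul_smul, ← h1, smul_smul, inv_mul_cancel₀ hm, one_smul]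

end IsRootOf

end SuperEnergy

namespace SuperEnergy

open Matrix Complex

/-! ### The span of the null Debever vectors -/

lemma nullVec_flip_zero (t : Fin 4) (k : Fin 3 → ℂ) :
    nullVec (flip t k) 0 = nullVec k 0 := by
  simp only [nullVec_zero, flip]
  refine Finset.sum_congr rfl fun j _ => ?_
  split_ifs <;> simp

/-- Changing the sign of one component of `k` reverses the two spatial components in which it is a
factor. -/
lemma nullVec_flip_succ (t : Fin 4) (k : Fin 3 → ℂ) (j : Fin 3) :
    nullVec (flip t k) j.succ =
      if t = 0 ∨ t = j.succ then nullVec k j.succ else -nullVec k j.succ := by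
  fin_cases t <;> fin_cases j <;> simp [nullVec, flip] <;> ring

namespace IsRootOf

variable {ρ k : Fin 3 → ℂ}

/-- At most one spatial component of `nullVec k` vanishes. -/
lemma eq_of_nullVec_eq_zero (h : IsRootOf ρ k) (hρ : Function.Injective ρ) {i j : Fin 3}
    (hi : nullVec k i.succ = 0) (hj : nullVec k j.succ = 0) : i = j := by
  have hH := h.nullVec_zero_pos hρ
  -- A vanishing spatial component makes one `normSq (k l)` equal to the sum of the other two. If
  -- this happened for two indices, the third would be zero.
  have key : ∀ l, nullVec k l.succ = 0 → nullVec k 0 = 2 * normSq (k l) := by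
    intro l hl
    have := nullVec_succ_sq h.isotropic l
    rw [hl, zero_pow two_ne_zero, eq_comm, mul_eq_zero] at this
    rcases this with h0 | h0 <;> linarith
  have h1 := key i hi
  have h2 := key j hj
  have p := fun l => normSq_pos.mpr (h.ne_zero hρ l)
  have p0 := p 0
  have p1 := p 1
  have p2 := p 2
  rw [nullVec_zero, Fin.sum_univ_three] at h1 h2
  fin_cases i <;> fin_cases j <;> simp at h1 h2 ⊢ <;> linarith

/-- All four vectors have the same positive time component, so equal lines force equal vectors. For
two different flips this would make two spatial components vanish. -/
lemma flip_injective (h : IsRootOf ρ k) (hρ : Function.Injective ρ) :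
    Function.Injective fun t => Submodule.span ℝ {nullVec (SuperEnergy.flip t k)} := by
  intro t t' ht
  have hH := h.nullVec_zero_pos hρ
  have hmem : nullVec (SuperEnergy.flip t k) ∈
      Submodule.span ℝ {nullVec (SuperEnergy.flip t' k)} := by
    rw [← show _ = Submodule.span ℝ {nullVec (SuperEnergy.flip t' k)} from ht]
    exact Submodule.mem_span_singleton_self _
  obtain ⟨r, hr⟩ := Submodule.mem_span_singleton.mp hmem
  have hr1 : r = 1 := by
    have := congrFun hr 0
    rw [Pi.smul_apply, smul_eq_mul, nullVec_flip_zero, nullVec_flip_zero] at this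
    exact mul_right_cancel₀ hH.ne' (by rw [this, one_mul])
  rw [hr1, one_smul] at hr
  have e := fun j : Fin 3 => congrFun hr j.succ
  simp only [nullVec_flip_succ] at e
  by_contra hne
  have key : ∃ i j : Fin 3, i ≠ j ∧ nullVec k i.succ = 0 ∧ nullVec k j.succ = 0 := by
    have e0 := e 0
    have e1 := e 1
    have e2 := e 2
    have z : ∀ x : ℝ, x = -x → x = 0 := fun x hx => by linarith
    have z' : ∀ x : ℝ, -x = x → x = 0 := fun x hx => by linarith
    fin_cases t <;> fin_cases t' <;> simp at e0 e1 e2 hne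
    all_goals first
      | exact ⟨0, 1, by decide, by first | exact z _ e0 | exact z' _ e0 | simpa using e0,
          by first | exact z _ e1 | exact z' _ e1 | simpa using e1⟩
      | exact ⟨0, 2, by decide, by first | exact z _ e0 | exact z' _ e0 | simpa using e0,
          by first | exact z _ e2 | exact z' _ e2⟩
      | exact ⟨1, 2, by decide, by first | exact z _ e1 | exact z' _ e1,
          by first | exact z _ e2 | exact z' _ e2⟩
  obtain ⟨i, j, hij, hi, hj⟩ := key
  exact hij (h.eq_of_nullVec_eq_zero hρ hi hj)

/-- The four vectors sum to 4H e_0, and the vectors for the flips `0` and `j.succ` sum to 2H e_0 + 2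
x e_j, where x is the jth spatial component of `nullVec k`. Thus e_0, and each e_j with x ≠ 0, lie
in the span. -/
lemma mem_span_iff (h : IsRootOf ρ k) (hρ : Function.Injective ρ) (c : Vec) :
    c ∈ Submodule.span ℝ (Set.range fun t => nullVec (SuperEnergy.flip t k)) ↔
      ∀ j : Fin 3, nullVec k j.succ = 0 → c j.succ = 0 := by
  set S := Submodule.span ℝ (Set.range fun t => nullVec (SuperEnergy.flip t k)) with hS
  have hmem : ∀ t, nullVec (SuperEnergy.flip t k) ∈ S := fun t => Submodule.subset_span ⟨t, rfl⟩
  refine ⟨fun hc j hj => ?_, fun hc => ?_⟩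
  · have : S ≤ LinearMap.ker (LinearMap.proj j.succ : Vec →ₗ[ℝ] ℝ) := by
      rw [hS, Submodule.span_le]
      rintro _ ⟨t, rfl⟩
      simp [nullVec_flip_succ, hj]
    exact this hc
  · have h0 : (Pi.single 0 1 : Vec) ∈ S := by
      have e : (Pi.single 0 1 : Vec) =
          (4 * nullVec k 0)⁻¹ • ∑ t, nullVec (SuperEnergy.flip t k) := by
        have hH := (h.nullVec_zero_pos hρ).ne'
        ext a
        refine Fin.cases ?_ (fun j => ?_) a
        · simp only [Pi.smul_apply, Finset.sum_apply, nullVec_flip_zero]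
          simp
          field_simp
        · simp only [Pi.smul_apply, Finset.sum_apply, nullVec_flip_succ]
          rw [Fin.sum_univ_four]
          fin_cases j <;> simp
      rw [e]
      exact S.smul_mem _ (S.sum_mem fun t _ => hmem t)
    have h1 : ∀ j : Fin 3, nullVec k j.succ ≠ 0 → (Pi.single j.succ 1 : Vec) ∈ S := by
      intro j hj
      have e : (Pi.single j.succ 1 : Vec) =
          (2 * nullVec k j.succ)⁻¹ • (nullVec (SuperEnergy.flip 0 k) +
            nullVec (SuperEnergy.flip j.succ k)) -
            (nullVec k 0 * (nullVec k j.succ)⁻¹) • Pi.single 0 1 := by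
        ext a
        refine Fin.cases ?_ (fun i => ?_) a
        · simp [nullVec_flip_zero]
          field_simp
          ring
        · simp only [Pi.sub_apply, Pi.add_apply, Pi.smul_apply, nullVec_flip_succ]
          by_cases hij : i = j
          · subst hij
            simp
            field_simp
            ring
          · have : j ≠ i := fun h => hij h.symm
            simp [hij, this]
      rw [e]
      exact S.sub_mem (S.smul_mem _ (S.add_mem (hmem _) (hmem _))) (S.smul_mem _ h0)
    have e : c = c 0 • Pi.single 0 1 + ∑ j : Fin 3, c j.succ • (Pi.single j.succ 1 : Vec) := by
      ext a
      rw [Fin.sum_univ_three]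
      fin_cases a <;> simp
    rw [e]
    refine S.add_mem (S.smul_mem _ h0) (S.sum_mem fun j _ => ?_)
    by_cases hj : nullVec k j.succ = 0
    · rw [hc j hj, zero_smul]
      exact S.zero_mem
    · exact S.smul_mem _ (h1 j hj)

lemma finrank_span_eq_three_iff (h : IsRootOf ρ k) (hρ : Function.Injective ρ) :
    Module.finrank ℝ (Submodule.span ℝ (Set.range fun t => nullVec (SuperEnergy.flip t k))) = 3 ↔
      ∃ j : Fin 3, nullVec k j.succ = 0 := by
  refine ⟨fun h3 => ?_, ?_⟩
  · by_contra! hne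
    have : Submodule.span ℝ (Set.range fun t => nullVec (SuperEnergy.flip t k)) = ⊤ := by
      rw [eq_top_iff]
      exact fun c _ => (h.mem_span_iff hρ c).mpr fun j hj => absurd hj (hne j)
    rw [this, finrank_top] at h3
    simp at h3
  · rintro ⟨j, hj⟩
    have : Submodule.span ℝ (Set.range fun t => nullVec (SuperEnergy.flip t k)) =
        LinearMap.ker (LinearMap.proj j.succ : Vec →ₗ[ℝ] ℝ) := by
      ext c
      rw [h.mem_span_iff hρ, LinearMap.mem_ker, LinearMap.proj_apply]
      refine ⟨fun hc => hc j hj, fun hc i hi => ?_⟩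
      rw [h.eq_of_nullVec_eq_zero hρ hi hj, hc]
    have h1 := (LinearMap.proj j.succ : Vec →ₗ[ℝ] ℝ).finrank_range_add_finrank_ker
    rw [LinearMap.range_eq_top.mpr (LinearMap.proj_surjective _), finrank_top,
      Module.finrank_self, Module.finrank_fin_fun] at h1
    rw [this]
    exact Nat.add_left_cancel (h1 : 1 + _ = 1 + 3)

/-! ### Collinear eigenvalues -/

/-- With z = k_1 conj k_2, the first spatial component is -2 Im z and the product of the other two
is -2H Re z. The product of all three is therefore 2H Im z², and z² = (ρ_2 - ρ_0) conj(ρ_0 - ρ_1)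
has imaginary part 3 Im(ρ_0 conj ρ_1). -/
lemma prod_nullVec (h : IsRootOf ρ k) (hs : ∑ j, ρ j = 0) :
    nullVec k 1 * nullVec k 2 * nullVec k 3 =
      6 * nullVec k 0 * (ρ 0 * (starRingEnd ℂ) (ρ 1)).im := by
  have h1 := congrArg re (nullForm_nullVec h.isotropic 1 2)
  have h1' : -(nullVec k 2 * nullVec k 3) =
      2 * nullVec k 0 * (k 1 * (starRingEnd ℂ) (k 2)).re := by
    rw [← Complex.ofReal_ofNat, ← Complex.ofReal_mul, Complex.re_ofReal_mul] at h1
    rw [← h1]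
    simp [nullForm]
  have s1 := h.sq 1
  have s2 := h.sq 2
  have h2 : ρ 2 = -ρ 0 - ρ 1 := by
    rw [Fin.sum_univ_three] at hs
    linear_combination hs
  simp at s1 s2
  have e1 : ((k 1 * (starRingEnd ℂ) (k 2)) ^ 2).im = 3 * (ρ 0 * (starRingEnd ℂ) (ρ 1)).im := by
    rw [mul_pow, ← map_pow, s1, s2, h2]
    simp
    ring
  have e2 : ((k 1 * (starRingEnd ℂ) (k 2)) ^ 2).im =
      2 * (k 1 * (starRingEnd ℂ) (k 2)).re * (k 1 * (starRingEnd ℂ) (k 2)).im := by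
    rw [pow_two, Complex.mul_im]
    ring
  have h3 : nullVec k 1 = -2 * (k 1 * (starRingEnd ℂ) (k 2)).im := rfl
  rw [e1] at e2
  linear_combination -nullVec k 1 * h1' - 2 * nullVec k 0 * e2 +
    2 * nullVec k 0 * (k 1 * (starRingEnd ℂ) (k 2)).re * -h3

lemma im_eq_zero_iff (h : IsRootOf ρ k) (hρ : Function.Injective ρ) (hs : ∑ j, ρ j = 0) :
    (ρ 0 * (starRingEnd ℂ) (ρ 1)).im = 0 ↔ ∃ j : Fin 3, nullVec k j.succ = 0 := by
  have hH := h.nullVec_zero_pos hρ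
  have e := h.prod_nullVec hs
  have : (ρ 0 * (starRingEnd ℂ) (ρ 1)).im = 0 ↔ nullVec k 1 * nullVec k 2 * nullVec k 3 = 0 := by
    rw [e]
    simp [hH.ne']
  rw [this, mul_eq_zero, mul_eq_zero, Fin.exists_fin_succ, Fin.exists_fin_two, or_assoc]
  rfl

/-- The product k_{j+1} conj k_{j+2} is real, so its square (ρ_{j+2} - ρ_j) conj(ρ_j - ρ_{j+1}) is
non-negative: ρ_j lies between the other two eigenvalues. As these are distinct and all three sum to
zero, ρ_j is strictly the smallest in modulus. -/
lemma normSq_lt (h : IsRootOf ρ k) (hρ : Function.Injective ρ) (hs : ∑ j, ρ j = 0) {j : Fin 3}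
    (hj : nullVec k j.succ = 0) {i : Fin 3} (hi : i ≠ j) : normSq (ρ j) < normSq (ρ i) := by
  have him : (k (j + 1) * (starRingEnd ℂ) (k (j + 2))).im = 0 := by
    fin_cases j <;> simp [nullVec] at hj ⊢ <;> linarith
  have hre : 0 ≤ ((k (j + 1) * (starRingEnd ℂ) (k (j + 2))) ^ 2).re := by
    rw [pow_two, Complex.mul_re, him, mul_zero, sub_zero]
    exact mul_self_nonneg _
  have p1 := normSq_pos.mpr (pow_ne_zero 2 (h.ne_zero hρ (j + 1)))
  have p2 := normSq_pos.mpr (pow_ne_zero 2 (h.ne_zero hρ (j + 2)))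
  rw [mul_pow, ← map_pow] at hre
  rw [h.sq] at p1 p2
  rw [h.sq, h.sq] at hre
  have h2 : ρ 2 = -ρ 0 - ρ 1 := by
    rw [Fin.sum_univ_three] at hs
    linear_combination hs
  fin_cases j <;> fin_cases i <;> simp [h2, normSq_apply] at hi p1 p2 hre ⊢ <;> nlinarith

end IsRootOf

end SuperEnergy

/-! ### Transport from the canonical frame and conclusion. -/

namespace SuperEnergy

open Matrix Complex

namespace IsCanonicalFrame

variable {g Λ : Matrix (Fin 4) (Fin 4) ℝ} {W : Tensor4} {ρ k : Fin 3 → ℂ}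

lemma exists_mulVec_eq (h : IsCanonicalFrame g W Λ ρ) (w : Vec) : ∃ v, Λ *ᵥ v = w := by
  refine ⟨Λ⁻¹ *ᵥ w, ?_⟩
  rw [Matrix.mulVec_mulVec, Matrix.mul_nonsing_inv _ (Ne.isUnit h.isFrame.det_ne_zero),
    Matrix.one_mulVec]

lemma mulVecLin_injective (h : IsCanonicalFrame g W Λ ρ) :
    Function.Injective (Matrix.mulVecLin Λ) :=
  Matrix.mulVec_injective_of_isUnit
    ((Matrix.isUnit_iff_isUnit_det _).mpr (Ne.isUnit h.isFrame.det_ne_zero))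

lemma debeverDirections_eq (h : IsCanonicalFrame g W Λ ρ) (hk : IsRootOf ρ k) :
    debeverDirections g W = Set.range fun t => (Submodule.span ℝ {nullVec (flip t k)}).map
      (Matrix.mulVecLin Λ) := by
  have hd := h.isFrame.isDebeverVector_iff W
  rw [h.pull_eq] at hd
  ext L
  constructor
  · rintro ⟨ℓ, hℓ, rfl⟩
    obtain ⟨v, e⟩ := h.exists_mulVec_eq ℓ
    rw [← e, hd] at hℓ
    obtain ⟨t, r, hr, hrt⟩ := hk.exists_of_isDebeverVector h.injective hℓ
    refine ⟨t, ?_⟩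
    simp only [← hrt, Submodule.map_span, Set.image_singleton, map_smul, Matrix.mulVecLin_apply, e]
    exact Submodule.span_singleton_smul_eq (Ne.isUnit hr) ℓ
  · rintro ⟨t, rfl⟩
    refine ⟨Λ *ᵥ nullVec (flip t k), (hd _).mpr ((hk.flip t).isDebeverVector h.injective), ?_⟩
    simp [Submodule.map_span]

lemma ncard_debeverDirections (h : IsCanonicalFrame g W Λ ρ) (hk : IsRootOf ρ k) :
    (debeverDirections g W).ncard = 4 := by
  rw [h.debeverDirections_eq hk, ← Set.image_univ, Set.ncard_image_of_injective, Set.ncard_univ,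
    Nat.card_fin]
  exact (Submodule.map_injective_of_injective h.mulVecLin_injective).comp
    (hk.flip_injective h.injective)

lemma debeverSpan_eq (h : IsCanonicalFrame g W Λ ρ) (hk : IsRootOf ρ k) :
    debeverSpan g W = (Submodule.span ℝ (Set.range fun t => nullVec (flip t k))).map
      (Matrix.mulVecLin Λ) := by
  rw [debeverSpan, h.debeverDirections_eq hk, sSup_range, ← Submodule.map_iSup,
    ← Submodule.span_range_eq_iSup]

lemma finrank_debeverSpan (h : IsCanonicalFrame g W Λ ρ) (hk : IsRootOf ρ k) :
    Module.finrank ℝ (debeverSpan g W) = 3 ↔ ∃ j : Fin 3, nullVec k j.succ = 0 := by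
  rw [h.debeverSpan_eq hk,
    (Submodule.equivMapOfInjective _ h.mulVecLin_injective _).finrank_eq.symm,
    hk.finrank_span_eq_three_iff h.injective]

/-- The time axis of a canonical frame is an observer at rest. -/
lemma isAtRest (h : IsCanonicalFrame g W Λ ρ) : IsAtRest g W fun a => Λ a 0 := by
  refine ⟨h.isFrame.isObserver fun _ => rfl, ?_⟩
  rw [h.isFrame.superPoynting_eq_zero_iff fun _ => rfl, h.pull_eq]
  exact superPoynting_weylOf_diagonal ρ

lemma mem_superStressEigenspace_iff (h : IsCanonicalFrame g W Λ ρ) {u : Vec} (hu : ∀ a, Λ a 0 = u a)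
    (κ : ℝ) (v : Vec) : Λ *ᵥ v ∈ superStressEigenspace g W u κ ↔ v 0 = 0 ∧ ∀ i : Fin 3,
      v i.succ ≠ 0 → κ = 1 / 4 * (∑ k, normSq (ρ k)) - 1 / 2 * normSq (ρ i) := by
  rw [h.isFrame.mem_superStressEigenspace_iff hu W, h.pull_eq]
  refine and_congr_right fun _ => ?_
  have e : ∀ i : Fin 3, ∑ j ∈ {1, 2, 3},
      belRobinson mink (weylOf (Matrix.diagonal ρ)) i.succ j 0 0 * v j =
        (1 / 4 * (∑ k, normSq (ρ k)) - 1 / 2 * normSq (ρ i)) * v i.succ := by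
    intro i
    have : ({1, 2, 3} : Finset (Fin 4)) = Finset.univ.map (Fin.succEmb 3) := by decide
    rw [this, Finset.sum_map]
    simp [superStress_weylOf_diagonal]
  constructor
  · intro hv i hi
    have := hv i.succ (Fin.succ_ne_zero i)
    rw [e] at this
    exact (mul_right_cancel₀ hi this).symm
  · intro hv i hi
    obtain ⟨i, rfl⟩ := Fin.exists_succ_eq.mpr hi
    rw [e]
    by_cases h0 : v i.succ = 0
    · rw [h0, mul_zero, mul_zero]
    · rw [hv i h0]

/-- In the canonical frame the 3-plane is the coordinate hyperplane on which the jth spatial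
component vanishes. -/
lemma mem_orthogonalSpace_iff (h : IsCanonicalFrame g W Λ ρ) (hk : IsRootOf ρ k) {j : Fin 3}
    (hj : nullVec k j.succ = 0) (v : Vec) :
    Λ *ᵥ v ∈ orthogonalSpace g (debeverSpan g W) ↔ v 0 = 0 ∧ ∀ i : Fin 3, i ≠ j → v i.succ = 0 := by
  have h0 : Λ *ᵥ v ∈ orthogonalSpace g (debeverSpan g W) ↔
      ∀ c : Vec, c j.succ = 0 → metricProd mink c v = 0 := by
    rw [h.debeverSpan_eq hk]
    have hS : ∀ c : Vec, c ∈ Submodule.span ℝ (Set.range fun t => nullVec (flip t k)) ↔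
        c j.succ = 0 := fun c => by
      rw [hk.mem_span_iff h.injective]
      refine ⟨fun hc => hc j hj, fun hc i hi => ?_⟩
      rw [hk.eq_of_nullVec_eq_zero h.injective hi hj, hc]
    constructor
    · intro hv c hc
      rw [← h.isFrame.metricProd]
      exact hv _ (Submodule.mem_map_of_mem ((hS c).mpr hc))
    · rintro hv _ ⟨c, hc, rfl⟩
      rw [Matrix.mulVecLin_apply, h.isFrame.metricProd]
      exact hv c ((hS c).mp hc)
  rw [h0]
  simp only [metricProd_mink]
  constructor
  · intro hv
    refine ⟨?_, fun i hi => ?_⟩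
    · simpa using hv (Pi.single 0 1) (by simp)
    · have := hv (Pi.single i.succ 1) (by simp [hi.symm])
      revert this
      fin_cases i <;> simp
  · rintro ⟨hv0, hv⟩ c hc
    have e : ∀ i : Fin 3, c i.succ * v i.succ = 0 := by
      intro i
      by_cases hi : i = j
      · rw [hi, hc, zero_mul]
      · rw [hv i hi, mul_zero]
    have e1 : c 1 * v 1 = 0 := e 0
    have e2 : c 2 * v 2 = 0 := e 1
    have e3 : c 3 * v 3 = 0 := e 2
    rw [hv0, e1, e2, e3]
    ring

end IsCanonicalFrame

/-- An observer who measures no stress flux is at rest. -/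
lemma IsFrame.isAtRest_of_stressFlux_eq_zero {g Λ : Matrix (Fin 4) (Fin 4) ℝ} {W : Tensor4}
    (h : IsFrame g Λ) (hW : IsWeylTensor g W) {u : Vec} (hu : IsObserver g u)
    (hQ : ∀ a b c, stressFlux g W u a b c = 0) : IsAtRest g W u := by
  obtain ⟨Λ', h', -, hu'⟩ := h.exists_of_observer hu
  obtain ⟨e, hs, -⟩ := (h'.isWeylTensor hW).eq_weylOf
  refine ⟨hu, (h'.superPoynting_eq_zero_iff hu' W).mpr fun i hi => ?_⟩
  have hf := (h'.stressFlux_eq_zero_iff hu' W).mp hQ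
  rw [e] at hf ⊢
  rw [← belRobinson_weylOf_spatial_trace _ hs]
  refine Finset.sum_eq_zero fun a ha => hf a a i ?_ ?_ hi <;>
  · rintro rfl
    simp at ha

lemma IsCanonicalFrame.not_isSuperEnergyRadiative_iff {g Λ : Matrix (Fin 4) (Fin 4) ℝ} {W : Tensor4}
    {ρ : Fin 3 → ℂ} (h : IsCanonicalFrame g W Λ ρ) (hW : IsWeylTensor g W)
    (hI : IsTypeI g W) :
    ¬ IsSuperEnergyRadiative g W ↔ Module.finrank ℝ (debeverSpan g W) = 3 := by
  -- This holds for every canonical frame. An observer with zero stress flux is at rest, hence the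
  -- time axis of one, which gives one implication; the time axis of the given frame gives the
  -- other.
  have key : ∀ {Λ' : Matrix (Fin 4) (Fin 4) ℝ} {ρ' : Fin 3 → ℂ} {u : Vec},
      IsCanonicalFrame g W Λ' ρ' → (∀ a, Λ' a 0 = u a) →
      ((∀ a b c, stressFlux g W u a b c = 0) ↔ Module.finrank ℝ (debeverSpan g W) = 3) := by
    intro Λ' ρ' u h' hu
    obtain ⟨k', hk'⟩ := IsRootOf.exists_root ρ'
    rw [h'.finrank_debeverSpan hk', ← hk'.im_eq_zero_iff h'.injective h'.sum_eq_zero,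
      h'.isFrame.stressFlux_eq_zero_iff hu W, h'.pull_eq,
      stressFlux_weylOf_diagonal ρ' h'.sum_eq_zero]
  simp only [IsSuperEnergyRadiative]
  push Not
  constructor
  · rintro ⟨u, hu, hQ⟩
    obtain ⟨Λ', ρ', h', hu'⟩ := h.isFrame.exists_canonicalFrame_of_isAtRest hW hI
      (h.isFrame.isAtRest_of_stressFlux_eq_zero hW hu hQ)
    exact (key h' hu').mp hQ
  · intro h3
    exact ⟨fun a => Λ a 0, h.isAtRest.1, (key h fun _ => rfl).mpr h3⟩

/-- The largest of the diagonal entries ¼ Σ|ρ_k|² - ½|ρ_i|² belongs to the eigenvalue of smallest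
modulus, which `normSq_lt` places in the direction normal to the 3-plane. Strictness makes the
eigenspace no larger than this line. -/
lemma IsCanonicalFrame.superStress_eigenspace {g Λ : Matrix (Fin 4) (Fin 4) ℝ} {W : Tensor4}
    {ρ : Fin 3 → ℂ} (h : IsCanonicalFrame g W Λ ρ) {u : Vec} (hu : ∀ a, Λ a 0 = u a)
    (h3 : Module.finrank ℝ (debeverSpan g W) = 3) :
    ∃ κ : ℝ, IsGreatest (principalSuperStresses g W u) κ ∧
      superStressEigenspace g W u κ = orthogonalSpace g (debeverSpan g W) := by
  obtain ⟨k, hk⟩ := IsRootOf.exists_root ρ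
  obtain ⟨j, hj⟩ := (h.finrank_debeverSpan hk).mp h3
  have hlt := fun i => hk.normSq_lt h.injective h.sum_eq_zero hj (i := i)
  refine ⟨1 / 4 * (∑ k, normSq (ρ k)) - 1 / 2 * normSq (ρ j), ⟨?_, ?_⟩, ?_⟩
  · intro hbot
    have hm : Λ *ᵥ Pi.single j.succ 1 ∈ superStressEigenspace g W u
        (1 / 4 * (∑ k, normSq (ρ k)) - 1 / 2 * normSq (ρ j)) := by
      rw [h.mem_superStressEigenspace_iff hu]
      refine ⟨by simp [(Fin.succ_ne_zero j).symm], fun i hi => ?_⟩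
      obtain rfl : i = j := by
        by_contra hij
        exact hi (by simp [hij])
      rfl
    rw [hbot, Submodule.mem_bot] at hm
    have := congrFun (Matrix.eq_zero_of_mulVec_eq_zero h.isFrame.det_ne_zero hm) j.succ
    simp at this
  · intro κ hκ
    obtain ⟨w, hw, hw0⟩ := Submodule.exists_mem_ne_zero_of_ne_bot hκ
    obtain ⟨v, rfl⟩ := h.exists_mulVec_eq w
    obtain ⟨hv0, hv⟩ := (h.mem_superStressEigenspace_iff hu κ v).mp hw
    obtain ⟨i, hi⟩ : ∃ i : Fin 3, v i.succ ≠ 0 := by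
      by_contra! hall
      refine hw0 ?_
      have : v = 0 := by
        ext a
        exact Fin.cases hv0 hall a
      rw [this, Matrix.mulVec_zero]
    rw [hv i hi]
    by_cases hij : i = j
    · rw [hij]
    · linarith [hlt i hij]
  · ext w
    obtain ⟨v, rfl⟩ := h.exists_mulVec_eq w
    rw [h.mem_superStressEigenspace_iff hu, h.mem_orthogonalSpace_iff hk hj]
    refine and_congr_right fun _ => forall_congr' fun i => ?_
    by_cases hij : i = j
    · simp [hij]
    · refine ⟨fun hv _ => ?_, fun hv hi => absurd (hv hij) hi⟩
      by_contra hi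
      linarith [hv hi, hlt i hij]

end SuperEnergy

open SuperEnergy in
theorem mainTheorem6 {M : Type*} [TopologicalSpace M] [ChartedSpace E4 M]
    [IsManifold (𝓡 4) ∞ M] (g : LorentzMetric M) (p : M)
    (hI : IsTypeI (g.metricAt p) (g.weylAt p)) :
    (debeverDirections (g.metricAt p) (g.weylAt p)).ncard = 4 ∧
    (¬ IsSuperEnergyRadiative (g.metricAt p) (g.weylAt p) ↔
      Module.finrank ℝ (debeverSpan (g.metricAt p) (g.weylAt p)) = 3) ∧
    (Module.finrank ℝ (debeverSpan (g.metricAt p) (g.weylAt p)) = 3 →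
      (∃ u : Vec, IsAtRest (g.metricAt p) (g.weylAt p) u) ∧
      ∀ u : Vec, IsAtRest (g.metricAt p) (g.weylAt p) u →
        ∃ κ : ℝ, IsGreatest (principalSuperStresses (g.metricAt p) (g.weylAt p) u) κ ∧
          superStressEigenspace (g.metricAt p) (g.weylAt p) u κ =
            orthogonalSpace (g.metricAt p) (debeverSpan (g.metricAt p) (g.weylAt p))) := by
  have hW : IsWeylTensor (g.metricAt p) (g.weylAt p) :=
    g.isWeylTensor_weyl p (mem_extChartAt_target p)
  obtain ⟨Λ₀, h0⟩ := g.exists_frame_comp p (mem_extChartAt_target p)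
  have hf : IsFrame (g.metricAt p) Λ₀ := h0
  obtain ⟨Λ, ρ, h⟩ := hf.exists_canonicalFrame hW hI
  obtain ⟨k, hk⟩ := IsRootOf.exists_root ρ
  refine ⟨h.ncard_debeverDirections hk, h.not_isSuperEnergyRadiative_iff hW hI,
    fun h3 => ⟨⟨_, h.isAtRest⟩, fun u hu => ?_⟩⟩
  obtain ⟨Λ', ρ', h', hu'⟩ := hf.exists_canonicalFrame_of_isAtRest hW hI hu
  exact h'.superStress_eigenspace hu' h3
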